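/- For a measurable set $\Omega\subset\mathbb{R}^3$ let $|\Omega|$ be its Lebesgue measure, $$P(\Omega)=\sup\Big\{\int_\Omega \operatorname{div}X\,dx : X\in C^1_c(\mathbb{R}^3;\mathbb{R}^3),\ |X|\le 1\Big\}$$ its perimeter, and $$D(\Omega)=\frac12\int_\Omega\int_\Omega\frac{dy\,dx}{|x-y|},\qquad D^\partial(\Omega)=\int_{\partial\Omega}\int_\Omega\frac{dy}{|x-y|}\,dA(x),$$ where $dA$ is the surface area measure (two-dimensional Hausdorff measure) on $\partial\Omega$. **Theorem.** Let $\Omega\subset\mathbb{R}^3$ be a non-empty compact set with smooth boundary, i.e. every $p\in\partial\Omega$ has an open neighbourhood $U$ with a $C^\infty$ function $\varphi:U\to\mathbb{R}$ such that $d\varphi(p)\neq0$ and $\Omega\cap U=\{x\in U:\varphi(x)\le 0\}$. Then $P(\Omega)$, $D(\Omega)$ and $D^\partial(\Omega)$ are finite, $$|\Omega|^3<\frac{3}{16\pi}\,P(\Omega)^2\,D(\Omega)$$ and $$|\Omega|^2\le\frac{1}{12\pi}\,P(\Omega)\,D^\partial(\Omega).$$ Equality holds in the second inequality if and only if $\Omega$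 is a round ball, i.e. a closed ball of positive radius. -/

import Mathlib

open MeasureTheory
open scoped ENNReal ContDiff

noncomputable section

namespace LiquidDrop

/-- Three-dimensional Euclidean space. -/
abbrev E3 : Type := EuclideanSpace ℝ (Fin 3)

/-- `Ω` has smooth boundary: near each of its boundary points, `Ω` is the sublevel set
`{φ ≤ 0}` of a `C^∞` function `φ` whose differential does not vanish at that point. -/
def HasSmoothBoundary (Ω : Set E3) : Prop :=
  ∀ p ∈ frontier Ω, ∃ (U : Set E3) (φ : E3 → ℝ), IsOpen U ∧ p ∈ U ∧
    ContDiffOn ℝ ∞ φ U ∧ fderiv ℝ φ p ≠ 0 ∧ ∀ x ∈ U, (x ∈ Ω ↔ φ x ≤ 0)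

/-- The divergence `∑ i, ∂ᵢ Xᵢ` of a vector field on three-dimensional Euclidean space. -/
def divergence (X : E3 → E3) (x : E3) : ℝ :=
  ∑ i : Fin 3, fderiv ℝ X x (EuclideanSpace.single i 1) i

/-- The perimeter of `Ω`: the supremum of `∫_Ω div X` over compactly supported `C^1` vector
fields `X` with `|X| ≤ 1`. (The field `X = 0` is allowed, so the supremum is nonnegative and
truncating negative values does not change it.) -/
def perimeter (Ω : Set E3) : ℝ≥0∞ :=
  ⨆ (X : E3 → E3) (_ : ContDiff ℝ 1 X) (_ : HasCompactSupport X) (_ : ∀ x, ‖X x‖ ≤ 1),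
    ENNReal.ofReal (∫ x in Ω, divergence X x)

/-- The Newtonian potential `v_Ω(x) = ∫_Ω |x - y|⁻¹ dy`. -/
def newtonianPotential (Ω : Set E3) (x : E3) : ℝ≥0∞ :=
  ∫⁻ y in Ω, ‖x - y‖ₑ⁻¹

/-- The Coulomb energy `D(Ω) = (1/2) ∫_Ω ∫_Ω |x - y|⁻¹ dy dx`. -/
def coulombEnergy (Ω : Set E3) : ℝ≥0∞ :=
  2⁻¹ * ∫⁻ x in Ω, newtonianPotential Ω x

/-- The boundary-interior Coulomb interaction `∫_{∂Ω} ∫_Ω |x - y|⁻¹ dy dA(x)`, where the surface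
measure `dA` is the two-dimensional Hausdorff measure, normalized to agree with Lebesgue measure
on Euclidean planes. -/
def boundaryCoulombEnergy (Ω : Set E3) : ℝ≥0∞ :=
  ∫⁻ x in frontier Ω, newtonianPotential Ω x ∂(Measure.euclideanHausdorffMeasure 2)

/-- `Ω` is a (closed) round ball of positive radius. -/
def IsRoundBall (Ω : Set E3) : Prop :=
  ∃ (c : E3) (r : ℝ), 0 < r ∧ Ω = Metric.closedBall c r

end LiquidDrop

end

/-! ### Cartesian frames and the divergence theorem below a graph -/

noncomputable section

namespace LiquidDrop

open Set

/-! Let `v` be the Newtonian potential of `Ω`, so that `-∇v` has divergence `4π` inside `Ω`.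
Everything rests on the pointwise bound `|∇v|² ≤ (4π/3) v`. For a unit vector `e` and `c > 0`, the
number `e·∇v(x) - c v(x)` is the integral over `Ω` of `bathtubKernel e c (y - x)`. It is therefore
at most the integral of the positive part of the kernel over the whole space, which is `π/(3c)`. The
kernel is positive exactly on a ball with `x` on its boundary, so equality forces `Ω` to be that
ball. Optimizing in `c` gives `norm_softField_sq_le`; the equality case is
`isRoundBall_of_norm_softField_sq_eq`.

With `K² = 4π/3` and `s = t²`, split `-∇v` into the damped part `-(s/(s+v)) ∇v` and the excess
`-(v/(s+v)) ∇v`. By the arithmetic-geometric mean inequality their lengths are at most `K t/2` and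
`K v/(2t)`. The flux of the first is controlled by the perimeter, that of the second by the boundary
energy, whence `4π|Ω| ≤ K(t/2)P + (K/(2t))D^∂`. Optimizing in `t` gives the second inequality.

For the first inequality the damped field suffices. Its divergence is at least `π(3 - v/s)` in `Ω`,
so `π(3|Ω| - 2D/s) ≤ K(t/2)P`. The choice `s = 2D/|Ω|` yields `6π|Ω|³ ≤ P²D`, which is strictly
stronger than the claim because `6 > 16/3`.

If `Ω` is not a ball, the pointwise bound is strict on the compact boundary. By continuity it holds
near the boundary with a smaller `K`, and the second inequality becomes strict. For a ball, `v` is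
constant on the sphere and the constants match.

Two technical devices enter. The kernel is softened at scale `δ`, which makes the fields `C^1`; the
pointwise bound survives with the same constant, and `δ → 0` at the end. Surface measure is handled
in nearly flat graph charts, where Lipschitz comparison with a plane costs a factor tending to one.
-/

/-- The Euclidean plane, the model space for charts of surfaces. -/
abbrev E2 : Type := EuclideanSpace ℝ (Fin 2)

/-- `T` is a system of Cartesian coordinates on `E3`, adapted to the splitting `E2 × ℝ`. -/
structure IsFrame (T : (E2 × ℝ) ≃L[ℝ] E3) : Prop where
  measurePreserving : MeasurePreserving T volume volume
  inner_map : ∀ z w : E2 × ℝ, inner ℝ (T z) (T w) = inner ℝ z.1 w.1 + z.2 * w.2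
  trace_eq : ∀ A : E3 →L[ℝ] E3, ∑ i : Fin 3, A (EuclideanSpace.single i 1) i =
    (∑ i : Fin 2, inner ℝ (T (EuclideanSpace.single i 1, 0))
      (A (T (EuclideanSpace.single i 1, 0)))) + inner ℝ (T (0, 1)) (A (T (0, 1)))

/-- Start from any linear isometry and compose it with the reflection that carries the image of the
last axis to `ν`. The result is again an isometry, so volume, inner products and the trace are
computed correctly in these coordinates. -/
theorem exists_isFrame {ν : E3} (hν : ‖ν‖ = 1) :
    ∃ T : (E2 × ℝ) ≃L[ℝ] E3, IsFrame T ∧ T (0, 1) = ν := by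
  let b : OrthonormalBasis (Fin 2 ⊕ Unit) ℝ (WithLp 2 (E2 × ℝ)) :=
    (EuclideanSpace.basisFun (Fin 2) ℝ).prod (OrthonormalBasis.singleton Unit ℝ)
  let e : Fin 2 ⊕ Unit ≃ Fin 3 := Fintype.equivOfCardEq (by simp)
  let A : WithLp 2 (E2 × ℝ) ≃ₗᵢ[ℝ] E3 := b.equiv (EuclideanSpace.basisFun (Fin 3) ℝ) e
  let w : E3 := A (WithLp.toLp 2 (0, 1))
  have hw : ‖w‖ = ‖ν‖ := by
    rw [hν, A.norm_map, WithLp.prod_norm_eq_of_L2]; simp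
  let R : WithLp 2 (E2 × ℝ) ≃ₗᵢ[ℝ] E3 := A.trans (Submodule.reflection (ℝ ∙ (w - ν))ᗮ)
  have hR : R (WithLp.toLp 2 (0, 1)) = ν := Submodule.reflection_sub hw
  let T : (E2 × ℝ) ≃L[ℝ] E3 :=
    (WithLp.prodContinuousLinearEquiv 2 ℝ E2 ℝ).symm.trans R.toContinuousLinearEquiv
  have hT : ∀ z, T z = R (WithLp.toLp 2 z) := fun z => rfl
  refine ⟨T, ⟨?_, ?_, ?_⟩, ?_⟩
  · exact R.measurePreserving.comp (WithLp.volume_preserving_toLp E2 ℝ)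
  · intro z w
    rw [hT, hT, R.inner_map_map, WithLp.prod_inner_apply]
    simp [mul_comm]
  · intro L
    have h1 := LinearMap.trace_eq_sum_inner (L : E3 →ₗ[ℝ] E3) (EuclideanSpace.basisFun (Fin 3) ℝ)
    have h2 := LinearMap.trace_eq_sum_inner (L : E3 →ₗ[ℝ] E3) (b.map R)
    rw [h1] at h2
    rw [Fintype.sum_sum_type] at h2
    simpa [b, hT, EuclideanSpace.inner_single_left] using h2
  · exact hR

theorem IsFrame.norm_sq {T : (E2 × ℝ) ≃L[ℝ] E3} (hT : IsFrame T) (z : E2 × ℝ) :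
    ‖T z‖ ^ 2 = ‖z.1‖ ^ 2 + z.2 ^ 2 := by
  rw [← real_inner_self_eq_norm_sq, hT.inner_map, real_inner_self_eq_norm_sq]; ring

theorem IsFrame.divergence_eq {T : (E2 × ℝ) ≃L[ℝ] E3} (hT : IsFrame T) (X : E3 → E3) (x : E3) :
    divergence X x = (∑ i : Fin 2, inner ℝ (T (EuclideanSpace.single i 1, 0))
      (fderiv ℝ X x (T (EuclideanSpace.single i 1, 0)))) +
        inner ℝ (T (0, 1)) (fderiv ℝ X x (T (0, 1))) :=
  hT.trace_eq (fderiv ℝ X x)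

/-- The vertical shear `(x, s) ↦ (x, g x + s)`. -/
def shear (g : E2 → ℝ) (z : E2 × ℝ) : E2 × ℝ := (z.1, g z.1 + z.2)

/-- The vertical shear along a continuous function is a homeomorphism. -/
def shearHomeomorph (g : E2 → ℝ) (hg : Continuous g) : (E2 × ℝ) ≃ₜ (E2 × ℝ) where
  toFun := shear g
  invFun z := (z.1, z.2 - g z.1)
  left_inv z := by simp [shear]
  right_inv z := by simp [shear]
  continuous_toFun := by unfold shear; fun_prop
  continuous_invFun := by fun_prop

theorem measurePreserving_shear {g : E2 → ℝ} (hg : Continuous g) :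
    MeasurePreserving (shear g) volume volume := by
  refine MeasurePreserving.skew_product (f := id) (g := fun x s => g x + s)
    (MeasurePreserving.id _) (by fun_prop) (Filter.Eventually.of_forall fun x => ?_)
  exact (measurePreserving_add_left volume (g x)).map_eq

/-- The points on or below the graph of `g` in the coordinates `T`. -/
def hypograph (T : (E2 × ℝ) ≃L[ℝ] E3) (g : E2 → ℝ) : Set E3 := T '' {z | z.2 ≤ g z.1}

/-- The upward normal vector of the graph of `g`, with vertical component one. -/
def graphNormal (T : (E2 × ℝ) ≃L[ℝ] E3) (g : E2 → ℝ) (x : E2) : E3 := T (-gradient g x, 1)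

theorem hasCompactSupport_prodMk_left {F : Type*} [Zero F] {f : E2 × ℝ → F}
    (h : HasCompactSupport f) (x : E2) : HasCompactSupport fun s => f (x, s) := by
  refine HasCompactSupport.intro (h.isCompact.image continuous_snd) fun s hs => ?_
  by_contra hne
  exact hs ⟨(x, s), subset_tsupport _ hne, rfl⟩

theorem hasCompactSupport_prodMk_right {F : Type*} [Zero F] {f : E2 × ℝ → F}
    (h : HasCompactSupport f) (s : ℝ) : HasCompactSupport fun x => f (x, s) := by
  refine HasCompactSupport.intro (h.isCompact.image continuous_fst) fun x hx => ?_
  by_contra hne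
  exact hx ⟨(x, s), subset_tsupport _ hne, rfl⟩

/-- The integral of a directional derivative of a compactly supported function vanishes. -/
theorem integral_fderiv_apply_eq_zero {E F : Type*} [NormedAddCommGroup E] [NormedSpace ℝ E]
    [MeasurableSpace E] [BorelSpace E] [FiniteDimensional ℝ E] (μ : Measure E)
    [μ.IsAddHaarMeasure] [NormedAddCommGroup F] [NormedSpace ℝ F] {f : E → F}
    (hf : ContDiff ℝ 1 f) (hc : HasCompactSupport f) (v : E) : ∫ x, fderiv ℝ f x v ∂μ = 0 := by
  have h := integral_smul_fderiv_eq_neg_fderiv_smul_of_integrable (μ := μ) (𝕜 := ℝ)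
    (f := fun _ => (1 : ℝ)) (g := f) (v := v) (by simp) ?_ ?_ (by simp)
    (fun x _ => hf.differentiable one_ne_zero x)
  · simpa using h
  · simpa using ((hf.continuous_fderiv one_ne_zero).clm_apply continuous_const
      ).integrable_of_hasCompactSupport (hc.fderiv_apply ℝ v)
  · simpa using hf.continuous.integrable_of_hasCompactSupport hc

/-- Fubini over horizontal planes: each slice is a compactly supported function on the whole plane.
-/
theorem integral_halfSpace_fderiv_horizontal {F : Type*} [NormedAddCommGroup F] [NormedSpace ℝ F]
    {Y : E2 × ℝ → F} (hY : ContDiff ℝ 1 Y) (hc : HasCompactSupport Y) (v : E2) :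
    ∫ z in {z : E2 × ℝ | z.2 ≤ 0}, fderiv ℝ Y z (v, 0) = 0 := by
  have hint : Integrable (fun z => fderiv ℝ Y z (v, 0)) :=
    ((hY.continuous_fderiv one_ne_zero).clm_apply continuous_const
      ).integrable_of_hasCompactSupport (hc.fderiv_apply ℝ _)
  have hset : {z : E2 × ℝ | z.2 ≤ 0} = univ ×ˢ Iic 0 := by ext; simp
  rw [hset, Measure.volume_eq_prod, ← Measure.prod_restrict, integral_prod_symm]
  · refine (integral_congr_ae (Filter.Eventually.of_forall fun s => ?_)).trans
      (integral_zero ℝ F)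
    have h1 : ∀ x, HasFDerivAt (fun x => Y (x, s))
        ((fderiv ℝ Y (x, s)).comp (ContinuousLinearMap.inl ℝ E2 ℝ)) x := fun x =>
      (hY.differentiable one_ne_zero (x, s)).hasFDerivAt.comp x (hasFDerivAt_prodMk_left x s)
    have h2 := integral_fderiv_apply_eq_zero (volume : Measure E2) (f := fun x => Y (x, s))
      (hY.comp (contDiff_id.prodMk contDiff_const)) (hasCompactSupport_prodMk_right hc s) v
    simp only [Measure.restrict_univ]
    rw [← h2]
    congr 1 with x
    rw [(h1 x).fderiv]
    simp
  · rw [Measure.prod_restrict]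
    exact hint.integrableOn

/-- Fubini over vertical lines and the fundamental theorem of calculus. Since `N` depends on the
horizontal variable only, it is constant along each line. -/
theorem integral_halfSpace_inner_fderiv_vertical {F : Type*} [NormedAddCommGroup F]
    [InnerProductSpace ℝ F] [CompleteSpace F] {Y : E2 × ℝ → F} (hY : ContDiff ℝ 1 Y)
    (hc : HasCompactSupport Y) {N : E2 → F} (hN : Continuous N) :
    ∫ z in {z : E2 × ℝ | z.2 ≤ 0}, inner ℝ (N z.1) (fderiv ℝ Y z (0, 1)) =
      ∫ x, inner ℝ (N x) (Y (x, 0)) := by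
  have hcont : Continuous fun z : E2 × ℝ => inner ℝ (N z.1) (fderiv ℝ Y z (0, 1)) :=
    (hN.comp continuous_fst).inner ((hY.continuous_fderiv one_ne_zero).clm_apply continuous_const)
  have hcs : HasCompactSupport fun z : E2 × ℝ => inner ℝ (N z.1) (fderiv ℝ Y z (0, 1)) :=
    (hc.fderiv_apply ℝ (0, 1)).mono fun z hz h0 => hz (by simp [h0])
  have hset : {z : E2 × ℝ | z.2 ≤ 0} = univ ×ˢ Iic 0 := by ext; simp
  rw [hset, Measure.volume_eq_prod, setIntegral_prod]
  · simp only [Measure.restrict_univ]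
    congr 1 with x
    have h1 : ∀ s, HasDerivAt (fun s => Y (x, s)) (fderiv ℝ Y (x, s) (0, 1)) s := fun s =>
      ((hY.differentiable one_ne_zero (x, s)).hasFDerivAt.comp_hasDerivAt s
        ((hasDerivAt_const s x).prodMk (hasDerivAt_id s)))
    have h2 : ∀ s, HasDerivAt (fun s => inner ℝ (N x) (Y (x, s)))
        (inner ℝ (N x) (fderiv ℝ Y (x, s) (0, 1))) s := fun s => by
      simpa using (hasDerivAt_const s (N x)).inner ℝ (h1 s)
    rw [← HasCompactSupport.integral_Iic_deriv_eq (f := fun s => inner ℝ (N x) (Y (x, s)))]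
    · congr 1 with s
      exact (h2 s).deriv.symm
    · exact contDiff_const.inner ℝ (hY.comp (contDiff_const.prodMk contDiff_id))
    · exact (hasCompactSupport_prodMk_left hc x).mono fun z hz h0 => hz (by simp [h0])
  · exact (hcont.integrable_of_hasCompactSupport hcs).integrableOn

/-- **Divergence theorem** for the region below a graph. -/
theorem integral_divergence_hypograph {T : (E2 × ℝ) ≃L[ℝ] E3} (hT : IsFrame T) {g : E2 → ℝ}
    (hg : ContDiff ℝ 1 g) {X : E3 → E3} (hX : ContDiff ℝ 1 X) (hc : HasCompactSupport X) :
    ∫ x in hypograph T g, divergence X x =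
      ∫ x, inner ℝ (graphNormal T g x) (X (T (x, g x))) := by
  have hTm : MeasurableEmbedding T := T.toHomeomorph.measurableEmbedding
  have hSm : MeasurableEmbedding (shear g) :=
    (shearHomeomorph g hg.continuous).measurableEmbedding
  -- The shear preserves volume and flattens the region to a half-space.
  have hset : T '' {z | z.2 ≤ g z.1} = (T ∘ shear g) '' {z | z.2 ≤ 0} := by
    rw [image_comp]
    congr 1
    ext z
    simp only [mem_ofPred_eq, mem_image, shear]
    constructor
    · intro h
      exact ⟨(z.1, z.2 - g z.1), by simpa using h, by simp⟩
    · rintro ⟨w, hw, rfl⟩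
      simpa using hw
  have hmp : MeasurePreserving (T ∘ shear g) volume volume :=
    hT.measurePreserving.comp (measurePreserving_shear hg.continuous)
  rw [hypograph, hset, hmp.setIntegral_image_emb (hTm.comp hSm)]
  set Y : E2 × ℝ → E3 := fun z => X (T (shear g z)) with hYdef
  have hshear : ContDiff ℝ 1 (shear g) := by unfold shear; fun_prop
  have hY : ContDiff ℝ 1 Y := hX.comp (T.contDiff.comp hshear)
  have hYc : HasCompactSupport Y :=
    hc.comp_homeomorph ((shearHomeomorph g hg.continuous).trans T.toHomeomorph)
  have hder : ∀ z h k, fderiv ℝ Y z (h, k) =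
      fderiv ℝ X (T (shear g z)) (T (h, fderiv ℝ g z.1 h + k)) := by
    intro z h k
    have h0 : HasFDerivAt (shear g) ((ContinuousLinearMap.fst ℝ E2 ℝ).prod
        ((fderiv ℝ g z.1).comp (ContinuousLinearMap.fst ℝ E2 ℝ) +
          ContinuousLinearMap.snd ℝ E2 ℝ)) z := by
      refine hasFDerivAt_fst.prodMk (HasFDerivAt.add ?_ hasFDerivAt_snd)
      exact (hg.differentiable one_ne_zero z.1).hasFDerivAt.comp z hasFDerivAt_fst
    have h1 := ((hX.differentiable one_ne_zero (T (shear g z))).hasFDerivAt.comp z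
      (T.hasFDerivAt.comp z h0))
    have h2 : fderiv ℝ Y z = _ := h1.fderiv
    rw [h2]
    simp
  -- By the chain rule the derivatives of `g` multiply only the vertical derivative of `Y`, where
  -- they assemble into the graph normal. The horizontal terms then integrate to zero.
  have hdiv : ∀ z, divergence X ((T ∘ shear g) z) =
      (∑ i : Fin 2, inner ℝ (T (EuclideanSpace.single i 1, 0))
        (fderiv ℝ Y z (EuclideanSpace.single i 1, 0))) +
      inner ℝ (graphNormal T g z.1) (fderiv ℝ Y z (0, 1)) := by
    intro z
    have hN : graphNormal T g z.1 = -(∑ i : Fin 2, fderiv ℝ g z.1 (EuclideanSpace.single i 1) •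
        T (EuclideanSpace.single i 1, 0)) + T (0, 1) := by
      have h0 : (-gradient g z.1, (1 : ℝ)) =
          -(∑ i : Fin 2, fderiv ℝ g z.1 (EuclideanSpace.single i 1) •
            ((EuclideanSpace.single i 1, 0) : E2 × ℝ)) + (0, 1) := by
        refine Prod.ext ?_ (by simp)
        have h1 : gradient g z.1 = ∑ i : Fin 2, fderiv ℝ g z.1 (EuclideanSpace.single i 1) •
            EuclideanSpace.single i 1 := by
          refine (OrthonormalBasis.sum_repr' (EuclideanSpace.basisFun (Fin 2) ℝ) _).symm.trans ?_
          refine Finset.sum_congr rfl fun i _ => ?_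
          rw [real_inner_comm, inner_gradient_left]
          simp
        simp [h1, Fin.sum_univ_two]
      rw [graphNormal, h0]
      simp only [map_add, map_neg, map_sum, map_smul]
    have hsplit : ∀ i : Fin 2, T (EuclideanSpace.single i 1,
        fderiv ℝ g z.1 (EuclideanSpace.single i 1) + 0) = T (EuclideanSpace.single i 1, 0) +
          fderiv ℝ g z.1 (EuclideanSpace.single i 1) • T (0, 1) := by
      intro i
      rw [← map_smul, ← map_add]
      simp
    rw [hT.divergence_eq, hN]
    simp only [hder, hsplit, map_add, map_smul, inner_add_right, inner_add_left, inner_neg_left,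
      sum_inner, inner_smul_left, inner_smul_right, Finset.sum_add_distrib, Function.comp_apply,
      map_zero, zero_add]
    simp
    ring
  simp_rw [hdiv]
  have hfd : Continuous fun z => fderiv ℝ Y z := hY.continuous_fderiv one_ne_zero
  have hNc : Continuous (graphNormal T g) := by
    have : Continuous (gradient g) :=
      (InnerProductSpace.toDual ℝ E2).symm.continuous.comp (hg.continuous_fderiv one_ne_zero)
    unfold graphNormal
    fun_prop
  have hi : ∀ v : E2 × ℝ, ∀ N : E2 → E3, Continuous N →
      IntegrableOn (fun z => inner ℝ (N z.1) (fderiv ℝ Y z v)) {z : E2 × ℝ | z.2 ≤ 0} := by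
    intro v N hN
    refine (Continuous.integrable_of_hasCompactSupport ?_ ?_).integrableOn
    · exact (hN.comp continuous_fst).inner (hfd.clm_apply continuous_const)
    · exact (hYc.fderiv_apply ℝ v).mono fun z hz h0 => hz (by simp [h0])
  rw [integral_add (integrable_finsetSum _ fun i _ => hi _ _ continuous_const) (hi _ _ hNc),
    integral_finsetSum _ fun i _ => hi _ _ continuous_const,
    integral_halfSpace_inner_fderiv_vertical hY hYc hNc]
  have hz : ∀ i : Fin 2, ∫ z in {z : E2 × ℝ | z.2 ≤ 0}, inner ℝ (T (EuclideanSpace.single i 1, 0))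
      (fderiv ℝ Y z (EuclideanSpace.single i 1, 0)) = 0 := by
    intro i
    rw [integral_inner, integral_halfSpace_fderiv_horizontal hY hYc, inner_zero_right]
    exact ((hfd.clm_apply continuous_const).integrable_of_hasCompactSupport
      (hYc.fderiv_apply ℝ _)).integrableOn
  simp only [hz, Finset.sum_const_zero, zero_add]
  simp [hYdef, shear]

end LiquidDrop

end

/-! ### Smooth boundaries as graphs of small slope -/

noncomputable section

namespace LiquidDrop

open Set Filter Topology Metric

/-- Near a regular point of `φ` the sublevel set `{φ ≤ 0}` is, in suitable Cartesian coordinates,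
the region below a graph of small slope. -/
theorem exists_hypograph {Ω : Set E3} {φ : E3 → ℝ} {p : E3} (hφ : ContDiffAt ℝ 1 φ p)
    (h0 : φ p = 0) (hd : gradient φ p ≠ 0) (hΩ : ∀ᶠ x in 𝓝 p, (x ∈ Ω ↔ φ x ≤ 0)) {ε : ℝ}
    (hε : 0 < ε) :
    ∃ (T : (E2 × ℝ) ≃L[ℝ] E3) (g : E2 → ℝ) (W : Set E3) (r : ℝ), IsFrame T ∧
      T (0, 1) = ‖gradient φ p‖⁻¹ • gradient φ p ∧ ContDiff ℝ 1 g ∧ IsOpen W ∧ p ∈ W ∧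
      (∀ x ∈ W, (x ∈ Ω ↔ x ∈ hypograph T g)) ∧
      (∀ x ∈ W, (T.symm x).1 ∈ ball (T.symm p).1 r) ∧
      ∀ y ∈ ball (T.symm p).1 r, ‖fderiv ℝ g y‖ ≤ ε := by
  have hn : 0 < ‖gradient φ p‖ := norm_pos_iff.2 hd
  obtain ⟨T, hT, hTν⟩ := exists_isFrame (ν := ‖gradient φ p‖⁻¹ • gradient φ p)
    (by rw [norm_smul, norm_inv, norm_norm, inv_mul_cancel₀ hn.ne'])
  set u : E2 × ℝ := T.symm p with hu
  have hTu : T u = p := T.apply_symm_apply p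
  set f : E2 × ℝ → ℝ := fun z => φ (T z) with hf
  have hfu : ContDiffAt ℝ 1 f u := by
    refine ContDiffAt.comp u (hTu ▸ hφ) T.contDiff.contDiffAt
  have hf0 : f u = 0 := by rw [hf]; simp only [hTu, h0]
  have hder : ∀ h k, fderiv ℝ f u (h, k) = ‖gradient φ p‖ * k := by
    intro h k
    have h1 : HasFDerivAt f ((fderiv ℝ φ p).comp (T : (E2 × ℝ) →L[ℝ] E3)) u := by
      have h2 : HasFDerivAt φ (fderiv ℝ φ p) (T u) := by
        rw [hTu]; exact (hφ.differentiableAt one_ne_zero).hasFDerivAt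
      exact h2.comp u T.hasFDerivAt
    rw [h1.fderiv]
    simp only [ContinuousLinearMap.comp_apply, ContinuousLinearEquiv.coe_coe]
    have h3 : gradient φ p = ‖gradient φ p‖ • T (0, 1) := by
      rw [hTν, smul_smul, mul_inv_cancel₀ hn.ne', one_smul]
    rw [← inner_gradient_left, h3, inner_smul_left, hT.inner_map]
    simp [← h3]
  have hinv : (fderiv ℝ f u ∘L .inr ℝ E2 ℝ).IsInvertible := by
    refine ⟨ContinuousLinearEquiv.smulLeft (Units.mk0 _ hn.ne'), ?_⟩
    ext
    simp [hder]
  set ψ := hfu.implicitFunction one_ne_zero hinv with hψ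
  have hψC : ContDiffAt ℝ 1 ψ u.1 := hfu.contDiffAt_implicitFunction one_ne_zero hinv
  -- The last axis of `T` points along the gradient, so the graph is horizontal over the base point.
  -- Continuity of the derivative then keeps the slope below `ε` nearby.
  have hψ1 : fderiv ℝ ψ u.1 = 0 := by
    rw [(hfu.hasStrictFDerivAt_implicitFunction one_ne_zero hinv).hasFDerivAt.fderiv]
    ext h
    simp [hder]
  have hψu : ψ u.1 = u.2 := hfu.implicitFunction_apply_self one_ne_zero hinv
  have e1 : ∀ᶠ x in 𝓝 u.1, f (x, ψ x) = 0 := by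
    simpa only [hf0] using hfu.eventually_apply_implicitFunction one_ne_zero hinv
  have e2 : ∀ᶠ x in 𝓝 u.1, ContDiffAt ℝ 1 ψ x := hψC.eventually (by simp)
  have e3 : ∀ᶠ x in 𝓝 u.1, ‖fderiv ℝ ψ x‖ < ε := by
    have : ContinuousAt (fun x => ‖fderiv ℝ ψ x‖) u.1 :=
      (hψC.fderiv_right (m := 0) (by simp)).continuousAt.norm
    refine this.eventually_lt continuousAt_const ?_
    simpa [hψ1] using hε
  have e4 : ∀ᶠ z in 𝓝 u, ContDiffAt ℝ 1 f z := hfu.eventually (by simp)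
  have e5 : ∀ᶠ z in 𝓝 u, 0 < fderiv ℝ f z (0, 1) := by
    have : ContinuousAt (fun z => fderiv ℝ f z (0, 1)) u :=
      (hfu.fderiv_right (m := 0) (by simp)).continuousAt.clm_apply continuousAt_const
    refine continuousAt_const.eventually_lt this ?_
    simpa [hder] using hd
  have e6 : ∀ᶠ z in 𝓝 u, (T z ∈ Ω ↔ f z ≤ 0) := by
    have : Tendsto T (𝓝 u) (𝓝 p) := by
      rw [← hTu]; exact T.continuous.continuousAt
    exact this.eventually hΩ
  obtain ⟨δ, hδ, hδ'⟩ := Metric.eventually_nhds_iff_ball.1 (e4.and (e5.and e6))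
  have e7 : ∀ᶠ x in 𝓝 u.1, ψ x ∈ ball u.2 δ := by
    refine hψC.continuousAt.eventually_mem ?_
    rw [hψu]; exact ball_mem_nhds _ hδ
  obtain ⟨r, hr, hr'⟩ := Metric.eventually_nhds_iff_ball.1
    (e1.and (e2.and (e3.and (e7.and (ball_mem_nhds u.1 hδ)))))
  -- `ψ` is controlled only near `u.1`. Multiplication by a bump equal to one on the smaller ball
  -- gives a global `C^1` function without changing the graph there.
  let χ : ContDiffBump u.1 := ⟨r / 2, 3 * r / 4, by positivity, by linarith⟩
  have hgψ : ∀ y ∈ ball u.1 (r / 2), χ y * ψ y = ψ y := fun y hy => by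
    rw [χ.one_of_mem_closedBall (ball_subset_closedBall hy), one_mul]
  refine ⟨T, fun y => χ y * ψ y, T.symm ⁻¹' (ball u.1 (r / 2) ×ˢ ball u.2 δ), r / 2, hT, hTν,
    ?_, ?_, ?_, ?_, ?_, ?_⟩
  · refine contDiff_iff_contDiffAt.2 fun y => ?_
    by_cases hy : y ∈ ball u.1 r
    · exact χ.contDiff.contDiffAt.mul (hr' y hy).2.1
    · have : (fun y => χ y * ψ y) =ᶠ[𝓝 y] fun _ => 0 := by
        have h1 : (tsupport χ)ᶜ ∈ 𝓝 y := by
          refine (isClosed_tsupport _).isOpen_compl.mem_nhds fun h => hy ?_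
          rw [χ.tsupport_eq] at h
          refine closedBall_subset_ball ?_ h
          change 3 * r / 4 < r
          linarith
        filter_upwards [h1] with z hz
        rw [image_eq_zero_of_notMem_tsupport hz, zero_mul]
      exact contDiffAt_const.congr_of_eventuallyEq this
  · exact (isOpen_ball.prod isOpen_ball).preimage T.symm.continuous
  · exact ⟨mem_ball_self (by positivity), mem_ball_self hδ⟩
  · intro x hx
    obtain ⟨hx1, hx2⟩ := hx
    obtain ⟨z, rfl⟩ := T.surjective x
    rw [T.symm_apply_apply] at hx1 hx2
    have hz1 : z.1 ∈ ball u.1 r := ball_subset_ball (by linarith) hx1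
    obtain ⟨ha, -, -, hb, hc⟩ := hr' z.1 hz1
    have hmem : ∀ s ∈ ball u.2 δ, (z.1, s) ∈ ball u δ := fun s hs => by
      rw [mem_ball, Prod.dist_eq]
      exact max_lt hc hs
    -- Along vertical segments `f` increases strictly and vanishes at height `ψ z.1`. Hence `f ≤ 0`
    -- means lying on or below the graph.
    have hmono : StrictMonoOn (fun s => f (z.1, s)) (ball u.2 δ) := by
      have hd' : ∀ s ∈ ball u.2 δ, HasDerivAt (fun s => f (z.1, s))
          (fderiv ℝ f (z.1, s) (0, 1)) s :=
        fun s hs => ((hδ' _ (hmem s hs)).1.differentiableAt one_ne_zero).hasFDerivAt.comp_hasDerivAt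
          s ((hasDerivAt_const s z.1).prodMk (hasDerivAt_id s))
      refine strictMonoOn_of_deriv_pos (convex_ball _ _)
        (fun s hs => (hd' s hs).continuousAt.continuousWithinAt) fun s hs => ?_
      rw [isOpen_ball.interior_eq] at hs
      rw [(hd' s hs).deriv]
      exact (hδ' _ (hmem s hs)).2.1
    rw [(hδ' z (hmem z.2 hx2)).2.2, ← ha]
    have := hmono.le_iff_le hx2 hb
    rw [show f z = f (z.1, z.2) from rfl]
    refine this.trans ?_
    simp [hypograph, hgψ z.1 hx1]
  · exact fun x hx => hx.1
  · intro y hy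
    have h1 : (fun y => χ y * ψ y) =ᶠ[𝓝 y] ψ := by
      filter_upwards [isOpen_ball.mem_nhds hy] with z hz using hgψ z hz
    rw [h1.fderiv_eq]
    exact (hr' y (ball_subset_ball (by linarith) hy)).2.2.1.le

end LiquidDrop

end

/-! ### Surface measure in nearly flat charts -/

noncomputable section

namespace LiquidDrop

open Set Filter Topology Metric

/-- The parametrization of the graph of `g` in the coordinates `T`. -/
def graphMap (T : (E2 × ℝ) ≃L[ℝ] E3) (g : E2 → ℝ) (x : E2) : E3 := T (x, g x)

theorem frontier_hypograph (T : (E2 × ℝ) ≃L[ℝ] E3) {g : E2 → ℝ} (hg : Continuous g) :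
    frontier (hypograph T g) = range (graphMap T g) := by
  have h1 : hypograph T g =
      ((shearHomeomorph g hg).trans T.toHomeomorph) '' (univ ×ˢ Iic (0 : ℝ)) := by
    ext x
    simp only [hypograph, mem_image, mem_ofPred_eq, mem_prod, mem_univ, true_and, mem_Iic]
    constructor
    · rintro ⟨z, hz, rfl⟩
      exact ⟨(z.1, z.2 - g z.1), by simpa using hz, by simp [shearHomeomorph, shear]⟩
    · rintro ⟨z, hz, rfl⟩
      exact ⟨shear g z, by simpa [shear] using hz, rfl⟩
  rw [h1, ← Homeomorph.image_frontier, frontier_univ_prod_eq, frontier_Iic]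
  ext x
  simp only [mem_image, mem_range, mem_prod, mem_univ, true_and, mem_singleton_iff, graphMap]
  constructor
  · rintro ⟨z, hz, rfl⟩
    exact ⟨z.1, by simp [shearHomeomorph, shear, hz]⟩
  · rintro ⟨y, rfl⟩
    exact ⟨(y, 0), rfl, by simp [shearHomeomorph, shear]⟩

theorem frontier_inter_eq_of_eqOn_isOpen {X : Type*} [TopologicalSpace X] {s t W : Set X}
    (hW : IsOpen W) (h : ∀ x ∈ W, (x ∈ s ↔ x ∈ t)) : frontier s ∩ W = frontier t ∩ W := by
  have : s ∩ W = t ∩ W := by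
    ext x
    simp only [mem_inter_iff, and_congr_left_iff]
    exact h x
  rw [← frontier_inter_open_inter hW, this, frontier_inter_open_inter hW]

theorem euclideanHausdorffMeasure_image_le {X Y : Type*} [MetricSpace X] [MeasurableSpace X]
    [BorelSpace X] [MetricSpace Y] [MeasurableSpace Y] [BorelSpace Y] {f : X → Y} {K : NNReal}
    {s : Set X} (hf : LipschitzOnWith K f s) (d : ℕ) :
    (Measure.euclideanHausdorffMeasure d : Measure Y) (f '' s) ≤
      (K : ℝ≥0∞) ^ d * (Measure.euclideanHausdorffMeasure d : Measure X) s := by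
  have h := hf.hausdorffMeasure_image_le (d := d) (by positivity)
  rw [ENNReal.rpow_natCast] at h
  simp only [Measure.euclideanHausdorffMeasure_def, Measure.smul_apply, ENNReal.smul_def,
    smul_eq_mul]
  calc _ ≤ _ * ((K : ℝ≥0∞) ^ d * _) := by gcongr
    _ = _ := by ring

theorem IsFrame.norm_fst_symm_le {T : (E2 × ℝ) ≃L[ℝ] E3} (hT : IsFrame T) (x : E3) :
    ‖(T.symm x).1‖ ≤ ‖x‖ := by
  have h := hT.norm_sq (T.symm x)
  rw [T.apply_symm_apply] at h
  exact le_of_sq_le_sq (by nlinarith [sq_nonneg (T.symm x).2]) (norm_nonneg _)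

/-- Pythagoras gives the constant `√(1 + ε²)`. The cruder `1 + ε` suffices, since `ε` will tend to
zero. -/
theorem lipschitzOnWith_graphMap {T : (E2 × ℝ) ≃L[ℝ] E3} (hT : IsFrame T) {g : E2 → ℝ}
    (hg : ContDiff ℝ 1 g) {s : Set E2} (hs : Convex ℝ s) {ε : NNReal}
    (hε : ∀ y ∈ s, ‖fderiv ℝ g y‖ ≤ ε) : LipschitzOnWith (1 + ε) (graphMap T g) s := by
  refine LipschitzOnWith.of_dist_le_mul fun x hx y hy => ?_
  have h1 : |g x - g y| ≤ ε * ‖x - y‖ :=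
    hs.norm_image_sub_le_of_norm_fderiv_le (fun z _ => hg.differentiable one_ne_zero z) hε hy hx
  rw [dist_eq_norm, dist_eq_norm, graphMap, graphMap, ← map_sub]
  refine le_of_sq_le_sq ?_ (by positivity)
  rw [hT.norm_sq]
  have h2 : (g x - g y) ^ 2 ≤ (ε * ‖x - y‖) ^ 2 := by
    rw [← sq_abs]; gcongr
  simp only [Prod.mk_sub_mk, NNReal.coe_add, NNReal.coe_one]
  nlinarith [mul_nonneg ε.coe_nonneg (sq_nonneg ‖x - y‖)]

/-- The surface measure on the boundary of `Ω`. -/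
def surfaceMeasure (Ω : Set E3) : Measure E3 :=
  (Measure.euclideanHausdorffMeasure 2).restrict (frontier Ω)

/-- In the open set `W` the boundary of `Ω` is nearly planar with outer normal `ν`: up to errors
controlled by `ε`, its surface measure is `m`, and `N` is an outer normal field, normalized so that
`N m` is the vector valued boundary measure of `Ω` in the divergence theorem. -/
structure IsSurfaceChart (Ω : Set E3) (ν : E3) (ε : NNReal) (W : Set E3) (m : Measure E3)
    (N : E3 → E3) : Prop where
  isOpen : IsOpen W
  isFiniteMeasure : IsFiniteMeasure m
  continuous_normal : Continuous N
  norm_normal_sub_le : ∀ x ∈ W, ‖N x - ν‖ ≤ ε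
  le_surfaceMeasure : m.restrict W ≤ (surfaceMeasure Ω).restrict W
  surfaceMeasure_le : (surfaceMeasure Ω).restrict W ≤ ((1 + ε) ^ 2 : NNReal) • m.restrict W
  integral_divergence : ∀ X : E3 → E3, ContDiff ℝ 1 X → HasCompactSupport X → tsupport X ⊆ W →
    ∫ x in Ω, divergence X x = ∫ x, inner ℝ (N x) (X x) ∂m

theorem divergence_eq_zero_of_notMem_tsupport {X : E3 → E3} {x : E3} (hx : x ∉ tsupport X) :
    divergence X x = 0 := by
  have : fderiv ℝ X x = 0 := image_eq_zero_of_notMem_tsupport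
    fun h => hx (tsupport_fderiv_subset ℝ h)
  simp [divergence, this]

/-- The measure `m` is the push-forward of planar Lebesgue measure under the graph map. Projection
to the plane is 1-Lipschitz and the graph map is `(1 + ε)`-Lipschitz. This compares `m` with
Hausdorff measure in both directions, without the area formula. -/
theorem exists_isSurfaceChart {Ω : Set E3} (hΩm : MeasurableSet Ω) {φ : E3 → ℝ} {p : E3}
    (hφ : ContDiffAt ℝ 1 φ p) (h0 : φ p = 0) (hd : gradient φ p ≠ 0)
    (hΩ : ∀ᶠ x in 𝓝 p, (x ∈ Ω ↔ φ x ≤ 0)) {ε : NNReal} (hε : 0 < ε) :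
    ∃ (W : Set E3) (m : Measure E3) (N : E3 → E3), p ∈ W ∧
      IsSurfaceChart Ω (‖gradient φ p‖⁻¹ • gradient φ p) ε W m N := by
  obtain ⟨T, g, W, r, hT, hTν, hg, hW, hpW, hWΩ, hWB, hB⟩ :=
    exists_hypograph hφ h0 hd hΩ (NNReal.coe_pos.2 hε)
  set B := ball (T.symm p).1 r with hBdef
  set Γ := graphMap T g with hΓ
  have hΓc : Continuous Γ := T.continuous.comp (continuous_id.prodMk hg.continuous)
  have hπΓ : ∀ y, (T.symm (Γ y)).1 = y := fun y => by simp [hΓ, graphMap]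
  have hfr : frontier Ω ∩ W = range Γ ∩ W := by
    rw [frontier_inter_eq_of_eqOn_isOpen hW hWΩ, frontier_hypograph T hg.continuous]
  have hNc : Continuous (graphNormal T g) := by
    have : Continuous (gradient g) :=
      (InnerProductSpace.toDual ℝ E2).symm.continuous.comp (hg.continuous_fderiv one_ne_zero)
    unfold graphNormal
    fun_prop
  have hpre : ∀ A ⊆ W, Γ ⁻¹' A ⊆ B := fun A hA y hy => by
    have := hWB _ (hA hy)
    rwa [hπΓ] at this
  have himg : ∀ A ⊆ W, Γ '' (Γ ⁻¹' A) = frontier Ω ∩ A := fun A hA => by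
    rw [image_preimage_eq_inter_range]
    ext x
    have := Set.ext_iff.1 hfr x
    simp only [mem_inter_iff] at this ⊢
    constructor
    · rintro ⟨h1, h2⟩; exact ⟨(this.2 ⟨h2, hA h1⟩).1, h1⟩
    · rintro ⟨h1, h2⟩; exact ⟨h2, (this.1 ⟨h1, hA h2⟩).1⟩
  have hm : ∀ A, MeasurableSet A → A ⊆ W →
      ((volume.restrict B).map Γ) A = volume (Γ ⁻¹' A) := fun A hA hAW => by
    rw [Measure.map_apply hΓc.measurable hA,
      Measure.restrict_apply (hΓc.measurable hA), inter_eq_left.2 (hpre A hAW)]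
  have hs : ∀ A, MeasurableSet A → A ⊆ W → surfaceMeasure Ω A =
      Measure.euclideanHausdorffMeasure 2 (Γ '' (Γ ⁻¹' A)) := fun A hA hAW => by
    rw [surfaceMeasure, Measure.restrict_apply hA, himg A hAW, inter_comm]
  -- Restricting to `B` makes the measure finite and loses nothing over `W`, because `Γ ⁻¹' W ⊆ B`.
  refine ⟨W, (volume.restrict B).map Γ, fun x => graphNormal T g (T.symm x).1, hpW, hW, ?_, ?_, ?_,
    ?_, ?_, ?_⟩
  · have : IsFiniteMeasure (volume.restrict B) := ⟨by
      rw [Measure.restrict_apply_univ]; exact measure_ball_lt_top⟩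
    infer_instance
  · fun_prop
  · intro x hx
    have h1 := hB _ (hWB x hx)
    rw [← hTν, graphNormal, ← map_sub]
    refine le_of_sq_le_sq ?_ ε.coe_nonneg
    rw [hT.norm_sq]
    have h2 : ‖gradient g (T.symm x).1‖ = ‖fderiv ℝ g (T.symm x).1‖ :=
      (InnerProductSpace.toDual ℝ E2).symm.norm_map _
    simp only [Prod.mk_sub_mk, sub_zero, norm_neg, sub_self, h2]
    nlinarith [norm_nonneg (fderiv ℝ g (T.symm x).1)]
  · refine Measure.le_iff.2 fun A hA => ?_
    rw [Measure.restrict_apply hA, Measure.restrict_apply hA,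
      hm _ (hA.inter hW.measurableSet) inter_subset_right,
      hs _ (hA.inter hW.measurableSet) inter_subset_right]
    set C := Γ ⁻¹' (A ∩ W)
    have h1 : (fun x => (T.symm x).1) '' (Γ '' C) = C := by
      rw [image_image]; simp [hπΓ]
    have h2 : LipschitzOnWith 1 (fun x => (T.symm x).1) (Γ '' C) := by
      refine LipschitzOnWith.of_dist_le_mul fun x _ y _ => ?_
      rw [dist_eq_norm, dist_eq_norm, ← Prod.fst_sub, ← map_sub, NNReal.coe_one, one_mul]
      exact hT.norm_fst_symm_le _
    have h3 := euclideanHausdorffMeasure_image_le h2 2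
    rw [h1, EuclideanSpace.euclideanHausdorffMeasure_eq_volume] at h3
    simpa using h3
  · refine Measure.le_iff.2 fun A hA => ?_
    rw [Measure.smul_apply, Measure.restrict_apply hA, Measure.restrict_apply hA,
      hm _ (hA.inter hW.measurableSet) inter_subset_right,
      hs _ (hA.inter hW.measurableSet) inter_subset_right]
    have h1 := euclideanHausdorffMeasure_image_le ((lipschitzOnWith_graphMap hT hg
      (convex_ball _ _) hB).mono (hpre (A ∩ W) inter_subset_right)) 2
    rw [EuclideanSpace.euclideanHausdorffMeasure_eq_volume] at h1
    simpa [ENNReal.smul_def] using h1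
  · intro X hX hXc hXW
    have hHm : MeasurableSet (hypograph T g) :=
      T.toHomeomorph.measurableEmbedding.measurableSet_image.2
      (measurableSet_le measurable_snd (hg.continuous.measurable.comp measurable_fst))
    have h1 : ∫ x in Ω, divergence X x = ∫ x in hypograph T g, divergence X x := by
      rw [← integral_indicator hΩm, ← integral_indicator hHm]
      congr 1 with x
      by_cases hx : x ∈ tsupport X
      · by_cases hxΩ : x ∈ Ω
        · rw [indicator_of_mem hxΩ, indicator_of_mem ((hWΩ x (hXW hx)).1 hxΩ)]
        · rw [indicator_of_notMem hxΩ, indicator_of_notMem fun h => hxΩ ((hWΩ x (hXW hx)).2 h)]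
      · simp [indicator, divergence_eq_zero_of_notMem_tsupport hx]
    rw [h1, integral_divergence_hypograph hT hg hX hXc, integral_map hΓc.aemeasurable]
    · rw [setIntegral_eq_integral_of_forall_compl_eq_zero]
      · congr 1 with y
        rw [hπΓ]; rfl
      · intro y hy
        rw [image_eq_zero_of_notMem_tsupport (f := X), inner_zero_right]
        exact fun h => hy (hpre _ hXW h)
    · exact Continuous.aestronglyMeasurable (by have := hX.continuous; fun_prop)

end LiquidDrop

end

/-! ### Localization of fluxes and finiteness of the surface area -/

noncomputable section

namespace LiquidDrop

open Set Filter Topology Metric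
open scoped Manifold

theorem exists_cutoff {K N : Set E3} (hK : IsCompact K) (hN : IsOpen N) (hKN : K ⊆ N) :
    ∃ χ : E3 → ℝ, ContDiff ℝ 1 χ ∧ HasCompactSupport χ ∧ tsupport χ ⊆ N ∧
      (∀ᶠ x in 𝓝ˢ K, χ x = 1) ∧ ∀ x, χ x ∈ Icc 0 1 := by
  obtain ⟨L, hL, hKL, hLN⟩ := exists_compact_between hK hN hKN
  obtain ⟨χ, h1, h2, h3⟩ := exists_contMDiffMap_one_nhds_of_subset_interior (n := 1) 𝓘(ℝ, E3)
    hK.isClosed hKL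
  have hsub : tsupport χ ⊆ L := by
    refine closure_minimal (fun x hx => ?_) hL.isClosed
    by_contra h
    exact hx (h2 x h)
  exact ⟨χ, χ.contMDiff.contDiff, hL.of_isClosed_subset (isClosed_tsupport _) hsub,
    hsub.trans hLN, h1, h3⟩

theorem exists_partition {K : Set E3} (hK : IsCompact K) (V : E3 → Set E3)
    (hV : ∀ p ∈ K, IsOpen (V p) ∧ p ∈ V p) :
    ∃ (t : Finset E3) (χ : t → E3 → ℝ), (∀ i : t, i.1 ∈ K) ∧ (∀ i, ContDiff ℝ 1 (χ i)) ∧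
      (∀ i, tsupport (χ i) ⊆ V i) ∧ (∀ i x, 0 ≤ χ i x) ∧ ∀ x ∈ K, ∑ i, χ i x = 1 := by
  obtain ⟨t, ht, hKt⟩ := hK.elim_nhds_subcover V fun p hp => (hV p hp).1.mem_nhds (hV p hp).2
  obtain ⟨f, hf⟩ := SmoothPartitionOfUnity.exists_isSubordinate 𝓘(ℝ, E3) hK.isClosed
    (fun i : t => V i) (fun i => (hV i (ht i i.2)).1) (by simpa [iUnion_subtype] using hKt)
  refine ⟨t, fun i => f i, fun i => ht i i.2, fun i => ?_, hf, fun i x => f.nonneg i x,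
    fun x hx => ?_⟩
  · exact ((f i).contMDiff.contDiff).of_le (by exact_mod_cast le_top)
  · rw [← f.sum_eq_one hx, finsum_eq_sum_of_fintype]

theorem continuous_divergence {X : E3 → E3} (hX : ContDiff ℝ 1 X) : Continuous (divergence X) := by
  have h := hX.continuous_fderiv one_ne_zero
  unfold divergence
  fun_prop

theorem hasCompactSupport_divergence {X : E3 → E3} (hc : HasCompactSupport X) :
    HasCompactSupport (divergence X) :=
  HasCompactSupport.intro' hc.isCompact (isClosed_tsupport _)
    fun _ hx => divergence_eq_zero_of_notMem_tsupport hx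

theorem divergence_congr_of_eventuallyEq {X Y : E3 → E3} {x : E3} (h : X =ᶠ[𝓝 x] Y) :
    divergence X x = divergence Y x := by
  simp [divergence, h.fderiv_eq]

theorem divergence_sum {ι : Type*} (s : Finset ι) {X : ι → E3 → E3} {x : E3}
    (h : ∀ i ∈ s, DifferentiableAt ℝ (X i) x) :
    divergence (fun x => ∑ i ∈ s, X i x) x = ∑ i ∈ s, divergence (X i) x := by
  simp only [divergence]
  rw [Finset.sum_comm, fderiv_fun_sum h]
  simp

theorem divergence_smul {f : E3 → ℝ} {X : E3 → E3} {x : E3} (hf : DifferentiableAt ℝ f x)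
    (hX : DifferentiableAt ℝ X x) :
    divergence (fun x => f x • X x) x = f x * divergence X x + fderiv ℝ f x (X x) := by
  have h1 : fderiv ℝ f x (X x) = ∑ i, X x i * fderiv ℝ f x (EuclideanSpace.single i 1) := by
    conv_lhs => rw [← (EuclideanSpace.basisFun (Fin 3) ℝ).sum_repr (X x)]
    simp [map_sum]
  simp only [divergence]
  rw [fderiv_fun_smul hf hX, h1, Finset.mul_sum, ← Finset.sum_add_distrib]
  refine Finset.sum_congr rfl fun i _ => ?_
  simp [mul_comm]

theorem integral_divergence_eq_zero {X : E3 → E3} (hX : ContDiff ℝ 1 X)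
    (hc : HasCompactSupport X) : ∫ x, divergence X x = 0 := by
  have hi : ∀ v, Integrable fun x => fderiv ℝ X x v := fun v =>
    ((hX.continuous_fderiv one_ne_zero).clm_apply continuous_const
      ).integrable_of_hasCompactSupport (hc.fderiv_apply ℝ v)
  have h2 : ∀ i : Fin 3, ∫ x, fderiv ℝ X x (EuclideanSpace.single i 1) i = 0 := fun i => by
    have := (EuclideanSpace.proj i : E3 →L[ℝ] ℝ).integral_comp_comm
      (hi (EuclideanSpace.single i 1))
    rw [integral_fderiv_apply_eq_zero volume hX hc, map_zero] at this
    simpa using this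
  simp only [divergence]
  rw [integral_finsetSum]
  · simp [h2]
  · exact fun i _ => (EuclideanSpace.proj i : E3 →L[ℝ] ℝ).integrable_comp
      (hi (EuclideanSpace.single i 1))

/-- A vector field that vanishes near the boundary of `Ω` has no flux through it. -/
theorem setIntegral_divergence_eq_zero {Ω : Set E3} (hΩm : MeasurableSet Ω) {X : E3 → E3}
    (hX : ContDiff ℝ 1 X) (hc : HasCompactSupport X) (hd : tsupport X ⊆ (frontier Ω)ᶜ) :
    ∫ x in Ω, divergence X x = 0 := by
  -- Near every point the truncated field `indicator Ω X` coincides with `X` or with zero. It is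
  -- therefore `C^1` with compact support, and its divergence integrates to zero over the whole
  -- space.
  have key : ∀ x, (indicator Ω X =ᶠ[𝓝 x] X ∧ (x ∈ Ω ∨ x ∉ tsupport X)) ∨
      (indicator Ω X =ᶠ[𝓝 x] fun _ => 0) ∧ (x ∉ Ω ∨ x ∉ tsupport X) := by
    intro x
    by_cases hx : x ∈ tsupport X
    · have hxf := hd hx
      rw [mem_compl_iff, frontier_eq_closure_inter_closure, mem_inter_iff, not_and_or] at hxf
      rcases hxf with h | h
      · right
        have h1 : (closure Ω)ᶜ ∈ 𝓝 x := isClosed_closure.isOpen_compl.mem_nhds h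
        refine ⟨?_, Or.inl fun h' => h (subset_closure h')⟩
        filter_upwards [h1] with y hy
        exact indicator_of_notMem (fun h' => hy (subset_closure h')) _
      · left
        have h1 : (closure Ωᶜ)ᶜ ∈ 𝓝 x := isClosed_closure.isOpen_compl.mem_nhds h
        refine ⟨?_, Or.inl (by by_contra h'; exact h (subset_closure h'))⟩
        filter_upwards [h1] with y hy
        exact indicator_of_mem (by by_contra h'; exact hy (subset_closure h')) _
    · right
      refine ⟨?_, Or.inr hx⟩
      filter_upwards [(isClosed_tsupport X).isOpen_compl.mem_nhds hx] with y hy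
      simp [indicator, image_eq_zero_of_notMem_tsupport hy]
  have hZ : ContDiff ℝ 1 (indicator Ω X) := contDiff_iff_contDiffAt.2 fun x => by
    rcases key x with h | h
    · exact hX.contDiffAt.congr_of_eventuallyEq h.1
    · exact contDiffAt_const.congr_of_eventuallyEq h.1
  have hZc : HasCompactSupport (indicator Ω X) :=
    hc.mono (by rw [support_indicator]; exact inter_subset_right)
  rw [← integral_indicator hΩm, ← integral_divergence_eq_zero hZ hZc]
  congr 1 with x
  rcases key x with ⟨h1, h2⟩ | ⟨h1, h2⟩
  · rw [divergence_congr_of_eventuallyEq h1]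
    rcases h2 with h2 | h2
    · exact indicator_of_mem h2 _
    · simp [indicator, divergence_eq_zero_of_notMem_tsupport h2]
  · rw [divergence_congr_of_eventuallyEq h1]
    rcases h2 with h2 | h2
    · simp [indicator_of_notMem h2, divergence]
    · simp [indicator, divergence_eq_zero_of_notMem_tsupport h2]
      simp [divergence]

/-- The definition of a smooth boundary does not state `φ p = 0`. A nonzero value would keep its
sign near `p`, placing `p` in the interior of `Ω` or of its complement. -/
theorem HasSmoothBoundary.exists_defining {Ω : Set E3} (hs : HasSmoothBoundary Ω) {p : E3}
    (hp : p ∈ frontier Ω) : ∃ φ : E3 → ℝ, ContDiffAt ℝ 1 φ p ∧ φ p = 0 ∧ gradient φ p ≠ 0 ∧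
      ∀ᶠ x in 𝓝 p, (x ∈ Ω ↔ φ x ≤ 0) := by
  obtain ⟨U, φ, hU, hpU, hφ, hd, hΩ⟩ := hs p hp
  have hUn := hU.mem_nhds hpU
  have hC : ContDiffAt ℝ 1 φ p := (hφ.contDiffAt hUn).of_le (by exact_mod_cast le_top)
  have he : ∀ᶠ x in 𝓝 p, (x ∈ Ω ↔ φ x ≤ 0) := by filter_upwards [hUn] with x hx using hΩ x hx
  refine ⟨φ, hC, ?_, ?_, he⟩
  · rw [frontier_eq_closure_inter_closure] at hp
    refine le_antisymm (le_of_not_gt fun h => ?_) (le_of_not_gt fun h => ?_)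
    · have h1 := (hC.continuousAt.eventually_const_lt h).and he
      obtain ⟨x, hx, hx2⟩ := (mem_closure_iff_frequently.1 hp.1).and_eventually h1 |>.exists
      exact absurd (hx2.2.1 hx) (not_le.2 hx2.1)
    · have h1 := (hC.continuousAt.eventually_lt_const h).and he
      obtain ⟨x, hx, hx2⟩ := (mem_closure_iff_frequently.1 hp.2).and_eventually h1 |>.exists
      exact hx (hx2.2.2 hx2.1.le)
  · intro h
    exact hd (by rw [← toDual_gradient, h, map_zero])

theorem HasSmoothBoundary.exists_chart {Ω : Set E3} (hs : HasSmoothBoundary Ω)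
    (hΩm : MeasurableSet Ω) {p : E3} (hp : p ∈ frontier Ω) {ε : NNReal} (hε : 0 < ε) :
    ∃ (ν : E3) (W : Set E3) (m : Measure E3) (N : E3 → E3), ‖ν‖ = 1 ∧ p ∈ W ∧
      IsSurfaceChart Ω ν ε W m N := by
  obtain ⟨φ, h1, h2, h3, h4⟩ := hs.exists_defining hp
  obtain ⟨W, m, N, hp, hW⟩ := exists_isSurfaceChart hΩm h1 h2 h3 h4 hε
  refine ⟨_, W, m, N, ?_, hp, hW⟩
  rw [norm_smul, norm_inv, norm_norm, inv_mul_cancel₀ (norm_ne_zero_iff.2 h3)]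

/-- Each boundary point has a chart, here with `ε = 1`, in which surface measure is at most `4 m`
with `m` finite; compactness does the rest. -/
theorem isFiniteMeasure_surfaceMeasure {Ω : Set E3} (hc : IsCompact Ω)
    (hs : HasSmoothBoundary Ω) : IsFiniteMeasure (surfaceMeasure Ω) := by
  have hK : IsCompact (frontier Ω) := hc.of_isClosed_subset isClosed_frontier
    (frontier_subset_iff_isClosed.2 hc.isClosed)
  refine ⟨?_⟩
  have h1 : surfaceMeasure Ω univ = surfaceMeasure Ω (frontier Ω) := by
    simp [surfaceMeasure]
  rw [h1]
  refine hK.measure_lt_top_of_nhdsWithin fun p hp => ?_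
  obtain ⟨ν, W, m, N, -, hpW, hW⟩ := hs.exists_chart hc.measurableSet hp one_pos
  refine ⟨W, mem_nhdsWithin_of_mem_nhds (hW.isOpen.mem_nhds hpW), ?_⟩
  have := hW.isFiniteMeasure
  have h2 := hW.surfaceMeasure_le W
  rw [Measure.restrict_apply_self] at h2
  refine h2.trans_lt ?_
  rw [Measure.smul_apply, ENNReal.smul_def, smul_eq_mul]
  exact ENNReal.mul_lt_top ENNReal.coe_lt_top (measure_lt_top _ _)

end LiquidDrop

end

/-! ### Flux bounds by surface area and by perimeter -/

noncomputable section

namespace LiquidDrop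

open Set Filter Topology Metric

theorem contDiff_smul_field {χ : E3 → ℝ} {X : E3 → E3} (hχ : ContDiff ℝ 1 χ)
    (hX : ContDiff ℝ 1 X) : ContDiff ℝ 1 fun x => χ x • X x := by fun_prop

theorem hasCompactSupport_smul_field {χ : E3 → ℝ} {X : E3 → E3} (hX : HasCompactSupport X) :
    HasCompactSupport fun x => χ x • X x :=
  hX.mono fun x hx h0 => hx (by simp [h0])

theorem tsupport_smul_field_subset (χ : E3 → ℝ) (X : E3 → E3) :
    tsupport (fun x => χ x • X x) ⊆ tsupport χ :=
  closure_mono fun x hx h0 => hx (by simp [h0])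

/-- The flux of a compactly supported field is the sum of the fluxes of the localized fields. -/
theorem exists_partition_integral_divergence (Ω : Set E3) {X : E3 → E3} (hX : ContDiff ℝ 1 X)
    (hc : HasCompactSupport X) (V : E3 → Set E3) (hV : ∀ p, IsOpen (V p) ∧ p ∈ V p) :
    ∃ (t : Finset E3) (χ : t → E3 → ℝ), (∀ i, ContDiff ℝ 1 (χ i)) ∧
      (∀ i, tsupport (χ i) ⊆ V i) ∧ (∀ i x, 0 ≤ χ i x) ∧ (∀ x ∈ tsupport X, ∑ i, χ i x = 1) ∧
      ∫ x in Ω, divergence X x = ∑ i, ∫ x in Ω, divergence (fun x => χ i x • X x) x := by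
  obtain ⟨t, χ, -, h1, h2, h3, h4⟩ := exists_partition hc.isCompact V fun p _ => hV p
  refine ⟨t, χ, h1, h2, h3, h4, ?_⟩
  have hXi : ∀ i, ContDiff ℝ 1 fun x => χ i x • X x := fun i => contDiff_smul_field (h1 i) hX
  have hsum : X = fun x => ∑ i, χ i x • X x := by
    ext1 x
    rw [← Finset.sum_smul]
    by_cases hx : x ∈ tsupport X
    · rw [h4 x hx, one_smul]
    · rw [image_eq_zero_of_notMem_tsupport hx, smul_zero]
  have hint : ∀ i, Integrable (divergence fun x => χ i x • X x) := fun i =>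
    (continuous_divergence (hXi i)).integrable_of_hasCompactSupport
      (hasCompactSupport_divergence (hasCompactSupport_smul_field hc))
  rw [← integral_finsetSum _ fun i _ => (hint i).integrableOn]
  congr 1 with x
  conv_lhs => rw [hsum]
  exact divergence_sum _ fun i _ => (hXi i).differentiable one_ne_zero x

/-- At a boundary point take a chart: there `‖N‖ ≤ 1 + ε`, and `m` is at most the surface measure.
Away from the boundary there is no flux at all. -/
theorem HasSmoothBoundary.exists_local_flux_le {Ω : Set E3} (hΩ : IsCompact Ω)
    (hs : HasSmoothBoundary Ω) {X : E3 → E3} (hX : ContDiff ℝ 1 X) (hc : HasCompactSupport X)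
    {ε : NNReal} (hε : 0 < ε) (p : E3) :
    ∃ V : Set E3, (IsOpen V ∧ p ∈ V) ∧ ∀ χ : E3 → ℝ, ContDiff ℝ 1 χ → tsupport χ ⊆ V →
      (∀ x, 0 ≤ χ x) → ∫ x in Ω, divergence (fun x => χ x • X x) x ≤
        (1 + ε) * ∫ x, χ x * ‖X x‖ ∂(surfaceMeasure Ω) := by
  have := isFiniteMeasure_surfaceMeasure hΩ hs
  by_cases hp : p ∈ frontier Ω
  · obtain ⟨ν, W, m, N, hν, hpW, hW⟩ := hs.exists_chart hΩ.measurableSet hp hε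
    have := hW.isFiniteMeasure
    refine ⟨W, ⟨hW.isOpen, hpW⟩, fun χ hχ hsub h0 => ?_⟩
    have hYC : ContDiff ℝ 1 fun x => χ x • X x := contDiff_smul_field hχ hX
    have hYc : HasCompactSupport fun x => χ x • X x := hasCompactSupport_smul_field hc
    have hYW : tsupport (fun x => χ x • X x) ⊆ W := (tsupport_smul_field_subset _ _).trans hsub
    have hY0 : ∀ x ∉ W, χ x • X x = 0 := fun x hx => by
      rw [image_eq_zero_of_notMem_tsupport fun h => hx (hsub h), zero_smul]
    have hcont : Continuous fun x => ‖χ x • X x‖ := hYC.continuous.norm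
    have hi1 : ∀ (μ : Measure E3) [IsFiniteMeasure μ], Integrable (fun x => ‖χ x • X x‖) μ :=
      fun μ _ => hcont.integrable_of_hasCompactSupport hYc.norm
    have hi2 : Integrable (fun x => inner ℝ (N x) (χ x • X x)) m :=
      (hW.continuous_normal.inner hYC.continuous).integrable_of_hasCompactSupport
        (hYc.mono fun z hz h0 => hz (by simp [h0]))
    calc ∫ x in Ω, divergence (fun x => χ x • X x) x = ∫ x, inner ℝ (N x) (χ x • X x) ∂m :=
          hW.integral_divergence _ hYC hYc hYW
      _ = ∫ x in W, inner ℝ (N x) (χ x • X x) ∂m := by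
          rw [setIntegral_eq_integral_of_forall_compl_eq_zero]
          intro x hx
          rw [hY0 x hx, inner_zero_right]
      _ ≤ ∫ x in W, (1 + ε) * ‖χ x • X x‖ ∂m := by
          refine setIntegral_mono_on hi2.integrableOn ((hi1 m).const_mul _).integrableOn
            hW.isOpen.measurableSet fun x hx => ?_
          refine (real_inner_le_norm _ _).trans ?_
          gcongr
          calc ‖N x‖ = ‖ν + (N x - ν)‖ := by congr 1; abel
            _ ≤ ‖ν‖ + ‖N x - ν‖ := norm_add_le _ _
            _ ≤ 1 + ε := by rw [hν]; gcongr; exact hW.norm_normal_sub_le x hx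
      _ = (1 + ε) * ∫ x in W, ‖χ x • X x‖ ∂m := integral_const_mul _ _
      _ ≤ (1 + ε) * ∫ x in W, ‖χ x • X x‖ ∂(surfaceMeasure Ω) := by
          refine mul_le_mul_of_nonneg_left ?_ (by positivity)
          exact integral_mono_measure hW.le_surfaceMeasure
            (Eventually.of_forall fun x => norm_nonneg _) (hi1 _)
      _ = (1 + ε) * ∫ x, χ x * ‖X x‖ ∂(surfaceMeasure Ω) := by
          rw [setIntegral_eq_integral_of_forall_compl_eq_zero]
          · simp only [norm_smul, Real.norm_of_nonneg (h0 _)]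
          · intro x hx
            rw [hY0 x hx, norm_zero]
  · refine ⟨(frontier Ω)ᶜ, ⟨isClosed_frontier.isOpen_compl, hp⟩, fun χ hχ hsub h0 => ?_⟩
    rw [setIntegral_divergence_eq_zero hΩ.measurableSet (contDiff_smul_field hχ hX)
      (hasCompactSupport_smul_field hc)
      ((tsupport_smul_field_subset _ _).trans hsub)]
    exact mul_nonneg (by positivity) (integral_nonneg fun x => mul_nonneg (h0 x) (norm_nonneg _))

theorem exists_hasCompactSupport_eq {Ω : Set E3} (hΩ : IsCompact Ω) {X : E3 → E3}
    (hX : ContDiff ℝ 1 X) : ∃ Y : E3 → E3, ContDiff ℝ 1 Y ∧ HasCompactSupport Y ∧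
      ∀ᶠ x in 𝓝ˢ Ω, Y x = X x := by
  obtain ⟨χ, h1, h2, -, h3, -⟩ := exists_cutoff hΩ isOpen_univ (subset_univ _)
  refine ⟨fun x => χ x • X x, contDiff_smul_field h1 hX,
    h2.mono fun x hx h0 => hx (by simp [h0]), ?_⟩
  filter_upwards [h3] with x hx
  rw [hx, one_smul]

theorem setIntegral_divergence_congr {Ω : Set E3} (hΩm : MeasurableSet Ω) {X Y : E3 → E3}
    (h : ∀ᶠ x in 𝓝ˢ Ω, Y x = X x) :
    ∫ x in Ω, divergence Y x = ∫ x in Ω, divergence X x :=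
  setIntegral_congr_fun hΩm fun _ hx =>
    divergence_congr_of_eventuallyEq (eventually_nhdsSet_iff_forall.1 h _ hx)

/-- The flux of a vector field through the boundary of `Ω` is at most the surface integral of its
length. -/
theorem HasSmoothBoundary.integral_divergence_le {Ω : Set E3} (hΩ : IsCompact Ω)
    (hs : HasSmoothBoundary Ω) {X : E3 → E3} (hX : ContDiff ℝ 1 X) :
    ∫ x in Ω, divergence X x ≤ ∫ x, ‖X x‖ ∂(surfaceMeasure Ω) := by
  have := isFiniteMeasure_surfaceMeasure hΩ hs
  obtain ⟨Y, hY, hYc, hYX⟩ := exists_hasCompactSupport_eq hΩ hX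
  have h1 : ∫ x, ‖X x‖ ∂(surfaceMeasure Ω) = ∫ x, ‖Y x‖ ∂(surfaceMeasure Ω) := by
    refine setIntegral_congr_fun isClosed_frontier.measurableSet fun x hx => ?_
    rw [hYX.self_of_nhdsSet x (frontier_subset_iff_isClosed.2 hΩ.isClosed hx)]
  rw [← setIntegral_divergence_congr hΩ.measurableSet hYX, h1]
  -- A partition of unity adds up the local estimates while keeping the factor `1 + ε`, which
  -- disappears as `ε → 0`.
  have key : ∀ ε : NNReal, 0 < ε → ∫ x in Ω, divergence Y x ≤
      (1 + ε) * ∫ x, ‖Y x‖ ∂(surfaceMeasure Ω) := by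
    intro ε hε
    choose V hV hloc using hs.exists_local_flux_le hΩ hY hYc hε
    obtain ⟨t, χ, h1, h2, h3, h4, h5⟩ := exists_partition_integral_divergence Ω hY hYc V hV
    rw [h5]
    refine (Finset.sum_le_sum fun i _ => hloc i.1 (χ i) (h1 i) (h2 i) (h3 i)).trans ?_
    rw [← Finset.mul_sum, ← integral_finsetSum]
    · refine mul_le_mul_of_nonneg_left ?_ (by positivity)
      refine le_of_eq ?_
      congr 1 with x
      rw [← Finset.sum_mul]
      by_cases hx : x ∈ tsupport Y
      · rw [h4 x hx, one_mul]
      · rw [image_eq_zero_of_notMem_tsupport hx, norm_zero, mul_zero]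
    · intro i _
      exact ((h1 i).continuous.mul hY.continuous.norm).integrable_of_hasCompactSupport
        (hYc.norm.mul_left)
  have hcont : Continuous fun ε : NNReal => (1 + (ε : ℝ)) * ∫ x, ‖Y x‖ ∂(surfaceMeasure Ω) := by
    fun_prop
  have ht := (hcont.tendsto 0).mono_left (nhdsWithin_le_nhds (s := Ioi (0 : NNReal)))
  simp only [NNReal.coe_zero, add_zero, one_mul] at ht
  refine ge_of_tendsto ht ?_
  filter_upwards [self_mem_nhdsWithin] with ε hε using key ε hε

/-- The reverse inequality is never needed. In the estimates for general `Ω`, the damped field is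
paired with the perimeter itself and the excess field with the surface measure. -/
theorem HasSmoothBoundary.perimeter_le {Ω : Set E3} (hΩ : IsCompact Ω)
    (hs : HasSmoothBoundary Ω) : perimeter Ω ≤ surfaceMeasure Ω univ := by
  have := isFiniteMeasure_surfaceMeasure hΩ hs
  refine iSup_le fun X => iSup_le fun hX => iSup_le fun hc => iSup_le fun h1 => ?_
  refine ENNReal.ofReal_le_of_le_toReal ((hs.integral_divergence_le hΩ hX).trans ?_)
  calc ∫ x, ‖X x‖ ∂(surfaceMeasure Ω) ≤ ∫ x, 1 ∂(surfaceMeasure Ω) :=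
        integral_mono (hX.continuous.norm.integrable_of_hasCompactSupport hc.norm)
          (integrable_const _) h1
    _ = _ := by simp [Measure.real]

theorem HasSmoothBoundary.perimeter_lt_top {Ω : Set E3} (hΩ : IsCompact Ω)
    (hs : HasSmoothBoundary Ω) : perimeter Ω < ⊤ :=
  have := isFiniteMeasure_surfaceMeasure hΩ hs
  (hs.perimeter_le hΩ).trans_lt (measure_lt_top _ _)

/-- The flux of a vector field that is bounded by `M` near the boundary of `Ω` is at most `M` times
the perimeter. -/
theorem HasSmoothBoundary.integral_divergence_le_mul_perimeter {Ω : Set E3} (hΩ : IsCompact Ω)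
    (hs : HasSmoothBoundary Ω) {X : E3 → E3} (hX : ContDiff ℝ 1 X) {M : ℝ} (hM : 0 < M)
    {N : Set E3} (hN : IsOpen N) (hΩN : frontier Ω ⊆ N) (hXM : ∀ x ∈ N, ‖X x‖ ≤ M) :
    ∫ x in Ω, divergence X x ≤ M * (perimeter Ω).toReal := by
  obtain ⟨Y, hY, hYc, hYX⟩ := exists_hasCompactSupport_eq hΩ hX
  have hK : IsCompact (frontier Ω) := hΩ.of_isClosed_subset isClosed_frontier
    (frontier_subset_iff_isClosed.2 hΩ.isClosed)
  obtain ⟨χ, h1, h2, h3, h4, h5⟩ := exists_cutoff hK hN hΩN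
  -- `Z` competes in the definition of the perimeter, and `M • Z` agrees with `X` near the boundary.
  -- The difference has no flux, so a bound on `X` near the boundary is enough; the equality case
  -- relies on this.
  set Z : E3 → E3 := fun x => (M⁻¹ * χ x) • X x with hZ
  have hZC : ContDiff ℝ 1 Z := contDiff_smul_field (contDiff_const.mul h1) hX
  have hZc : HasCompactSupport Z := h2.mono fun x hx h0 => hx (by simp [hZ, h0])
  have hZ1 : ∀ x, ‖Z x‖ ≤ 1 := fun x => by
    by_cases hx : x ∈ tsupport χ
    · rw [hZ]
      simp only [norm_smul, norm_mul, norm_inv, Real.norm_of_nonneg hM.le,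
        Real.norm_of_nonneg (h5 x).1]
      calc M⁻¹ * χ x * ‖X x‖ ≤ M⁻¹ * 1 * M := by
            gcongr
            · exact (h5 x).2
            · exact hXM x (h3 hx)
        _ = 1 := by field_simp
    · simp [hZ, image_eq_zero_of_notMem_tsupport hx]
  have hle : ∫ x in Ω, divergence Z x ≤ (perimeter Ω).toReal := by
    refine (ENNReal.ofReal_le_iff_le_toReal (hs.perimeter_lt_top hΩ).ne).1 ?_
    exact le_iSup_of_le Z (le_iSup_of_le hZC (le_iSup_of_le hZc (le_iSup_of_le hZ1 le_rfl)))
  have hD : ContDiff ℝ 1 fun x => Y x - M • Z x := hY.sub (contDiff_smul_field contDiff_const hZC)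
  have hDc : HasCompactSupport fun x => Y x - M • Z x := hYc.sub (hasCompactSupport_smul_field hZc)
  have hd : tsupport (fun x => Y x - M • Z x) ⊆ (frontier Ω)ᶜ := by
    intro x hx hxf
    have h6 : ∀ᶠ y in 𝓝 x, Y y - M • Z y = 0 := by
      filter_upwards [eventually_nhdsSet_iff_forall.1 h4 x hxf, eventually_nhdsSet_iff_forall.1 hYX x
        (frontier_subset_iff_isClosed.2 hΩ.isClosed hxf)] with y hy1 hy2
      rw [hy2, hZ]
      simp only [hy1, smul_smul]
      rw [mul_one, mul_inv_cancel₀ hM.ne', one_smul, sub_self]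
    exact (notMem_tsupport_iff_eventuallyEq.2 h6) hx
  have h0 := setIntegral_divergence_eq_zero hΩ.measurableSet hD hDc hd
  have hsub : ∀ x, divergence (fun x => Y x - M • Z x) x = divergence Y x - M * divergence Z x := by
    intro x
    have e1 := hY.differentiable one_ne_zero x
    have e2 := hZC.differentiable one_ne_zero x
    simp only [divergence]
    rw [fderiv_fun_sub (g := fun x => M • Z x) e1 (e2.const_smul M), fderiv_fun_const_smul e2,
      Finset.mul_sum,
      ← Finset.sum_sub_distrib]
    simp
  simp_rw [hsub] at h0
  rw [integral_sub, integral_const_mul, sub_eq_zero] at h0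
  · rw [← setIntegral_divergence_congr hΩ.measurableSet hYX, h0]
    gcongr
  · exact ((continuous_divergence hY).integrable_of_hasCompactSupport
      (hasCompactSupport_divergence hYc)).integrableOn
  · exact (((continuous_divergence hZC).integrable_of_hasCompactSupport
      (hasCompactSupport_divergence hZc)).const_mul M).integrableOn

end LiquidDrop

end

/-! ### Area of the sphere and negligibility of the boundary -/

noncomputable section

namespace LiquidDrop

open Set Filter Topology Metric

theorem hasGradientAt_norm_sub_sq (c x : E3) (r : ℝ) :
    HasGradientAt (fun x => ‖x - c‖ ^ 2 - r ^ 2) ((2 : ℝ) • (x - c)) x := by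
  have h1 := (((hasFDerivAt_id (𝕜 := ℝ) x).sub_const c).norm_sq).sub_const (r ^ 2)
  rw [hasGradientAt_iff_hasFDerivAt]
  refine h1.congr_fderiv ?_
  ext v
  simp

theorem contDiff_norm_sub_sq (c : E3) (r : ℝ) {n : WithTop ℕ∞} :
    ContDiff ℝ n fun x : E3 => ‖x - c‖ ^ 2 - r ^ 2 :=
  ((contDiff_id.sub contDiff_const).norm_sq ℝ).sub contDiff_const

theorem mem_closedBall_iff_norm_sq {c x : E3} {r : ℝ} (hr : 0 < r) :
    x ∈ closedBall c r ↔ ‖x - c‖ ^ 2 - r ^ 2 ≤ 0 := by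
  rw [mem_closedBall, dist_eq_norm, sub_nonpos, sq_le_sq₀ (norm_nonneg _) hr.le]

theorem hasSmoothBoundary_closedBall (c : E3) {r : ℝ} (hr : 0 < r) :
    HasSmoothBoundary (closedBall c r) := by
  intro p hp
  rw [frontier_closedBall c hr.ne', mem_sphere, dist_eq_norm] at hp
  refine ⟨univ, fun x => ‖x - c‖ ^ 2 - r ^ 2, isOpen_univ, mem_univ _,
    (contDiff_norm_sub_sq c r).contDiffOn, fun h => ?_, fun x _ => mem_closedBall_iff_norm_sq hr⟩
  have h1 := (hasGradientAt_norm_sub_sq c p r).gradient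
  rw [gradient, h, map_zero] at h1
  have h2 : p - c = 0 := by simpa using h1.symm
  rw [h2, norm_zero] at hp
  exact hr.ne hp

/-- Near each point the flux of the outer unit normal field of a ball bounds the surface measure
from above, up to a small relative error. -/
theorem exists_local_surfaceMeasure_closedBall_le {c : E3} {r : ℝ} (hr : 0 < r) {X : E3 → E3}
    (hX : ContDiff ℝ 1 X) (hc : HasCompactSupport X)
    (hXr : ∀ x ∈ ball c (2 * r), X x = r⁻¹ • (x - c)) {ε : NNReal} (hε : 0 < ε) (hε1 : ε ≤ 1 / 3)
    (p : E3) :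
    ∃ V : Set E3, (IsOpen V ∧ p ∈ V) ∧ ∀ χ : E3 → ℝ, ContDiff ℝ 1 χ → tsupport χ ⊆ V →
      (∀ x, 0 ≤ χ x) → (1 - 3 * (ε : ℝ)) * ∫ x, χ x ∂(surfaceMeasure (closedBall c r)) ≤
        (1 + (ε : ℝ)) ^ 2 * ∫ x in closedBall c r, divergence (fun x => χ x • X x) x := by
  have hΩ : IsCompact (closedBall c r) := isCompact_closedBall c r
  have hε3 : 0 ≤ 1 - 3 * (ε : ℝ) := by
    have : (ε : ℝ) ≤ 1 / 3 := by exact_mod_cast hε1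
    linarith
  have hε1 : (ε : ℝ) ≤ 1 := by linarith
  have hfr : frontier (closedBall c r) = sphere c r := frontier_closedBall c hr.ne'
  by_cases hp : p ∈ sphere c r
  · have hpc : ‖p - c‖ = r := by rwa [mem_sphere, dist_eq_norm] at hp
    have hgrad := (hasGradientAt_norm_sub_sq c p r).gradient
    obtain ⟨W, m, N, hpW, hW⟩ := exists_isSurfaceChart (Ω := closedBall c r) hΩ.measurableSet
      (φ := fun x => ‖x - c‖ ^ 2 - r ^ 2) (p := p) (contDiff_norm_sub_sq c r).contDiffAt
      (by rw [hpc, sub_self]) (by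
        rw [hgrad, ← norm_ne_zero_iff, norm_smul, hpc]
        simp [hr.ne'])
      (Eventually.of_forall fun x => mem_closedBall_iff_norm_sq hr) hε
    have hν : ‖gradient (fun x => ‖x - c‖ ^ 2 - r ^ 2) p‖⁻¹ •
        gradient (fun x => ‖x - c‖ ^ 2 - r ^ 2) p = r⁻¹ • (p - c) := by
      rw [hgrad, norm_smul, hpc, smul_smul]
      congr 1
      simp
    rw [hν] at hW
    have := hW.isFiniteMeasure
    have hrε : 0 < r * ε := by positivity
    -- Within distance `r * ε` of `p` the radial field differs from its value `ν` at `p` by at most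
    -- `ε`.
    refine ⟨W ∩ ball p (r * ε), ⟨hW.isOpen.inter isOpen_ball, hpW, mem_ball_self hrε⟩,
      fun χ hχ hsub h0 => ?_⟩
    have hsubW : tsupport χ ⊆ W := hsub.trans inter_subset_left
    have hYC : ContDiff ℝ 1 fun x => χ x • X x := contDiff_smul_field hχ hX
    have hYc : HasCompactSupport fun x => χ x • X x := hasCompactSupport_smul_field hc
    have hχc : HasCompactSupport χ := by
      refine HasCompactSupport.of_support_subset_isCompact (isCompact_closedBall p (r * ε)) ?_
      exact (subset_tsupport χ).trans ((hsub.trans inter_subset_right).trans ball_subset_closedBall)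
    have hχ0 : ∀ x ∉ W, χ x = 0 := fun x hx =>
      image_eq_zero_of_notMem_tsupport fun h => hx (hsubW h)
    have hχi : ∀ (μ : Measure E3) [IsFiniteMeasure μ], Integrable χ μ :=
      fun μ _ => hχ.continuous.integrable_of_hasCompactSupport hχc
    have hi2 : Integrable (fun x => inner ℝ (N x) (χ x • X x)) m :=
      (hW.continuous_normal.inner hYC.continuous).integrable_of_hasCompactSupport
        (hYc.mono fun z hz h0 => hz (by simp [h0]))
    have hflux : ∫ x in closedBall c r, divergence (fun x => χ x • X x) x =
        ∫ x, inner ℝ (N x) (χ x • X x) ∂m :=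
      hW.integral_divergence _ hYC hYc ((tsupport_smul_field_subset χ X).trans hsubW)
    have hlow : (1 - 3 * (ε : ℝ)) * ∫ x, χ x ∂m ≤ ∫ x, inner ℝ (N x) (χ x • X x) ∂m := by
      rw [← integral_const_mul]
      refine integral_mono ((hχi m).const_mul _) hi2 fun x => ?_
      by_cases hx : x ∈ tsupport χ
      · have hxW : x ∈ W := hsubW hx
        have hxp : ‖x - p‖ < r * ε := by
          have := (hsub hx).2
          rwa [mem_ball, dist_eq_norm] at this
        have hxb : x ∈ ball c (2 * r) := by
          rw [mem_ball, dist_eq_norm]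
          calc ‖x - c‖ = ‖(x - p) + (p - c)‖ := by congr 1; abel
            _ ≤ ‖x - p‖ + ‖p - c‖ := norm_add_le _ _
            _ < r * ε + r := by rw [hpc]; gcongr
            _ ≤ r * 1 + r := by gcongr
            _ = 2 * r := by ring
        have h1 := hW.norm_normal_sub_le x hxW
        have h2 : ‖X x - r⁻¹ • (p - c)‖ ≤ ε := by
          rw [hXr x hxb, ← smul_sub, norm_smul, norm_inv, Real.norm_of_nonneg hr.le]
          have : x - c - (p - c) = x - p := by abel
          rw [this, inv_mul_le_iff₀ hr]
          exact hxp.le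
        set ν := r⁻¹ • (p - c)
        have hν1 : ‖ν‖ = 1 := by
          rw [norm_smul, norm_inv, Real.norm_of_nonneg hr.le, hpc, inv_mul_cancel₀ hr.ne']
        -- Expansion about `ν` leaves three error terms, each at least `-ε`; the quadratic one uses
        -- `ε ≤ 1`. This is the origin of `1 - 3 ε`.
        have hin : inner ℝ (N x) (X x) = 1 + inner ℝ ν (X x - ν) + inner ℝ (N x - ν) ν +
            inner ℝ (N x - ν) (X x - ν) := by
          simp only [inner_sub_left, inner_sub_right, real_inner_self_eq_norm_sq, hν1]
          ring
        have e1 := abs_le.1 ((abs_real_inner_le_norm ν (X x - ν)))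
        have e2 := abs_le.1 ((abs_real_inner_le_norm (N x - ν) ν))
        have e3 := abs_le.1 ((abs_real_inner_le_norm (N x - ν) (X x - ν)))
        rw [hν1] at e1 e2
        have e4 : ‖N x - ν‖ * ‖X x - ν‖ ≤ ε * 1 :=
          mul_le_mul h1 (h2.trans hε1) (norm_nonneg _) ε.coe_nonneg
        have e5 : 1 - 3 * (ε : ℝ) ≤ inner ℝ (N x) (X x) := by rw [hin]; linarith [e1.1, e2.1, e3.1]
        simp only [inner_smul_right]
        rw [mul_comm]
        exact mul_le_mul_of_nonneg_left e5 (h0 x)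
      · simp [image_eq_zero_of_notMem_tsupport hx]
    have hup : ∫ x, χ x ∂(surfaceMeasure (closedBall c r)) ≤ (1 + (ε : ℝ)) ^ 2 * ∫ x, χ x ∂m := by
      rw [← setIntegral_eq_integral_of_forall_compl_eq_zero hχ0,
        ← setIntegral_eq_integral_of_forall_compl_eq_zero (μ := m) hχ0]
      refine (integral_mono_measure hW.surfaceMeasure_le (Eventually.of_forall h0) ?_).trans
        (le_of_eq ?_)
      · exact ((hχi _).smul_measure_nnreal)
      · rw [integral_smul_nnreal_measure]
        simp [NNReal.smul_def]
    rw [hflux]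
    calc _ ≤ (1 - 3 * (ε : ℝ)) * ((1 + (ε : ℝ)) ^ 2 * ∫ x, χ x ∂m) := by gcongr
      _ = (1 + (ε : ℝ)) ^ 2 * ((1 - 3 * (ε : ℝ)) * ∫ x, χ x ∂m) := by ring
      _ ≤ _ := by gcongr
  · refine ⟨(sphere c r)ᶜ, ⟨isClosed_sphere.isOpen_compl, hp⟩, fun χ hχ hsub h0 => ?_⟩
    rw [setIntegral_divergence_eq_zero hΩ.measurableSet (contDiff_smul_field hχ hX)
      (hasCompactSupport_smul_field hc) ((tsupport_smul_field_subset χ X).trans (hfr ▸ hsub)),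
      surfaceMeasure, hfr, setIntegral_eq_zero_of_forall_eq_zero, mul_zero, mul_zero]
    exact fun x hx => image_eq_zero_of_notMem_tsupport fun h => hsub h hx

theorem divergence_smul_sub (a : ℝ) (c x : E3) : divergence (fun x => a • (x - c)) x = 3 * a := by
  have : fderiv ℝ (fun x : E3 => a • (x - c)) x = a • ContinuousLinearMap.id ℝ E3 :=
    (((hasFDerivAt_id x).sub_const c).const_smul a).fderiv
  simp [divergence, this]

/-- The surface area of a round sphere is at most `4 π r ^ 2`. -/
theorem surfaceMeasure_closedBall_le (c : E3) {r : ℝ} (hr : 0 < r) :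
    (surfaceMeasure (closedBall c r)).real univ ≤ 4 * Real.pi * r ^ 2 := by
  have hΩ : IsCompact (closedBall c r) := isCompact_closedBall c r
  have := isFiniteMeasure_surfaceMeasure hΩ (hasSmoothBoundary_closedBall c hr)
  have hfr : frontier (closedBall c r) = sphere c r := frontier_closedBall c hr.ne'
  obtain ⟨X, hX, hXc, hXr⟩ := exists_hasCompactSupport_eq (isCompact_closedBall c (2 * r))
    (X := fun x => r⁻¹ • (x - c)) (by fun_prop)
  have hXr' : ∀ x ∈ closedBall c (2 * r), X x = r⁻¹ • (x - c) := hXr.self_of_nhdsSet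
  -- Constant divergence `3 / r` times the volume of the ball.
  have hflux : ∫ x in closedBall c r, divergence X x = 4 * Real.pi * r ^ 2 := by
    rw [setIntegral_divergence_congr hΩ.measurableSet (X := fun x => r⁻¹ • (x - c))
      (hXr.filter_mono (nhdsSet_mono (closedBall_subset_closedBall (by linarith))))]
    simp only [divergence_smul_sub]
    rw [setIntegral_const, Measure.real, EuclideanSpace.volume_closedBall_fin_three,
      ENNReal.toReal_mul, ENNReal.toReal_pow, ENNReal.toReal_ofReal hr.le,
      ENNReal.toReal_ofReal (by positivity), smul_eq_mul]
    field_simp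
  have key : ∀ ε : NNReal, 0 < ε → ε ≤ 1 / 3 →
      (1 - 3 * (ε : ℝ)) * (surfaceMeasure (closedBall c r)).real univ ≤
        (1 + (ε : ℝ)) ^ 2 * (4 * Real.pi * r ^ 2) := by
    intro ε hε hε1
    choose V hV hloc using exists_local_surfaceMeasure_closedBall_le hr hX hXc
      (fun x hx => hXr' x (ball_subset_closedBall hx)) hε hε1
    obtain ⟨t, χ, h1, h2, h3, h4, h5⟩ :=
      exists_partition_integral_divergence (closedBall c r) hX hXc V hV
    have hle := Finset.sum_le_sum fun (i : t) (_ : i ∈ Finset.univ) =>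
      hloc i.1 (χ i) (h1 i) (h2 i) (h3 i)
    have hsupp : ∀ x ∈ sphere c r, ∑ i, χ i x = 1 := fun x hx => by
      refine h4 x (subset_tsupport X ?_)
      rw [mem_sphere, dist_eq_norm] at hx
      rw [Function.mem_support, hXr' x (by rw [mem_closedBall, dist_eq_norm]; linarith),
        ← norm_ne_zero_iff, norm_smul, hx, norm_inv, Real.norm_of_nonneg hr.le,
        inv_mul_cancel₀ hr.ne']
      exact one_ne_zero
    have hint : ∀ i, Integrable (χ i) (surfaceMeasure (closedBall c r)) := fun i => by
      refine Measure.integrableOn_of_bounded (M := 1)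
        (s := frontier (closedBall c r)) ?_ (h1 i).continuous.aestronglyMeasurable ?_
      · have := measure_lt_top (surfaceMeasure (closedBall c r)) univ
        rw [surfaceMeasure, Measure.restrict_apply_univ] at this
        exact this.ne
      · refine (ae_restrict_mem isClosed_frontier.measurableSet).mono fun x hx => ?_
        rw [Real.norm_of_nonneg (h3 i x), ← hsupp x (hfr ▸ hx)]
        exact Finset.single_le_sum (f := fun i => χ i x) (fun i _ => h3 i x) (Finset.mem_univ i)
    rw [← Finset.mul_sum, ← Finset.mul_sum, ← h5, hflux,
      ← integral_finsetSum _ fun i _ => hint i] at hle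
    refine le_trans (le_of_eq ?_) hle
    congr 1
    have : ∫ x, ∑ i, χ i x ∂(surfaceMeasure (closedBall c r)) =
        ∫ x, (1 : ℝ) ∂(surfaceMeasure (closedBall c r)) :=
      setIntegral_congr_fun isClosed_frontier.measurableSet fun x hx => hsupp x (hfr ▸ hx)
    rw [this, integral_const, smul_eq_mul, mul_one]
  have hc1 : Continuous fun ε : NNReal =>
      (1 - 3 * (ε : ℝ)) * (surfaceMeasure (closedBall c r)).real univ := by fun_prop
  have hc2 : Continuous fun ε : NNReal => (1 + (ε : ℝ)) ^ 2 * (4 * Real.pi * r ^ 2) := by fun_prop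
  have ht1 := (hc1.tendsto 0).mono_left (nhdsWithin_le_nhds (s := Ioi (0 : NNReal)))
  have ht2 := (hc2.tendsto 0).mono_left (nhdsWithin_le_nhds (s := Ioi (0 : NNReal)))
  simp only [NNReal.coe_zero, mul_zero, sub_zero, add_zero, one_pow, one_mul] at ht1 ht2
  refine le_of_tendsto_of_tendsto ht1 ht2 ?_
  filter_upwards [self_mem_nhdsWithin,
    nhdsWithin_le_nhds (Iic_mem_nhds (show (0 : NNReal) < 1 / 3 by positivity))] with ε h1 h2
  exact key ε h1 h2

/-- The boundary of a smooth compact set is Lebesgue negligible. -/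
theorem HasSmoothBoundary.volume_frontier {Ω : Set E3} (hΩ : IsCompact Ω)
    (hs : HasSmoothBoundary Ω) : volume (frontier Ω) = 0 := by
  have := isFiniteMeasure_surfaceMeasure hΩ hs
  have h1 := measure_lt_top (surfaceMeasure Ω) univ
  rw [surfaceMeasure, Measure.restrict_apply_univ] at h1
  -- A set of finite two-dimensional measure has zero three-dimensional measure.
  rcases Measure.euclideanHausdorffMeasure_zero_or_top (by norm_num : 2 < 3) (frontier Ω) with h | h
  · rwa [EuclideanSpace.euclideanHausdorffMeasure_eq_volume] at h
  · exact absurd h h1.ne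

end LiquidDrop

end

/-! ### Polar coordinates and half-moments of the sphere -/

noncomputable section

namespace LiquidDrop

open Set Filter Topology Metric

/-- Integration in polar coordinates in three dimensions. -/
theorem lintegral_polar {F : E3 → ℝ≥0∞} (hF : Measurable F) :
    ∫⁻ x, F x = ∫⁻ w : sphere (0 : E3) 1, ∫⁻ s in Ioi (0 : ℝ),
      ENNReal.ofReal (s ^ 2) * F (s • w.1) ∂volume ∂(volume : Measure E3).toSphere := by
  have hmp := (volume : Measure E3).measurePreserving_homeomorphUnitSphereProd
  have hsub : Measurable fun p : sphere (0 : E3) 1 × Ioi (0 : ℝ) => F (p.2.1 • p.1.1) :=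
    hF.comp (by fun_prop)
  have h1 : ∫⁻ x, F x = ∫⁻ x : ({0}ᶜ : Set E3), F x.1 ∂((volume : Measure E3).comap (↑)) := by
    rw [lintegral_subtype_comap (measurableSet_singleton _).compl, restrict_compl_singleton]
  have h2 : ∫⁻ x : ({0}ᶜ : Set E3), F x.1 ∂((volume : Measure E3).comap (↑)) =
      ∫⁻ p : sphere (0 : E3) 1 × Ioi (0 : ℝ), F (p.2.1 • p.1.1)
        ∂((volume : Measure E3).toSphere.prod (.volumeIoiPow 2)) := by
    have h3 := hmp.lintegral_comp hsub
    rw [finrank_euclideanSpace_fin] at h3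
    rw [← h3]
    refine lintegral_congr fun x => ?_
    congr 1
    have hx : ‖x.1‖ ≠ 0 := norm_ne_zero_iff.2 x.2
    simp [smul_smul, mul_inv_cancel₀ hx]
  rw [h1, h2, lintegral_prod _ hsub.aemeasurable]
  refine lintegral_congr fun w => ?_
  have hw : Measurable fun s : Ioi (0 : ℝ) => F (s.1 • w.1) := hF.comp (by fun_prop)
  refine (lintegral_withDensity_eq_lintegral_mul _ (f := fun r : Ioi (0 : ℝ) =>
    ENNReal.ofReal (r.1 ^ 2)) (by fun_prop) hw).trans ?_
  exact lintegral_subtype_comap measurableSet_Ioi fun s => ENNReal.ofReal (s ^ 2) * F (s • w.1)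

theorem lintegral_Ioo_pow (n : ℕ) {a : ℝ} (ha : 0 ≤ a) :
    ∫⁻ s in Ioo 0 a, ENNReal.ofReal (s ^ n) = ENNReal.ofReal (a ^ (n + 1) / (n + 1)) := by
  rw [Measure.restrict_congr_set Ioo_ae_eq_Ioc, ← ofReal_integral_eq_lintegral_ofReal
    (intervalIntegral.intervalIntegrable_pow _).1, ← intervalIntegral.integral_of_le ha]
  · simp
  · filter_upwards [ae_restrict_mem measurableSet_Ioc] with y hy using pow_nonneg hy.1.le _

/-- The integral over the unit ball of the squared positive part of a linear form. -/
def halfMoment (e : E3) : ℝ≥0∞ := ∫⁻ z in ball (0 : E3) 1, ENNReal.ofReal (inner ℝ e z) ^ 2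

theorem halfMoment_map (L : E3 ≃ₗᵢ[ℝ] E3) (e : E3) : halfMoment (L e) = halfMoment e := by
  have hpre : L ⁻¹' ball (0 : E3) 1 = ball (0 : E3) 1 := by
    ext z; simp
  rw [halfMoment, halfMoment, ← L.measurePreserving.setLIntegral_comp_preimage
    measurableSet_ball (by fun_prop), hpre]
  simp only [L.inner_map_map]

/-- A reflection takes one vector to the other, and the unit ball is invariant under it. -/
theorem halfMoment_congr {e f : E3} (h : ‖e‖ = ‖f‖) : halfMoment e = halfMoment f := by
  conv_rhs => rw [← Submodule.reflection_sub h]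
  exact (halfMoment_map _ e).symm

/-- Homogeneity of degree two leaves the radial factor `∫₀¹ s⁴ ds = 1/5`. -/
theorem halfMoment_eq_polar (e : E3) : halfMoment e =
    (∫⁻ w : sphere (0 : E3) 1, ENNReal.ofReal (inner ℝ e w.1) ^ 2
      ∂(volume : Measure E3).toSphere) * ENNReal.ofReal (1 / 5) := by
  rw [halfMoment, ← lintegral_indicator measurableSet_ball, lintegral_polar]
  · rw [← lintegral_mul_const _ (by fun_prop)]
    refine lintegral_congr fun w => ?_
    have hw : ‖w.1‖ = 1 := by simp
    have h1 : ∀ s ∈ Ioi (0 : ℝ), ENNReal.ofReal (s ^ 2) *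
        (ball (0 : E3) 1).indicator (fun z => ENNReal.ofReal (inner ℝ e z) ^ 2) (s • w.1) =
        (Ioo (0 : ℝ) 1).indicator (fun s => ENNReal.ofReal (inner ℝ e w.1) ^ 2 *
          ENNReal.ofReal (s ^ 4)) s := by
      intro s hs
      have hs' : 0 < s := hs
      by_cases h : s < 1
      · rw [indicator_of_mem, indicator_of_mem (show s ∈ Ioo (0 : ℝ) 1 from ⟨hs, h⟩),
          inner_smul_right, ENNReal.ofReal_mul hs'.le, mul_pow, ← ENNReal.ofReal_pow hs'.le,
          ← mul_assoc, ← ENNReal.ofReal_mul (by positivity), mul_comm]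
        · congr 2; ring
        · simpa [norm_smul, hw, abs_of_pos hs'] using h
      · rw [indicator_of_notMem, indicator_of_notMem (fun h' => h h'.2), mul_zero]
        simpa [norm_smul, hw, abs_of_pos hs'] using h
    rw [setLIntegral_congr_fun measurableSet_Ioi h1, lintegral_indicator measurableSet_Ioo,
      Measure.restrict_restrict measurableSet_Ioo,
      inter_eq_left.2 Ioo_subset_Ioi_self, lintegral_const_mul _ (by fun_prop),
      lintegral_Ioo_pow 4 zero_le_one]
    norm_num
  · exact Measurable.indicator (by fun_prop) measurableSet_ball

theorem lintegral_ball_norm_sq :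
    ∫⁻ z in ball (0 : E3) 1, ENNReal.ofReal (‖z‖ ^ 2) = ENNReal.ofReal (4 * Real.pi / 5) := by
  rw [← lintegral_indicator measurableSet_ball, lintegral_polar]
  · have h0 : ∀ w : sphere (0 : E3) 1, ∫⁻ s in Ioi (0 : ℝ), ENNReal.ofReal (s ^ 2) *
        (ball (0 : E3) 1).indicator (fun z => ENNReal.ofReal (‖z‖ ^ 2)) (s • w.1) =
          ENNReal.ofReal (1 / 5) := by
      intro w
      have hw : ‖w.1‖ = 1 := by simp
      have h1 : ∀ s ∈ Ioi (0 : ℝ), ENNReal.ofReal (s ^ 2) *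
          (ball (0 : E3) 1).indicator (fun z => ENNReal.ofReal (‖z‖ ^ 2)) (s • w.1) =
          (Ioo (0 : ℝ) 1).indicator (fun s => ENNReal.ofReal (s ^ 4)) s := by
        intro s hs
        have hs' : 0 < s := hs
        by_cases h : s < 1
        · rw [indicator_of_mem, indicator_of_mem (show s ∈ Ioo (0 : ℝ) 1 from ⟨hs, h⟩),
            norm_smul, hw, ← ENNReal.ofReal_mul (by positivity), Real.norm_of_nonneg hs'.le]
          · congr 1; ring
          · simpa [norm_smul, hw, abs_of_pos hs'] using h
        · rw [indicator_of_notMem, indicator_of_notMem (fun h' => h h'.2), mul_zero]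
          simpa [norm_smul, hw, abs_of_pos hs'] using h
      rw [setLIntegral_congr_fun measurableSet_Ioi h1, lintegral_indicator measurableSet_Ioo,
        Measure.restrict_restrict measurableSet_Ioo, inter_eq_left.2 Ioo_subset_Ioi_self,
        lintegral_Ioo_pow 4 zero_le_one]
      norm_num
    simp only [h0]
    rw [lintegral_const, Measure.toSphere_apply_univ, EuclideanSpace.volume_ball_fin_three,
      finrank_euclideanSpace_fin]
    rw [ENNReal.ofReal_one, one_pow, one_mul, ← ENNReal.ofReal_natCast,
      ← ENNReal.ofReal_mul (by positivity), ← ENNReal.ofReal_mul (by positivity)]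
    congr 1
    push_cast
    ring
  · exact Measurable.indicator (by fun_prop) measurableSet_ball

/-- The half-moments of the six vectors `±eᵢ` are equal and add up to the integral of `‖z‖²` over
the ball, so each is `(4π/5)/6`. -/
theorem halfMoment_eq {e : E3} (he : ‖e‖ = 1) :
    halfMoment e = ENNReal.ofReal (2 * Real.pi / 15) := by
  have h1 : ∀ z : E3, ENNReal.ofReal (‖z‖ ^ 2) = ∑ i : Fin 3,
      (ENNReal.ofReal (inner ℝ (EuclideanSpace.single i (1 : ℝ)) z) ^ 2 +
        ENNReal.ofReal (inner ℝ (-EuclideanSpace.single i (1 : ℝ)) z) ^ 2) := by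
    intro z
    have h2 : ∀ a : ℝ, ENNReal.ofReal a ^ 2 + ENNReal.ofReal (-a) ^ 2 = ENNReal.ofReal (a ^ 2) := by
      intro a
      rcases le_total 0 a with h | h
      · rw [ENNReal.ofReal_of_nonpos (by linarith : -a ≤ 0), ENNReal.ofReal_pow h]; simp
      · rw [ENNReal.ofReal_of_nonpos h, ← ENNReal.ofReal_pow (by linarith)]; simp
    simp only [inner_neg_left, h2]
    rw [← ENNReal.ofReal_sum_of_nonneg fun i _ => sq_nonneg _, EuclideanSpace.norm_sq_eq]
    simp [EuclideanSpace.inner_single_left]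
  have h2 := lintegral_ball_norm_sq
  simp only [h1] at h2
  rw [lintegral_finsetSum _ fun i _ => by fun_prop] at h2
  have h3 : ∀ i : Fin 3, ∫⁻ z in ball (0 : E3) 1,
      (ENNReal.ofReal (inner ℝ (EuclideanSpace.single i (1 : ℝ)) z) ^ 2 +
        ENNReal.ofReal (inner ℝ (-EuclideanSpace.single i (1 : ℝ)) z) ^ 2) =
      halfMoment e + halfMoment e := by
    intro i
    rw [lintegral_add_left (by fun_prop)]
    congr 1
    · exact halfMoment_congr (by rw [he]; simp)
    · exact halfMoment_congr (by rw [he, norm_neg]; simp)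
  simp only [h3, Finset.sum_const, Finset.card_univ, Fintype.card_fin] at h2
  have hfin : halfMoment e ≠ ⊤ := by
    intro h
    rw [h] at h2
    simp at h2
  rw [← ENNReal.ofReal_toReal hfin] at h2 ⊢
  rw [← ENNReal.ofReal_add (by positivity) (by positivity), nsmul_eq_mul,
    ← ENNReal.ofReal_natCast, ← ENNReal.ofReal_mul (by positivity),
    ENNReal.ofReal_eq_ofReal_iff (by positivity) (by positivity)] at h2
  congr 1
  push_cast at h2
  linarith

/-- This angular integral supplies the constants both in the total mass of the positive part of the
bathtub kernel and in the potential of a ball at its boundary. -/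
theorem lintegral_sphere_inner_sq {e : E3} (he : ‖e‖ = 1) :
    ∫⁻ w : sphere (0 : E3) 1, ENNReal.ofReal (inner ℝ e w.1) ^ 2 ∂(volume : Measure E3).toSphere =
      ENNReal.ofReal (2 * Real.pi / 3) := by
  have h := halfMoment_eq_polar e
  rw [halfMoment_eq he] at h
  have h5 : ENNReal.ofReal (1 / 5) * ENNReal.ofReal 5 = 1 := by
    rw [← ENNReal.ofReal_mul (by norm_num)]; norm_num
  have h6 := congrArg (· * ENNReal.ofReal 5) h
  simp only [mul_assoc, h5, mul_one] at h6
  rw [← h6, ← ENNReal.ofReal_mul (by positivity)]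
  congr 1
  ring

end LiquidDrop

end

/-! ### The bathtub kernel and its extremal ball -/

noncomputable section

namespace LiquidDrop

open Set Filter Topology Metric

/-- The component in direction `e` of the gravitational attraction of a unit point mass at `z`,
minus `c` times its potential. -/
def bathtubKernel (e : E3) (c : ℝ) (z : E3) : ℝ := inner ℝ e z / ‖z‖ ^ 3 - c / ‖z‖

theorem measurable_bathtubKernel (e : E3) (c : ℝ) : Measurable (bathtubKernel e c) := by
  unfold bathtubKernel
  fun_prop

/-- The polar Jacobian cancels the singularity, so along each ray the kernel becomes affine in the
radius. -/
theorem bathtubKernel_smul {e : E3} {c s : ℝ} (hs : 0 < s) {w : E3} (hw : ‖w‖ = 1) :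
    s ^ 2 * bathtubKernel e c (s • w) = inner ℝ e w - c * s := by
  rw [bathtubKernel, norm_smul, hw, inner_smul_right, Real.norm_of_nonneg hs.le]
  field_simp

/-- Completing the square. The ball has diameter `1/c` and the origin lies on its boundary sphere.
-/
theorem setOf_lt_inner_eq_ball {e : E3} (he : ‖e‖ = 1) {c : ℝ} (hc : 0 < c) :
    {z : E3 | c * ‖z‖ ^ 2 < inner ℝ e z} = ball ((2 * c)⁻¹ • e) (2 * c)⁻¹ := by
  ext z
  have h2c : 0 < (2 * c)⁻¹ := by positivity
  rw [mem_ball, dist_eq_norm, ← sq_lt_sq₀ (norm_nonneg _) h2c.le, norm_sub_sq_real,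
    norm_smul, he, inner_smul_right, real_inner_comm, Real.norm_of_nonneg h2c.le, mem_ofPred_eq]
  have h3 : (2 * c)⁻¹ * c = 1 / 2 := by field_simp
  have h4 : (2 * c)⁻¹ * (c * ‖z‖ ^ 2) < (2 * c)⁻¹ * inner ℝ e z ↔ c * ‖z‖ ^ 2 < inner ℝ e z :=
    mul_lt_mul_iff_right₀ h2c
  rw [← h4, ← mul_assoc, h3]
  constructor <;> intro h <;> linarith

theorem bathtubKernel_pos_iff (e : E3) (c : ℝ) (z : E3) :
    0 < bathtubKernel e c z ↔ c * ‖z‖ ^ 2 < inner ℝ e z := by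
  rcases eq_or_ne z 0 with rfl | hz
  · simp [bathtubKernel]
  · have hz' : 0 < ‖z‖ := norm_pos_iff.2 hz
    rw [bathtubKernel, sub_pos, div_lt_div_iff₀ hz' (by positivity)]
    have : c * ‖z‖ ^ 3 = (c * ‖z‖ ^ 2) * ‖z‖ := by ring
    rw [this]
    exact mul_lt_mul_iff_left₀ hz'

/-- On a ray with `a = e·w > 0` the positive part contributes `∫₀^{a/c} (a - c s) ds = a²/(2c)`. It
remains to integrate over directions. -/
theorem lintegral_bathtubKernel {e : E3} (he : ‖e‖ = 1) {c : ℝ} (hc : 0 < c) :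
    ∫⁻ z, ENNReal.ofReal (bathtubKernel e c z) = ENNReal.ofReal (Real.pi / (3 * c)) := by
  rw [lintegral_polar (measurable_bathtubKernel e c).ennreal_ofReal]
  have h1 : ∀ w : sphere (0 : E3) 1, ∫⁻ s in Ioi (0 : ℝ), ENNReal.ofReal (s ^ 2) *
      ENNReal.ofReal (bathtubKernel e c (s • w.1)) =
        ENNReal.ofReal (inner ℝ e w.1) ^ 2 * ENNReal.ofReal (1 / (2 * c)) := by
    intro w
    have hw : ‖w.1‖ = 1 := by simp
    set a := inner ℝ e w.1
    have h2 : ∀ s ∈ Ioi (0 : ℝ), ENNReal.ofReal (s ^ 2) *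
        ENNReal.ofReal (bathtubKernel e c (s • w.1)) =
          (Ioc 0 (a / c)).indicator (fun s => ENNReal.ofReal (a - c * s)) s := by
      intro s hs
      have hs' : 0 < s := hs
      rw [← ENNReal.ofReal_mul (by positivity), bathtubKernel_smul hs' hw]
      by_cases h : s ≤ a / c
      · rw [indicator_of_mem (show s ∈ Ioc 0 (a / c) from ⟨hs, h⟩)]
      · rw [indicator_of_notMem fun h' => h h'.2, ENNReal.ofReal_of_nonpos]
        rw [not_le, div_lt_iff₀ hc] at h
        linarith
    rw [setLIntegral_congr_fun measurableSet_Ioi h2, lintegral_indicator measurableSet_Ioc,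
      Measure.restrict_restrict measurableSet_Ioc, inter_eq_left.2 Ioc_subset_Ioi_self]
    rcases le_or_gt a 0 with ha | ha
    · rw [Ioc_eq_empty (not_lt.2 (div_nonpos_of_nonpos_of_nonneg ha hc.le)),
        ENNReal.ofReal_of_nonpos ha]
      simp
    · have hac : 0 ≤ a / c := by positivity
      rw [← ofReal_integral_eq_lintegral_ofReal, ← intervalIntegral.integral_of_le hac,
        ← ENNReal.ofReal_pow ha.le, ← ENNReal.ofReal_mul (by positivity)]
      · congr 1
        rw [intervalIntegral.integral_sub (by simp)
          (Continuous.intervalIntegrable (by fun_prop) _ _),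
          intervalIntegral.integral_const_mul, integral_id, intervalIntegral.integral_const]
        simp only [smul_eq_mul]
        field_simp
        ring
      · exact (Continuous.integrableOn_Icc (by fun_prop)).mono_set Ioc_subset_Icc_self
      · filter_upwards [ae_restrict_mem measurableSet_Ioc] with s hs
        have := (le_div_iff₀ hc).1 hs.2
        simp only [Pi.zero_apply]
        linarith
  simp only [h1]
  rw [lintegral_mul_const _ (by fun_prop), lintegral_sphere_inner_sq he,
    ← ENNReal.ofReal_mul (by positivity)]
  congr 1
  field_simp

/-- This is the potential of a ball at a point of its boundary. The chord in direction `w` has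
length `a/c` when `a = e·w > 0`, and contributes `∫₀^{a/c} s ds`. -/
theorem lintegral_ball_enorm_inv {e : E3} (he : ‖e‖ = 1) {c : ℝ} (hc : 0 < c) :
    ∫⁻ z in ball ((2 * c)⁻¹ • e) (2 * c)⁻¹, ‖z‖ₑ⁻¹ = ENNReal.ofReal (Real.pi / (3 * c ^ 2)) := by
  rw [← setOf_lt_inner_eq_ball he hc]
  have hm : MeasurableSet {z : E3 | c * ‖z‖ ^ 2 < inner ℝ e z} :=
    measurableSet_lt (by fun_prop) (by fun_prop)
  rw [← lintegral_indicator hm, lintegral_polar (Measurable.indicator (by fun_prop) hm)]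
  have h1 : ∀ w : sphere (0 : E3) 1, ∫⁻ s in Ioi (0 : ℝ), ENNReal.ofReal (s ^ 2) *
      {z : E3 | c * ‖z‖ ^ 2 < inner ℝ e z}.indicator (fun z => ‖z‖ₑ⁻¹) (s • w.1) =
        ENNReal.ofReal (inner ℝ e w.1) ^ 2 * ENNReal.ofReal (1 / (2 * c ^ 2)) := by
    intro w
    have hw : ‖w.1‖ = 1 := by simp
    set a := inner ℝ e w.1 with ha_def
    have h2 : ∀ s ∈ Ioi (0 : ℝ), ENNReal.ofReal (s ^ 2) *
        {z : E3 | c * ‖z‖ ^ 2 < inner ℝ e z}.indicator (fun z => ‖z‖ₑ⁻¹) (s • w.1) =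
          (Ioo 0 (a / c)).indicator (fun s => ENNReal.ofReal (s ^ 1)) s := by
      intro s hs
      have hs' : 0 < s := hs
      have hiff : s • w.1 ∈ {z : E3 | c * ‖z‖ ^ 2 < inner ℝ e z} ↔ s ∈ Ioo 0 (a / c) := by
        rw [mem_ofPred_eq, norm_smul, hw, inner_smul_right, Real.norm_of_nonneg hs'.le, mem_Ioo,
          lt_div_iff₀ hc, and_iff_right hs', ← ha_def]
        have : c * (s * 1) ^ 2 = s * (s * c) := by ring
        rw [this]
        exact mul_lt_mul_iff_right₀ hs'
      by_cases h : s ∈ Ioo 0 (a / c)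
      · rw [indicator_of_mem h, indicator_of_mem (hiff.2 h), enorm_smul,
          ← ofReal_norm w.1, hw, ENNReal.ofReal_one, mul_one,
          Real.enorm_eq_ofReal hs'.le, ← ENNReal.ofReal_inv_of_pos hs',
          ← ENNReal.ofReal_mul (by positivity)]
        congr 1
        field_simp
      · rw [indicator_of_notMem h, indicator_of_notMem fun h' => h (hiff.1 h'), mul_zero]
    rw [setLIntegral_congr_fun measurableSet_Ioi h2, lintegral_indicator measurableSet_Ioo,
      Measure.restrict_restrict measurableSet_Ioo, inter_eq_left.2 Ioo_subset_Ioi_self]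
    rcases le_or_gt a 0 with ha | ha
    · rw [Ioo_eq_empty (not_lt.2 (div_nonpos_of_nonpos_of_nonneg ha hc.le)),
        ENNReal.ofReal_of_nonpos ha]
      simp
    · rw [lintegral_Ioo_pow 1 (by positivity), ← ENNReal.ofReal_pow ha.le,
        ← ENNReal.ofReal_mul (by positivity)]
      congr 1
      push_cast
      field_simp
      norm_num
  simp only [h1]
  rw [lintegral_mul_const _ (by fun_prop), lintegral_sphere_inner_sq he,
    ← ENNReal.ofReal_mul (by positivity)]
  congr 1
  field_simp

end LiquidDrop

end

/-! ### Regularity of potentials with locally integrable kernels -/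

noncomputable section

namespace LiquidDrop

open Set Filter Topology Metric

theorem integrableOn_closedBall_norm_inv (R : ℝ) :
    IntegrableOn (fun z : E3 => ‖z‖⁻¹) (closedBall 0 R) := by
  refine IntegrableOn.mono_set (t := ball 0 (R + 1)) ?_ (closedBall_subset_ball (by linarith))
  rw [integrableOn_fun_norm_addHaar volume (f := fun y => y⁻¹), finrank_euclideanSpace_fin]
  refine IntegrableOn.congr_fun (f := fun y : ℝ => y) ?_ (fun y hy => ?_) measurableSet_Ioo
  · exact (continuous_id.integrableOn_Icc).mono_set Ioo_subset_Icc_self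
  · have := hy.1.ne'
    simp only [smul_eq_mul]
    field_simp

theorem integrableOn_closedBall_norm_sq_inv (R : ℝ) :
    IntegrableOn (fun z : E3 => (‖z‖ ^ 2)⁻¹) (closedBall 0 R) := by
  refine IntegrableOn.mono_set (t := ball 0 (R + 1)) ?_ (closedBall_subset_ball (by linarith))
  rw [integrableOn_fun_norm_addHaar volume (f := fun y => (y ^ 2)⁻¹), finrank_euclideanSpace_fin]
  refine IntegrableOn.congr_fun (f := fun y : ℝ => (1 : ℝ)) ?_ (fun y hy => ?_) measurableSet_Ioo
  · exact (continuous_const.integrableOn_Icc).mono_set Ioo_subset_Icc_self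
  · have := hy.1.ne'
    simp only [smul_eq_mul]
    field_simp

theorem integrableOn_comp_sub_of_le {G : Type*} [NormedAddCommGroup G]
    {Ω : Set E3} (hΩ : IsCompact Ω) {F : E3 → G}
    (hFm : StronglyMeasurable F) {h : E3 → ℝ} (hh : ∀ R, IntegrableOn h (closedBall 0 R))
    (hb : ∀ z ≠ 0, ‖F z‖ ≤ h z) (x : E3) : IntegrableOn (fun y => F (x - y)) Ω := by
  obtain ⟨R, hR⟩ := hΩ.isBounded.subset_closedBall x
  refine IntegrableOn.mono_set ?_ hR
  have h1 : IntegrableOn (fun y => h (x - y)) (closedBall x R) := by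
    have h2 := (hh R).integrable_indicator isClosed_closedBall.measurableSet
    rw [← integrable_indicator_iff isClosed_closedBall.measurableSet]
    refine (h2.comp_sub_left x).congr (Eventually.of_forall fun y => ?_)
    simp only [indicator, mem_closedBall, dist_eq_norm, sub_zero, norm_sub_rev]
  refine h1.mono' (hFm.comp_measurable (by fun_prop)).aestronglyMeasurable
    (ae_restrict_of_ae ?_)
  have h3 : ∀ᵐ y : E3, y ≠ x := by simp [ae_iff]
  filter_upwards [h3] with y hy using hb _ (sub_ne_zero.2 hy.symm)

/-- A potential whose kernel is dominated by a locally integrable function is continuous, jointly in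
the position and in a parameter on which the kernel depends continuously. -/
theorem continuous_integral_comp_sub {G : Type*} [NormedAddCommGroup G] [NormedSpace ℝ G]
    {Ω : Set E3} (hΩ : IsCompact Ω)
    (h0 : volume (frontier Ω) = 0) {F : ℝ → E3 → G} (hFm : ∀ δ, StronglyMeasurable (F δ))
    (hF : ∀ z ≠ 0, Continuous fun δ => F δ z) {h : E3 → ℝ}
    (hh : ∀ R, IntegrableOn h (closedBall 0 R)) (hb : ∀ δ, ∀ z ≠ 0, ‖F δ z‖ ≤ h z) :
    Continuous fun p : ℝ × E3 => ∫ y in Ω, F p.1 (p.2 - y) := by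
  -- After the substitution the singularity stays at the origin and only the domain moves, so a
  -- single dominating function works for all nearby points.
  have hshift : ∀ p : ℝ × E3, ∫ y in Ω, F p.1 (p.2 - y) =
      ∫ z, ((fun z => p.2 - z) ⁻¹' Ω).indicator (F p.1) z := by
    intro p
    rw [← integral_indicator hΩ.measurableSet, ← integral_sub_left_eq_self _ volume p.2]
    congr 1 with y
    by_cases hy : p.2 - y ∈ Ω
    · rw [indicator_of_mem hy, indicator_of_mem (show y ∈ (fun z => p.2 - z) ⁻¹' Ω from hy),
        sub_sub_cancel]
    · rw [indicator_of_notMem hy,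
        indicator_of_notMem (show y ∉ (fun z => p.2 - z) ⁻¹' Ω from hy)]
  simp_rw [hshift]
  refine continuous_iff_continuousAt.2 fun p => ?_
  obtain ⟨R, hR⟩ := hΩ.isBounded.subset_closedBall p.2
  refine continuousAt_of_dominated (bound := (closedBall 0 (R + 1)).indicator h) ?_ ?_ ?_ ?_
  · refine Eventually.of_forall fun q => ((hFm q.1).indicator ?_).aestronglyMeasurable
    exact hΩ.measurableSet.preimage (by fun_prop)
  · have : ∀ᶠ q : ℝ × E3 in 𝓝 p, ‖q.2 - p.2‖ < 1 := by
      have : ContinuousAt (fun q : ℝ × E3 => ‖q.2 - p.2‖) p := by fun_prop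
      exact this.eventually_lt continuousAt_const (by simp)
    filter_upwards [this] with q hq
    have h3 : ∀ᵐ z : E3, z ≠ 0 := by simp [ae_iff]
    filter_upwards [h3] with z hz0
    by_cases hz : q.2 - z ∈ Ω
    · rw [indicator_of_mem (show z ∈ (fun z => q.2 - z) ⁻¹' Ω from hz), indicator_of_mem]
      · exact hb _ _ hz0
      · have h1 := hR hz
        rw [mem_closedBall, dist_eq_norm] at h1
        rw [mem_closedBall_zero_iff]
        calc ‖z‖ = ‖(q.2 - p.2) - (q.2 - z - p.2)‖ := by congr 1; abel
          _ ≤ ‖q.2 - p.2‖ + ‖q.2 - z - p.2‖ := norm_sub_le _ _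
          _ ≤ R + 1 := by linarith
    · rw [indicator_of_notMem (show z ∉ (fun z => q.2 - z) ⁻¹' Ω from hz), norm_zero]
      by_cases hzR : z ∈ closedBall (0 : E3) (R + 1)
      · rw [indicator_of_mem hzR]
        exact (norm_nonneg _).trans (hb 0 z hz0)
      · rw [indicator_of_notMem hzR]
  · exact (hh _).integrable_indicator isClosed_closedBall.measurableSet
  · have h1 : volume ((fun z => p.2 - z) ⁻¹' frontier Ω) = 0 := by
      rwa [(Measure.measurePreserving_sub_left volume p.2).measure_preimage
        isClosed_frontier.measurableSet.nullMeasurableSet]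
    have h2 : ∀ᵐ z : E3, p.2 - z ∉ frontier Ω := by
      rw [ae_iff]
      simp only [not_not]
      exact h1
    have h3 : ∀ᵐ z : E3, z ≠ 0 := by simp [ae_iff]
    filter_upwards [h2, h3] with z hz hz0
    have hFc : ContinuousAt (fun q : ℝ × E3 => F q.1 z) p :=
      ((hF z hz0).comp continuous_fst).continuousAt
    have hsub : ContinuousAt (fun q : ℝ × E3 => q.2 - z) p := by fun_prop
    rw [frontier_eq_closure_inter_closure, mem_inter_iff, not_and_or] at hz
    rcases hz with hz | hz
    · have h4 : ∀ᶠ q : ℝ × E3 in 𝓝 p, q.2 - z ∈ (closure Ω)ᶜ :=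
        hsub.eventually_mem (isClosed_closure.isOpen_compl.mem_nhds hz)
      refine (continuousAt_const (y := (0 : G))).congr ?_
      filter_upwards [h4] with q hq
      exact (indicator_of_notMem (s := (fun z => q.2 - z) ⁻¹' Ω)
        (fun h' => hq (subset_closure h')) _).symm
    · have h4 : ∀ᶠ q : ℝ × E3 in 𝓝 p, q.2 - z ∈ (closure Ωᶜ)ᶜ :=
        hsub.eventually_mem (isClosed_closure.isOpen_compl.mem_nhds hz)
      refine hFc.congr ?_
      filter_upwards [h4] with q hq
      refine (indicator_of_mem ?_ _).symm
      by_contra h'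
      exact hq (subset_closure h')

theorem hasFDerivAt_integral_comp_sub {G : Type*} [NormedAddCommGroup G] [NormedSpace ℝ G]
    {Ω : Set E3} (hΩ : IsCompact Ω) {f : E3 → G}
    (hf : ContDiff ℝ 1 f) (x : E3) :
    HasFDerivAt (fun x => ∫ y in Ω, f (x - y)) (∫ y in Ω, fderiv ℝ f (x - y)) x := by
  have hfd := hf.continuous_fderiv one_ne_zero
  have hK : IsCompact ((fun p : E3 × E3 => p.1 - p.2) '' (closedBall x 1 ×ˢ Ω)) :=
    ((isCompact_closedBall x 1).prod hΩ).image (by fun_prop)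
  obtain ⟨C, hC⟩ := hK.exists_bound_of_continuousOn hfd.continuousOn
  refine (hasFDerivAt_integral_of_dominated_of_fderiv_le (𝕜 := ℝ) (μ := volume.restrict Ω)
    (F := fun x y => f (x - y)) (F' := fun x y => fderiv ℝ f (x - y)) (bound := fun _ => C)
    (ball_mem_nhds x one_pos) ?_ ?_ ?_ ?_ ?_ ?_)
  · exact Eventually.of_forall fun z => (by have := hf.continuous; fun_prop :
      Continuous fun y => f (z - y)).aestronglyMeasurable
  · exact (by have := hf.continuous; fun_prop :
      Continuous fun y => f (x - y)).continuousOn.integrableOn_compact hΩ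
  · exact (by fun_prop : Continuous fun y => fderiv ℝ f (x - y)).aestronglyMeasurable
  · filter_upwards [ae_restrict_mem hΩ.measurableSet] with y hy z hz
    exact hC _ ⟨(z, y), ⟨ball_subset_closedBall hz, hy⟩, rfl⟩
  · exact integrableOn_const hΩ.measure_lt_top.ne
  · refine Eventually.of_forall fun y z _ => ?_
    have h1 := (hf.differentiable one_ne_zero (z - y)).hasFDerivAt
    exact (h1.comp z ((hasFDerivAt_id z).sub_const y)).congr_fderiv (by ext; simp)

theorem contDiff_integral_comp_sub {G : Type*} [NormedAddCommGroup G] [NormedSpace ℝ G]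
    {Ω : Set E3} (hΩ : IsCompact Ω) {f : E3 → G}
    (hf : ContDiff ℝ 1 f) : ContDiff ℝ 1 fun x => ∫ y in Ω, f (x - y) := by
  rw [contDiff_one_iff_fderiv]
  refine ⟨fun x => (hasFDerivAt_integral_comp_sub hΩ hf x).differentiableAt, ?_⟩
  have : fderiv ℝ (fun x => ∫ y in Ω, f (x - y)) = fun x => ∫ y in Ω, fderiv ℝ f (x - y) :=
    funext fun x => (hasFDerivAt_integral_comp_sub hΩ hf x).fderiv
  rw [this]
  refine continuous_parametric_integral_of_continuous (f := fun x y => fderiv ℝ f (x - y)) ?_ hΩ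
  have := hf.continuous_fderiv one_ne_zero
  unfold Function.uncurry
  fun_prop

end LiquidDrop

end

/-! ### The softened potential, field and density -/

noncomputable section

namespace LiquidDrop

open Set Filter Topology Metric

/-- The power `p` of `‖z‖ ^ 2 + δ ^ 2`. -/
def softPow (p δ : ℝ) (z : E3) : ℝ := (‖z‖ ^ 2 + δ ^ 2) ^ p

/-- The Newtonian potential of `Ω`, softened at the length scale `δ`. -/
def softPotential (Ω : Set E3) (δ : ℝ) (x : E3) : ℝ := ∫ y in Ω, softPow (-1 / 2) δ (x - y)

/-- The gradient of the softened Newtonian potential. -/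
def softField (Ω : Set E3) (δ : ℝ) (x : E3) : E3 :=
  ∫ y in Ω, -(softPow (-3 / 2) δ (x - y) • (x - y))

/-- The softened indicator function of `Ω`, proportional to the Laplacian of `softPotential`. -/
def softDensity (Ω : Set E3) (δ : ℝ) (x : E3) : ℝ :=
  ∫ y in Ω, 3 * δ ^ 2 / (4 * Real.pi) * softPow (-5 / 2) δ (x - y)

theorem softPow_nonneg (p δ : ℝ) (z : E3) : 0 ≤ softPow p δ z := by
  unfold softPow; positivity

theorem softPow_pos (p δ : ℝ) {z : E3} (hz : z ≠ 0) : 0 < softPow p δ z := by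
  have := norm_pos_iff.2 hz
  unfold softPow; positivity

theorem measurable_softPow (p δ : ℝ) : Measurable (softPow p δ) := by
  unfold softPow; fun_prop

theorem continuous_softPow_left (p : ℝ) {z : E3} (hz : z ≠ 0) :
    Continuous fun δ => softPow p δ z := by
  have := norm_pos_iff.2 hz
  unfold softPow
  exact Continuous.rpow_const (by fun_prop) fun δ => Or.inl (by positivity)

theorem contDiff_softPow (p : ℝ) {δ : ℝ} (hδ : δ ≠ 0) {n : WithTop ℕ∞} :
    ContDiff ℝ n (softPow p δ) := by
  refine contDiff_iff_contDiffAt.2 fun z => ?_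
  refine ContDiffAt.rpow_const_of_ne ?_ (by positivity)
  exact ((contDiff_id.norm_sq ℝ).add contDiff_const).contDiffAt

theorem hasFDerivAt_softPow (p : ℝ) {δ : ℝ} (hδ : δ ≠ 0) (z : E3) :
    HasFDerivAt (softPow p δ) ((2 * p * softPow (p - 1) δ z) • innerSL ℝ z) z := by
  have h1 : HasFDerivAt (fun z : E3 => ‖z‖ ^ 2 + δ ^ 2) ((2 : ℝ) • innerSL ℝ z) z := by
    refine (((hasFDerivAt_id (𝕜 := ℝ) z).norm_sq).add_const (δ ^ 2)).congr_fderiv ?_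
    ext v
    simp
  have h2 := h1.rpow_const (p := p) (Or.inl (by positivity))
  refine h2.congr_fderiv ?_
  rw [smul_smul]
  congr 1
  unfold softPow
  ring

theorem softPow_neg_half (δ : ℝ) (z : E3) :
    softPow (-1 / 2) δ z = (√(‖z‖ ^ 2 + δ ^ 2))⁻¹ := by
  rw [softPow, Real.sqrt_eq_rpow, ← Real.rpow_neg (by positivity)]
  norm_num

theorem softPow_neg_three_half (δ : ℝ) (z : E3) :
    softPow (-3 / 2) δ z = (√(‖z‖ ^ 2 + δ ^ 2) ^ 3)⁻¹ := by
  rw [softPow, Real.sqrt_eq_rpow, ← Real.rpow_mul_natCast (by positivity) _ 3,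
    ← Real.rpow_neg (by positivity)]
  norm_num

theorem softPow_neg_half_le (δ : ℝ) {z : E3} (hz : z ≠ 0) : softPow (-1 / 2) δ z ≤ ‖z‖⁻¹ := by
  have hz' := norm_pos_iff.2 hz
  rw [softPow_neg_half]
  gcongr
  exact Real.le_sqrt_of_sq_le (by nlinarith [sq_nonneg δ])

theorem norm_softPow_smul_le (δ : ℝ) {z : E3} (hz : z ≠ 0) :
    ‖-(softPow (-3 / 2) δ z • z)‖ ≤ (‖z‖ ^ 2)⁻¹ := by
  have hz' := norm_pos_iff.2 hz
  rw [norm_neg, norm_smul, Real.norm_of_nonneg (softPow_nonneg _ _ _), softPow_neg_three_half]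
  calc (√(‖z‖ ^ 2 + δ ^ 2) ^ 3)⁻¹ * ‖z‖ ≤ (‖z‖ ^ 3)⁻¹ * ‖z‖ := by
        gcongr
        exact Real.le_sqrt_of_sq_le (by nlinarith [sq_nonneg δ])
    _ = (‖z‖ ^ 2)⁻¹ := by field_simp

theorem integrableOn_softPotential {Ω : Set E3} (hΩ : IsCompact Ω) (δ : ℝ) (x : E3) :
    IntegrableOn (fun y => softPow (-1 / 2) δ (x - y)) Ω :=
  integrableOn_comp_sub_of_le hΩ (measurable_softPow _ δ).stronglyMeasurable
    integrableOn_closedBall_norm_inv (fun _ hz => by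
      rw [Real.norm_of_nonneg (softPow_nonneg _ _ _)]; exact softPow_neg_half_le δ hz) x

theorem integrableOn_softField {Ω : Set E3} (hΩ : IsCompact Ω) (δ : ℝ) (x : E3) :
    IntegrableOn (fun y => -(softPow (-3 / 2) δ (x - y) • (x - y))) Ω :=
  integrableOn_comp_sub_of_le (F := fun z => -(softPow (-3 / 2) δ z • z)) hΩ
    ((measurable_softPow _ δ).smul measurable_id).neg.stronglyMeasurable
    integrableOn_closedBall_norm_sq_inv (fun _ hz => norm_softPow_smul_le δ hz) x

theorem continuous_softPotential {Ω : Set E3} (hΩ : IsCompact Ω) (h0 : volume (frontier Ω) = 0) :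
    Continuous fun p : ℝ × E3 => softPotential Ω p.1 p.2 :=
  continuous_integral_comp_sub hΩ h0 (F := fun δ z => softPow (-1 / 2) δ z)
    (fun δ => (measurable_softPow _ δ).stronglyMeasurable)
    (fun _ hz => continuous_softPow_left _ hz) integrableOn_closedBall_norm_inv fun δ _ hz => by
      rw [Real.norm_of_nonneg (softPow_nonneg _ _ _)]; exact softPow_neg_half_le δ hz

theorem continuous_softField {Ω : Set E3} (hΩ : IsCompact Ω) (h0 : volume (frontier Ω) = 0) :
    Continuous fun p : ℝ × E3 => softField Ω p.1 p.2 :=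
  continuous_integral_comp_sub hΩ h0 (F := fun δ z => -(softPow (-3 / 2) δ z • z))
    (fun δ => ((measurable_softPow _ δ).smul measurable_id).neg.stronglyMeasurable)
    (fun _ hz => ((continuous_softPow_left _ hz).smul continuous_const).neg)
    integrableOn_closedBall_norm_sq_inv fun δ _ hz => norm_softPow_smul_le δ hz

theorem contDiff_softPotential {Ω : Set E3} (hΩ : IsCompact Ω) {δ : ℝ} (hδ : δ ≠ 0) :
    ContDiff ℝ 1 (softPotential Ω δ) :=
  contDiff_integral_comp_sub hΩ (contDiff_softPow _ hδ)

theorem contDiff_softPow_smul (p : ℝ) {δ : ℝ} (hδ : δ ≠ 0) :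
    ContDiff ℝ 1 fun z : E3 => -(softPow p δ z • z) :=
  (contDiff_smul_field (contDiff_softPow _ hδ) contDiff_id).neg

theorem contDiff_softField {Ω : Set E3} (hΩ : IsCompact Ω) {δ : ℝ} (hδ : δ ≠ 0) :
    ContDiff ℝ 1 (softField Ω δ) :=
  contDiff_integral_comp_sub hΩ (contDiff_softPow_smul _ hδ)

theorem fderiv_softPotential {Ω : Set E3} (hΩ : IsCompact Ω) {δ : ℝ} (hδ : δ ≠ 0) (x v : E3) :
    fderiv ℝ (softPotential Ω δ) x v = inner ℝ (softField Ω δ x) v := by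
  have h1 := hasFDerivAt_integral_comp_sub hΩ (contDiff_softPow (-1 / 2) hδ) x
  have h2 : fderiv ℝ (softPotential Ω δ) x = _ := h1.fderiv
  have hcont : Continuous fun y => fderiv ℝ (softPow (-1 / 2) δ) (x - y) := by
    have := (contDiff_softPow (-1 / 2) hδ (n := 1)).continuous_fderiv one_ne_zero
    fun_prop
  rw [h2, ContinuousLinearMap.integral_apply (hcont.continuousOn.integrableOn_compact hΩ),
    softField,
    real_inner_comm, ← integral_inner (integrableOn_softField hΩ δ x)]
  congr 1 with y
  rw [(hasFDerivAt_softPow _ hδ _).fderiv]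
  simp only [smul_apply, innerSL_apply_apply, inner_neg_right, inner_smul_right,
    smul_eq_mul, real_inner_comm v]
  norm_num

/-- With `softPow (-5 / 2) δ z` factored out, the two terms are `-3(‖z‖² + δ²)` and `3‖z‖²`; only
`-3 δ²` remains. -/
theorem divergence_softPow_smul {δ : ℝ} (hδ : δ ≠ 0) (z : E3) :
    divergence (fun z => -(softPow (-3 / 2) δ z • z)) z = -(3 * δ ^ 2 * softPow (-5 / 2) δ z) := by
  have h1 : (fun z : E3 => -(softPow (-3 / 2) δ z • z)) =
      fun z => softPow (-3 / 2) δ z • ((-1 : ℝ) • (z - 0)) := by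
    ext1 z; simp
  rw [h1, divergence_smul (hasFDerivAt_softPow _ hδ z).differentiableAt (by fun_prop),
    divergence_smul_sub, (hasFDerivAt_softPow _ hδ z).fderiv]
  simp only [smul_apply, innerSL_apply_apply, inner_smul_right, sub_zero,
    real_inner_self_eq_norm_sq, smul_eq_mul]
  have h2 : softPow (-3 / 2) δ z = (‖z‖ ^ 2 + δ ^ 2) * softPow (-5 / 2) δ z := by
    rw [softPow, softPow, ← Real.rpow_one_add' (by positivity) (by norm_num)]
    norm_num
  have h3 : (-3 / 2 - 1 : ℝ) = -5 / 2 := by norm_num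
  rw [h3, h2]
  ring

theorem divergence_softField {Ω : Set E3} (hΩ : IsCompact Ω) {δ : ℝ} (hδ : δ ≠ 0) (x : E3) :
    divergence (softField Ω δ) x = -(4 * Real.pi * softDensity Ω δ x) := by
  have hC := contDiff_softPow_smul (-3 / 2) hδ
  have h1 := hasFDerivAt_integral_comp_sub hΩ hC x
  have h2 : fderiv ℝ (softField Ω δ) x = _ := h1.fderiv
  have hcont : Continuous fun y => fderiv ℝ (fun z : E3 => -(softPow (-3 / 2) δ z • z)) (x - y) := by
    have := hC.continuous_fderiv one_ne_zero
    fun_prop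
  have hint := hcont.continuousOn.integrableOn_compact (μ := volume) hΩ
  have h3 : ∀ i : Fin 3, (∫ y in Ω, fderiv ℝ (fun z : E3 => -(softPow (-3 / 2) δ z • z)) (x - y))
      (EuclideanSpace.single i 1) i = ∫ y in Ω,
        fderiv ℝ (fun z : E3 => -(softPow (-3 / 2) δ z • z)) (x - y)
          (EuclideanSpace.single i 1) i := by
    intro i
    rw [ContinuousLinearMap.integral_apply hint]
    exact ((EuclideanSpace.proj i : E3 →L[ℝ] ℝ).integral_comp_comm
      (hint.apply_continuousLinearMap _)).symm
  rw [divergence, h2]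
  simp only [h3]
  rw [← integral_finsetSum, softDensity, ← integral_const_mul, ← integral_neg]
  · congr 1 with y
    refine (divergence_softPow_smul hδ (x - y)).trans ?_
    field_simp
  · exact fun i _ => (EuclideanSpace.proj i : E3 →L[ℝ] ℝ).integrable_comp
      (hint.apply_continuousLinearMap _)

end LiquidDrop

end

/-! ### Convergence of the softened density -/

noncomputable section

namespace LiquidDrop

open Set Filter Topology Metric

/-- The mass in a ball of the density whose potential is the softened point source. -/
theorem integral_ball_softPow {δ : ℝ} (hδ : δ ≠ 0) (x : E3) {r : ℝ} (hr : 0 < r) :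
    ∫ y in ball x r, 3 * δ ^ 2 / (4 * Real.pi) * softPow (-5 / 2) δ (x - y) =
      r ^ 3 * (r ^ 2 + δ ^ 2) ^ (-3 / 2 : ℝ) := by
  set f : ℝ → ℝ := (Iio r).indicator fun s =>
    3 * δ ^ 2 / (4 * Real.pi) * (s ^ 2 + δ ^ 2) ^ (-5 / 2 : ℝ) with hf
  have h1 : ∫ y in ball x r, 3 * δ ^ 2 / (4 * Real.pi) * softPow (-5 / 2) δ (x - y) =
      ∫ z : E3, f ‖z‖ := by
    rw [← integral_indicator measurableSet_ball,
      ← integral_sub_left_eq_self (fun z : E3 => f ‖z‖) volume x]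
    congr 1 with y
    simp only [hf, indicator, mem_ball, dist_eq_norm, mem_Iio, norm_sub_rev y x, softPow]
  have h2 : ∀ s ∈ Ioi (0 : ℝ), s ^ 2 • f s = (Ioo 0 r).indicator (fun s =>
      s ^ 2 * (3 * δ ^ 2 / (4 * Real.pi) * (s ^ 2 + δ ^ 2) ^ (-5 / 2 : ℝ))) s := by
    intro s hs
    by_cases h : s < r
    · rw [hf, indicator_of_mem (show s ∈ Iio r from h), indicator_of_mem (show s ∈ Ioo 0 r from
        ⟨hs, h⟩), smul_eq_mul]
    · rw [hf, indicator_of_notMem (show s ∉ Iio r from h), indicator_of_notMem fun h' => h h'.2,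
        smul_zero]
  -- The mass within radius `s` has the closed form `s³ (s² + δ²)^(-3/2)`. It is always at most one,
  -- and tends to one as `δ → 0` with `s > 0` fixed.
  have hder : ∀ s : ℝ, HasDerivAt (fun s => s ^ 3 * (s ^ 2 + δ ^ 2) ^ (-3 / 2 : ℝ))
      (s ^ 2 * (3 * δ ^ 2 * (s ^ 2 + δ ^ 2) ^ (-5 / 2 : ℝ))) s := by
    intro s
    have e1 : HasDerivAt (fun s : ℝ => s ^ 2 + δ ^ 2) (2 * s) s := by
      simpa using (hasDerivAt_pow 2 s).add_const (δ ^ 2)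
    have e2 := (hasDerivAt_pow 3 s).mul (e1.rpow_const (p := -3 / 2) (Or.inl (by positivity)))
    refine e2.congr_deriv ?_
    have e3 : (s ^ 2 + δ ^ 2) ^ (-3 / 2 : ℝ) =
        (s ^ 2 + δ ^ 2) * (s ^ 2 + δ ^ 2) ^ (-5 / 2 : ℝ) := by
      rw [← Real.rpow_one_add' (by positivity) (by norm_num)]
      norm_num
    have e4 : (-3 / 2 - 1 : ℝ) = -5 / 2 := by norm_num
    rw [e4, e3]
    push_cast
    ring
  have hcont : Continuous fun s : ℝ => s ^ 2 * (3 * δ ^ 2 * (s ^ 2 + δ ^ 2) ^ (-5 / 2 : ℝ)) := by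
    have : Continuous fun s : ℝ => (s ^ 2 + δ ^ 2) ^ (-5 / 2 : ℝ) :=
      Continuous.rpow_const (by fun_prop) fun s => Or.inl (by positivity)
    fun_prop
  have hftc := intervalIntegral.integral_eq_sub_of_hasDerivAt (a := 0) (b := r)
    (fun s _ => hder s) (hcont.intervalIntegrable _ _)
  rw [h1, integral_fun_norm_addHaar, finrank_euclideanSpace_fin,
    setIntegral_congr_fun measurableSet_Ioi h2, setIntegral_indicator measurableSet_Ioo,
    inter_eq_right.2 Ioo_subset_Ioi_self, Measure.real, EuclideanSpace.volume_ball_fin_three,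
    ENNReal.toReal_mul, ENNReal.toReal_pow, ENNReal.toReal_ofReal zero_le_one,
    ENNReal.toReal_ofReal (by positivity), ← integral_Ioc_eq_integral_Ioo,
    ← intervalIntegral.integral_of_le hr.le]
  have h3 : ∀ s : ℝ, s ^ 2 * (3 * δ ^ 2 / (4 * Real.pi) * (s ^ 2 + δ ^ 2) ^ (-5 / 2 : ℝ)) =
      (4 * Real.pi)⁻¹ * (s ^ 2 * (3 * δ ^ 2 * (s ^ 2 + δ ^ 2) ^ (-5 / 2 : ℝ))) := fun s => by
    field_simp
  simp only [h3]
  rw [intervalIntegral.integral_const_mul, hftc]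
  simp
  field_simp

theorem integrableOn_softDensity {δ : ℝ} (hδ : δ ≠ 0) (x : E3) {A : Set E3}
    (hA : Bornology.IsBounded A) :
    IntegrableOn (fun y => 3 * δ ^ 2 / (4 * Real.pi) * softPow (-5 / 2) δ (x - y)) A := by
  have hc : Continuous fun y => 3 * δ ^ 2 / (4 * Real.pi) * softPow (-5 / 2) δ (x - y) := by
    have := (contDiff_softPow (-5 / 2) hδ (n := 0)).continuous
    fun_prop
  exact (hc.continuousOn.integrableOn_compact hA.isCompact_closure).mono_set subset_closure

theorem softDensity_nonneg (Ω : Set E3) (δ : ℝ) (x : E3) : 0 ≤ softDensity Ω δ x :=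
  integral_nonneg fun y => mul_nonneg (by positivity) (softPow_nonneg _ _ _)

/-- Enclose `Ω` in a ball about `x`; the kernel has mass at most one in every such ball. -/
theorem softDensity_le_one {Ω : Set E3} (hΩ : IsCompact Ω) {δ : ℝ} (hδ : δ ≠ 0) (x : E3) :
    softDensity Ω δ x ≤ 1 := by
  obtain ⟨R, hR⟩ := hΩ.isBounded.subset_ball x
  set r := max R 1
  have hr : 0 < r := lt_max_of_lt_right one_pos
  have h1 : softDensity Ω δ x ≤ r ^ 3 * (r ^ 2 + δ ^ 2) ^ (-3 / 2 : ℝ) := by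
    rw [← integral_ball_softPow hδ x hr]
    exact setIntegral_mono_set (integrableOn_softDensity hδ x isBounded_ball)
      (Eventually.of_forall fun y => mul_nonneg (by positivity) (softPow_nonneg _ _ _))
      (Eventually.of_forall (hR.trans (ball_subset_ball (le_max_left _ _))))
  refine h1.trans ?_
  have h2 : (r ^ 2 + δ ^ 2) ^ (-3 / 2 : ℝ) ≤ (r ^ 2) ^ (-3 / 2 : ℝ) :=
    Real.rpow_le_rpow_of_nonpos (by positivity) (by nlinarith [sq_nonneg δ]) (by norm_num)
  have h3 : (r ^ 2) ^ (-3 / 2 : ℝ) = (r ^ 3)⁻¹ := by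
    rw [← Real.rpow_natCast, ← Real.rpow_mul hr.le, ← Real.rpow_natCast, ← Real.rpow_neg hr.le]
    norm_num
  calc _ ≤ r ^ 3 * (r ^ 3)⁻¹ := by rw [← h3]; gcongr
    _ = 1 := by field_simp

/-- As `δ → 0`, the mass of the kernel concentrates in any fixed ball about `x`, in particular in
one contained in `Ω`. -/
theorem tendsto_softDensity {Ω : Set E3} (hΩ : IsCompact Ω) {x : E3} (hx : x ∈ interior Ω) :
    Tendsto (fun δ => softDensity Ω δ x) (𝓝[≠] 0) (𝓝 1) := by
  obtain ⟨r, hr, hrΩ⟩ := Metric.isOpen_iff.1 isOpen_interior x hx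
  have hlow : ∀ᶠ δ in 𝓝[≠] (0 : ℝ), r ^ 3 * (r ^ 2 + δ ^ 2) ^ (-3 / 2 : ℝ) ≤ softDensity Ω δ x := by
    filter_upwards [self_mem_nhdsWithin] with δ hδ
    rw [← integral_ball_softPow hδ x hr]
    exact setIntegral_mono_set (integrableOn_softDensity hδ x hΩ.isBounded)
      (Eventually.of_forall fun y => mul_nonneg (by positivity) (softPow_nonneg _ _ _))
      (Eventually.of_forall (hrΩ.trans interior_subset))
  have hup : ∀ᶠ δ in 𝓝[≠] (0 : ℝ), softDensity Ω δ x ≤ 1 := by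
    filter_upwards [self_mem_nhdsWithin] with δ hδ using softDensity_le_one hΩ hδ x
  refine tendsto_of_tendsto_of_tendsto_of_le_of_le' ?_ tendsto_const_nhds hlow hup
  have hc : Continuous fun δ : ℝ => r ^ 3 * (r ^ 2 + δ ^ 2) ^ (-3 / 2 : ℝ) :=
    continuous_const.mul (Continuous.rpow_const (by fun_prop) fun s => Or.inl (by positivity))
  have h1 := (hc.tendsto 0).mono_left (nhdsWithin_le_nhds (s := {0}ᶜ))
  have h3 : r ^ 3 * (r ^ 2 + 0 ^ 2) ^ (-3 / 2 : ℝ) = 1 := by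
    have : (r ^ 2 + 0 ^ 2) ^ (-3 / 2 : ℝ) = (r ^ 3)⁻¹ := by
      rw [zero_pow two_ne_zero, add_zero, ← Real.rpow_natCast, ← Real.rpow_mul hr.le,
        ← Real.rpow_natCast, ← Real.rpow_neg hr.le]
      norm_num
    rw [this]
    field_simp
  rwa [h3] at h1

theorem continuous_softDensity {Ω : Set E3} (hΩ : IsCompact Ω) {δ : ℝ} (hδ : δ ≠ 0) :
    Continuous (softDensity Ω δ) := by
  have h : softDensity Ω δ = fun x => -(4 * Real.pi)⁻¹ * divergence (softField Ω δ) x := by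
    ext1 x
    rw [divergence_softField hΩ hδ]
    field_simp
  rw [h]
  exact continuous_const.mul (continuous_divergence (contDiff_softField hΩ hδ))

/-- Almost every point of `Ω` is interior because the boundary is null; the densities are dominated
by one. -/
theorem tendsto_integral_softDensity {Ω : Set E3} (hΩ : IsCompact Ω)
    (h0 : volume (frontier Ω) = 0) :
    Tendsto (fun δ => ∫ x in Ω, softDensity Ω δ x) (𝓝[≠] 0) (𝓝 (volume.real Ω)) := by
  have h1 : volume.real Ω = ∫ x in Ω, (1 : ℝ) := by simp
  rw [h1]
  refine tendsto_integral_filter_of_dominated_convergence (fun _ => 1) ?_ ?_ ?_ ?_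
  · filter_upwards [self_mem_nhdsWithin] with δ hδ
    exact (continuous_softDensity hΩ hδ).aestronglyMeasurable
  · filter_upwards [self_mem_nhdsWithin] with δ hδ
    refine Eventually.of_forall fun x => ?_
    rw [Real.norm_of_nonneg (softDensity_nonneg _ _ _)]
    exact softDensity_le_one hΩ hδ x
  · exact integrableOn_const hΩ.measure_lt_top.ne
  · have h2 : ∀ᵐ x : E3, x ∉ frontier Ω := by
      rw [ae_iff]
      simp only [not_not]
      exact h0
    filter_upwards [ae_restrict_of_ae h2, ae_restrict_mem hΩ.measurableSet] with x hx hxΩ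
    refine tendsto_softDensity hΩ ?_
    by_contra h
    exact hx ⟨subset_closure hxΩ, h⟩

end LiquidDrop

end

/-! ### The pointwise field bound and its equality case -/

noncomputable section

namespace LiquidDrop

open Set Filter Topology Metric

theorem setOf_le_inner_eq_closedBall {e : E3} (he : ‖e‖ = 1) {c : ℝ} (hc : 0 < c) :
    {z : E3 | c * ‖z‖ ^ 2 ≤ inner ℝ e z} = closedBall ((2 * c)⁻¹ • e) (2 * c)⁻¹ := by
  ext z
  have h2c : 0 < (2 * c)⁻¹ := by positivity
  rw [mem_closedBall, dist_eq_norm, ← sq_le_sq₀ (norm_nonneg _) h2c.le, norm_sub_sq_real,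
    norm_smul, he, inner_smul_right, real_inner_comm, Real.norm_of_nonneg h2c.le, mem_ofPred_eq]
  have h3 : (2 * c)⁻¹ * c = 1 / 2 := by field_simp
  have h4 : (2 * c)⁻¹ * (c * ‖z‖ ^ 2) ≤ (2 * c)⁻¹ * inner ℝ e z ↔ c * ‖z‖ ^ 2 ≤ inner ℝ e z :=
    mul_le_mul_iff_right₀ h2c
  rw [← h4, ← mul_assoc, h3]
  constructor <;> intro h <;> linarith

theorem bathtubKernel_neg_iff (e : E3) (c : ℝ) (z : E3) :
    bathtubKernel e c z < 0 ↔ inner ℝ e z < c * ‖z‖ ^ 2 := by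
  have h := bathtubKernel_pos_iff (-e) (-c) z
  have h1 : bathtubKernel (-e) (-c) z = -bathtubKernel e c z := by
    simp only [bathtubKernel, inner_neg_left]; ring
  rw [h1, inner_neg_left, neg_pos] at h
  rw [h]
  constructor <;> intro h' <;> linarith

/-- The softened version of `bathtubKernel`. -/
def softBathtubKernel (e : E3) (c δ : ℝ) (z : E3) : ℝ :=
  softPow (-3 / 2) δ z * inner ℝ e z - c * softPow (-1 / 2) δ z

theorem softBathtubKernel_zero (e : E3) (c : ℝ) : softBathtubKernel e c 0 = bathtubKernel e c := by
  ext z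
  rw [softBathtubKernel, bathtubKernel, softPow_neg_half, softPow_neg_three_half,
    zero_pow two_ne_zero, add_zero, Real.sqrt_sq (norm_nonneg _)]
  ring

/-- Write the kernel as `t⁻¹ (a t⁻² - c)`, where softening replaces `t = ‖z‖` by a larger value.
Where it is positive one has `a > 0`, and the expression decreases in `t`. Hence the field bound has
the same constant for every `δ`. -/
theorem ofReal_softBathtubKernel_le (e : E3) {c : ℝ} (hc : 0 < c) (δ : ℝ) {z : E3} (hz : z ≠ 0) :
    ENNReal.ofReal (softBathtubKernel e c δ z) ≤ ENNReal.ofReal (bathtubKernel e c z) := by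
  have hz' := norm_pos_iff.2 hz
  rw [softBathtubKernel, bathtubKernel, softPow_neg_half, softPow_neg_three_half]
  set t := √(‖z‖ ^ 2 + δ ^ 2)
  have ht : ‖z‖ ≤ t := Real.le_sqrt_of_sq_le (by nlinarith [sq_nonneg δ])
  have ht' : 0 < t := hz'.trans_le ht
  set a := inner ℝ e z
  have h1 : (t ^ 3)⁻¹ * a - c * t⁻¹ = t⁻¹ * (a * (t ^ 2)⁻¹ - c) := by field_simp
  have h2 : a / ‖z‖ ^ 3 - c / ‖z‖ = ‖z‖⁻¹ * (a * (‖z‖ ^ 2)⁻¹ - c) := by field_simp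
  rw [h1, h2]
  rcases le_or_gt (a * (t ^ 2)⁻¹ - c) 0 with h | h
  · rw [ENNReal.ofReal_of_nonpos (mul_nonpos_of_nonneg_of_nonpos (by positivity) h)]
    exact zero_le
  · have ha : 0 < a := by
      by_contra h'
      have : a * (t ^ 2)⁻¹ ≤ 0 := mul_nonpos_of_nonpos_of_nonneg (not_lt.1 h') (by positivity)
      linarith
    refine ENNReal.ofReal_le_ofReal ?_
    gcongr

theorem lintegral_bathtubKernel_sub {e : E3} (he : ‖e‖ = 1) {c : ℝ} (hc : 0 < c) (x : E3) :
    ∫⁻ y, ENNReal.ofReal (bathtubKernel e c (y - x)) = ENNReal.ofReal (Real.pi / (3 * c)) := by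
  rw [lintegral_sub_right_eq_self (fun y => ENNReal.ofReal (bathtubKernel e c y)) x,
    lintegral_bathtubKernel he hc]

theorem softPow_sub_comm (p δ : ℝ) (x y : E3) : softPow p δ (x - y) = softPow p δ (y - x) := by
  rw [softPow, softPow, norm_sub_rev]

theorem integrableOn_softBathtubKernel {Ω : Set E3} (hΩ : IsCompact Ω) (e : E3) (c δ : ℝ) (x : E3) :
    IntegrableOn (fun y => softBathtubKernel e c δ (y - x)) Ω := by
  refine (((integrableOn_softField hΩ δ x).const_inner e).sub
    ((integrableOn_softPotential hΩ δ x).const_mul c)).congr (Eventually.of_forall fun y => ?_)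
  simp only [Pi.sub_apply, softBathtubKernel, softPow_sub_comm _ _ x y]
  rw [← smul_neg, neg_sub, inner_smul_right]

theorem integral_softBathtubKernel {Ω : Set E3} (hΩ : IsCompact Ω) (e : E3) (c δ : ℝ) (x : E3) :
    ∫ y in Ω, softBathtubKernel e c δ (y - x) =
      inner ℝ e (softField Ω δ x) - c * softPotential Ω δ x := by
  rw [softField, softPotential, ← integral_inner (integrableOn_softField hΩ δ x),
    ← integral_const_mul, ← integral_sub]
  · congr 1 with y
    simp only [softBathtubKernel, softPow_sub_comm _ _ x y]
    rw [← smul_neg, neg_sub, inner_smul_right]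
  · exact (integrableOn_softField hΩ δ x).const_inner e
  · exact (integrableOn_softPotential hΩ δ x).const_mul c

/-- Given the potential of a mass distribution of density at most one, its attraction is largest
for a ball touching the point under consideration. -/
theorem inner_softField_le {Ω : Set E3} (hΩ : IsCompact Ω) {e : E3} (he : ‖e‖ = 1) {c : ℝ}
    (hc : 0 < c) (δ : ℝ) (x : E3) :
    inner ℝ e (softField Ω δ x) ≤ c * softPotential Ω δ x + Real.pi / (3 * c) := by
  have h1 := integral_softBathtubKernel hΩ e c δ x
  have h2 := integral_eq_lintegral_pos_part_sub_lintegral_neg_part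
    (integrableOn_softBathtubKernel hΩ e c δ x)
  have hne : ∀ᵐ y : E3, y ≠ x := by simp [ae_iff]
  -- The negative part is discarded and `Ω` is enlarged to the whole space. The equality case
  -- consists in showing that neither operation loses anything.
  have h3 : ∫⁻ y in Ω, ENNReal.ofReal (softBathtubKernel e c δ (y - x)) ≤
      ENNReal.ofReal (Real.pi / (3 * c)) := by
    rw [← lintegral_bathtubKernel_sub he hc x]
    refine (lintegral_mono_ae (ae_restrict_of_ae ?_)).trans (setLIntegral_le_lintegral _ _)
    filter_upwards [hne] with y hy
    exact ofReal_softBathtubKernel_le e hc δ (sub_ne_zero.2 hy)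
  have h4 := ENNReal.toReal_mono ENNReal.ofReal_ne_top h3
  rw [ENNReal.toReal_ofReal (by positivity)] at h4
  have h5 := ENNReal.toReal_nonneg
    (a := ∫⁻ y in Ω, ENNReal.ofReal (-softBathtubKernel e c δ (y - x)))
  linarith

theorem softPotential_pos {Ω : Set E3} (hΩ : IsCompact Ω) (hv : volume Ω ≠ 0) (δ : ℝ) (x : E3) :
    0 < softPotential Ω δ x := by
  rw [softPotential, setIntegral_pos_iff_support_of_nonneg_ae
    (Eventually.of_forall fun y => softPow_nonneg _ _ _) (integrableOn_softPotential hΩ δ x)]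
  have h1 : Ω \ {x} ⊆ (Function.support fun y => softPow (-1 / 2) δ (x - y)) ∩ Ω := fun y hy =>
    ⟨(softPow_pos _ _ (sub_ne_zero.2 fun h => hy.2 h.symm)).ne', hy.1⟩
  refine lt_of_lt_of_le ?_ (measure_mono h1)
  rw [measure_sdiff_null (measure_singleton x)]
  exact pos_iff_ne_zero.2 hv

/-- Apply the directional bound with `e` along the field. -/
theorem norm_softField_le {Ω : Set E3} (hΩ : IsCompact Ω) {c : ℝ} (hc : 0 < c) (δ : ℝ) (x : E3) :
    ‖softField Ω δ x‖ ≤ c * softPotential Ω δ x + Real.pi / (3 * c) := by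
  rcases eq_or_ne (softField Ω δ x) 0 with h | h
  · rw [h, norm_zero]
    have h1 : 0 ≤ softPotential Ω δ x := integral_nonneg fun y => softPow_nonneg _ _ _
    positivity
  · have hn := norm_pos_iff.2 h
    have h1 := inner_softField_le hΩ (e := ‖softField Ω δ x‖⁻¹ • softField Ω δ x)
      (by rw [norm_smul, norm_inv, norm_norm, inv_mul_cancel₀ hn.ne']) hc δ x
    rw [inner_smul_left, real_inner_self_eq_norm_sq] at h1
    refine le_trans (le_of_eq ?_) h1
    simp only [conj_trivial]
    field_simp

/-- The value of the parameter that optimizes `norm_softField_le`. -/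
theorem exists_optimal_slope {V : ℝ} (hV : 0 < V) :
    ∃ c, 0 < c ∧ (c * V + Real.pi / (3 * c)) ^ 2 = 4 * Real.pi / 3 * V := by
  -- This minimizer makes the two summands `c * V` and `π / (3 * c)` equal.
  refine ⟨√(Real.pi / (3 * V)), by positivity, ?_⟩
  set c := √(Real.pi / (3 * V))
  have hc : 0 < c := by positivity
  have hc2 : c ^ 2 = Real.pi / (3 * V) := Real.sq_sqrt (by positivity)
  have h1 : Real.pi / (3 * c) = c * V := by
    rw [div_eq_iff (by positivity)]
    have : c * V * (3 * c) = c ^ 2 * (3 * V) := by ring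
    rw [this, hc2]
    field_simp
  rw [h1]
  have : (c * V + c * V) ^ 2 = 4 * c ^ 2 * V ^ 2 := by ring
  rw [this, hc2]
  field_simp

theorem norm_softField_sq_le {Ω : Set E3} (hΩ : IsCompact Ω) (hv : volume Ω ≠ 0) (δ : ℝ) (x : E3) :
    ‖softField Ω δ x‖ ^ 2 ≤ 4 * Real.pi / 3 * softPotential Ω δ x := by
  obtain ⟨c, hc, h⟩ := exists_optimal_slope (softPotential_pos hΩ hv δ x)
  rw [← h]
  gcongr
  exact norm_softField_le hΩ hc δ x

/-- A boundary point is a limit of points directly below it in graph coordinates, and these are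
interior. So `Ω` has no lower-dimensional pieces that Lebesgue measure could miss. -/
theorem HasSmoothBoundary.subset_closure_interior {Ω : Set E3}
    (hs : HasSmoothBoundary Ω) : Ω ⊆ closure (interior Ω) := by
  intro p hp
  by_cases hpf : p ∈ frontier Ω
  · obtain ⟨φ, h1, h2, h3, h4⟩ := hs.exists_defining hpf
    obtain ⟨T, g, W, r, -, -, hg, hW, hpW, hWΩ, -, -⟩ := exists_hypograph h1 h2 h3 h4 one_pos
    obtain ⟨z, hz, rfl⟩ := (hWΩ p hpW).1 hp
    have hO : IsOpen (T '' {z | z.2 < g z.1} ∩ W) :=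
      (T.toHomeomorph.isOpenMap _
        (isOpen_lt continuous_snd (hg.continuous.comp continuous_fst))).inter hW
    have hOΩ : T '' {z | z.2 < g z.1} ∩ W ⊆ interior Ω := by
      refine interior_maximal (fun x hx => ?_) hO
      obtain ⟨w, hw, rfl⟩ := hx.1
      exact (hWΩ _ hx.2).2 ⟨w, (le_of_lt hw : w.2 ≤ g w.1), rfl⟩
    have ht : Tendsto (fun s : ℝ => T (z.1, z.2 - s)) (𝓝[>] 0) (𝓝 (T z)) := by
      have : Continuous fun s : ℝ => T (z.1, z.2 - s) := by fun_prop
      have h5 := (this.tendsto 0).mono_left (nhdsWithin_le_nhds (s := Ioi (0 : ℝ)))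
      simpa using h5
    refine mem_closure_of_tendsto ht ?_
    filter_upwards [self_mem_nhdsWithin, ht.eventually_mem (hW.mem_nhds hpW)] with s hs hsW
    refine hOΩ ⟨⟨_, ?_, rfl⟩, hsW⟩
    have hs' : 0 < s := hs
    have hz' : z.2 ≤ g z.1 := hz
    rw [mem_ofPred_eq]
    simp only
    linarith
  · refine subset_closure ?_
    by_contra h
    exact hpf ⟨subset_closure hp, h⟩

theorem HasSmoothBoundary.volume_ne_zero {Ω : Set E3} (hne : Ω.Nonempty)
    (hs : HasSmoothBoundary Ω) : volume Ω ≠ 0 := by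
  obtain ⟨p, hp⟩ := hne
  have h1 : (interior Ω).Nonempty := closure_nonempty_iff.1 ⟨p, hs.subset_closure_interior hp⟩
  exact fun h => (isOpen_interior.measure_pos volume h1).ne'
    (measure_mono_null interior_subset h)

/-- The open sets `interior Ω \ closedBall c r` and `ball c r \ Ω` are null, hence empty. Taking
closures turns almost everywhere containment into equality. -/
theorem HasSmoothBoundary.eq_closedBall_of_ae {Ω : Set E3} (hΩ : IsClosed Ω)
    (hs : HasSmoothBoundary Ω) {c : E3} {r : ℝ} (hr : 0 < r)
    (h1 : ∀ᵐ y, y ∈ Ω → y ∈ closedBall c r) (h2 : ∀ᵐ y, y ∉ Ω → y ∉ ball c r) :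
    Ω = closedBall c r := by
  refine Subset.antisymm ?_ ?_
  · have h3 : volume (interior Ω \ closedBall c r) = 0 := by
      refine measure_mono_null (fun y hy => ?_) (ae_iff.1 h1)
      exact fun h => hy.2 (h (interior_subset hy.1))
    have h4 : interior Ω \ closedBall c r = ∅ :=
      ((isOpen_interior.sdiff isClosed_closedBall).measure_eq_zero_iff volume).1 h3
    exact hs.subset_closure_interior.trans
      (closure_minimal (sdiff_eq_empty.1 h4) isClosed_closedBall)
  · have h3 : volume (ball c r \ Ω) = 0 := by
      refine measure_mono_null (fun y hy => ?_) (ae_iff.1 h2)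
      exact fun h => h hy.2 hy.1
    have h4 : ball c r \ Ω = ∅ := ((isOpen_ball.sdiff hΩ).measure_eq_zero_iff volume).1 h3
    rw [← closure_ball c hr.ne']
    exact closure_minimal (sdiff_eq_empty.1 h4) hΩ

/-- If the attraction at one point is as large as the potential permits, `Ω` is a ball. -/
theorem HasSmoothBoundary.isRoundBall_of_norm_softField_sq_eq {Ω : Set E3} (hΩ : IsCompact Ω)
    (hv : volume Ω ≠ 0) (hs : HasSmoothBoundary Ω) {x : E3}
    (h : ‖softField Ω 0 x‖ ^ 2 = 4 * Real.pi / 3 * softPotential Ω 0 x) : IsRoundBall Ω := by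
  have hV := softPotential_pos hΩ hv 0 x
  obtain ⟨c, hc, hcV⟩ := exists_optimal_slope hV
  rw [← h, sq_eq_sq₀ (by positivity) (norm_nonneg _)] at hcV
  have hn : 0 < ‖softField Ω 0 x‖ := by rw [← hcV]; positivity
  set e := ‖softField Ω 0 x‖⁻¹ • softField Ω 0 x with he_def
  have he : ‖e‖ = 1 := by rw [he_def, norm_smul, norm_inv, norm_norm, inv_mul_cancel₀ hn.ne']
  have hin : inner ℝ e (softField Ω 0 x) = ‖softField Ω 0 x‖ := by
    rw [he_def, inner_smul_left, real_inner_self_eq_norm_sq]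
    simp only [conj_trivial]
    field_simp
  have h1 := integral_softBathtubKernel hΩ e c 0 x
  have hint := integrableOn_softBathtubKernel hΩ e c 0 x
  have h2 := integral_eq_lintegral_pos_part_sub_lintegral_neg_part hint
  rw [softBathtubKernel_zero] at h1 h2 hint
  have hfm : Measurable fun y => bathtubKernel e c (y - x) :=
    (measurable_bathtubKernel e c).comp (by fun_prop)
  have htot := lintegral_bathtubKernel_sub he hc x
  have hsplit := lintegral_add_compl (μ := volume)
    (fun y => ENNReal.ofReal (bathtubKernel e c (y - x))) hΩ.measurableSet
  rw [htot] at hsplit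
  set a := ∫⁻ y in Ω, ENNReal.ofReal (bathtubKernel e c (y - x))
  set b := ∫⁻ y in Ω, ENNReal.ofReal (-bathtubKernel e c (y - x))
  set d := ∫⁻ y in Ωᶜ, ENNReal.ofReal (bathtubKernel e c (y - x))
  have ha : a ≠ ⊤ := ne_top_of_le_ne_top ENNReal.ofReal_ne_top (hsplit ▸ le_self_add)
  have hd : d ≠ ⊤ := ne_top_of_le_ne_top ENNReal.ofReal_ne_top (hsplit ▸ le_add_self)
  have hb : b ≠ ⊤ := by
    have := hint.neg.lintegral_lt_top
    exact this.ne
  have hsum : a.toReal + d.toReal = Real.pi / (3 * c) := by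
    rw [← ENNReal.toReal_add ha hd, hsplit, ENNReal.toReal_ofReal (by positivity)]
  -- Equality in the field bound says `a - b = π/(3c)`, while the total mass is `a + d = π/(3c)`.
  -- Hence `b + d = 0` with both terms nonnegative.
  have hbd : b.toReal = 0 ∧ d.toReal = 0 := by
    have e1 : 0 ≤ b.toReal := ENNReal.toReal_nonneg
    have e2 : 0 ≤ d.toReal := ENNReal.toReal_nonneg
    rw [hin] at h1
    constructor <;> linarith
  have hb0 : b = 0 := (ENNReal.toReal_eq_zero_iff _).1 hbd.1 |>.resolve_right hb
  have hd0 : d = 0 := (ENNReal.toReal_eq_zero_iff _).1 hbd.2 |>.resolve_right hd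
  rw [setLIntegral_eq_zero_iff hΩ.measurableSet (show Measurable fun y =>
    ENNReal.ofReal (-bathtubKernel e c (y - x)) from hfm.neg.ennreal_ofReal)] at hb0
  rw [setLIntegral_eq_zero_iff hΩ.measurableSet.compl hfm.ennreal_ofReal] at hd0
  have h2c : 0 < (2 * c)⁻¹ := by positivity
  refine ⟨x + (2 * c)⁻¹ • e, (2 * c)⁻¹, h2c, hs.eq_closedBall_of_ae hΩ.isClosed h2c ?_ ?_⟩
  · filter_upwards [hb0] with y hy hyΩ
    have h3 := hy hyΩ
    rw [ENNReal.ofReal_eq_zero, neg_nonpos] at h3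
    have h4 : c * ‖y - x‖ ^ 2 ≤ inner ℝ e (y - x) :=
      not_lt.1 fun h' => not_lt.2 h3 ((bathtubKernel_neg_iff e c _).2 h')
    have h5 : y - x ∈ closedBall ((2 * c)⁻¹ • e) (2 * c)⁻¹ := by
      rw [← setOf_le_inner_eq_closedBall he hc]; exact h4
    rw [mem_closedBall, dist_eq_norm] at h5 ⊢
    rwa [← sub_sub]
  · filter_upwards [hd0] with y hy hyΩ hyb
    have h3 := hy hyΩ
    rw [ENNReal.ofReal_eq_zero] at h3
    have h5 : y - x ∈ ball ((2 * c)⁻¹ • e) (2 * c)⁻¹ := by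
      rw [mem_ball, dist_eq_norm] at hyb ⊢
      rwa [sub_sub]
    rw [← setOf_lt_inner_eq_ball he hc] at h5
    exact not_lt.2 h3 ((bathtubKernel_pos_iff e c _).2 h5)

end LiquidDrop

end

/-! ### Damped and excess fields, the two inequalities, and equality -/

noncomputable section

namespace LiquidDrop


open Set Filter Topology Metric

theorem softPotential_le_zero {Ω : Set E3} (hΩ : IsCompact Ω) (δ : ℝ) (x : E3) :
    softPotential Ω δ x ≤ softPotential Ω 0 x := by
  have hne : ∀ᵐ y : E3, y ≠ x := by simp [ae_iff]
  refine integral_mono_ae (integrableOn_softPotential hΩ δ x) (integrableOn_softPotential hΩ 0 x) ?_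
  filter_upwards [ae_restrict_of_ae hne] with y hy
  refine (softPow_neg_half_le δ (sub_ne_zero.2 hy.symm)).trans_eq ?_
  rw [softPow_neg_half, zero_pow two_ne_zero, add_zero, Real.sqrt_sq (norm_nonneg _)]

theorem newtonianPotential_eq {Ω : Set E3} (hΩ : IsCompact Ω) (x : E3) :
    newtonianPotential Ω x = ENNReal.ofReal (softPotential Ω 0 x) := by
  have hne : ∀ᵐ y : E3, y ≠ x := by simp [ae_iff]
  rw [newtonianPotential, softPotential, ofReal_integral_eq_lintegral_ofReal
    (integrableOn_softPotential hΩ 0 x) (Eventually.of_forall fun y => softPow_nonneg _ _ _)]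
  refine lintegral_congr_ae ?_
  filter_upwards [ae_restrict_of_ae hne] with y hy
  have h1 : 0 < ‖x - y‖ := norm_pos_iff.2 (sub_ne_zero.2 hy.symm)
  rw [softPow_neg_half, zero_pow two_ne_zero, add_zero, Real.sqrt_sq h1.le,
    ENNReal.ofReal_inv_of_pos h1, ofReal_norm]

theorem continuous_softPotential_zero {Ω : Set E3} (hΩ : IsCompact Ω)
    (h0 : volume (frontier Ω) = 0) : Continuous (softPotential Ω 0) := by
  have : Continuous fun x => softPotential Ω ((0 : ℝ), x).1 ((0 : ℝ), x).2 :=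
    (continuous_softPotential hΩ h0).comp (Continuous.prodMk_right (0 : ℝ))
  exact this

/-- The integral of the Newtonian potential against a finite measure on a compact set. -/
theorem setLIntegral_newtonianPotential {Ω K : Set E3} (hΩ : IsCompact Ω)
    (h0 : volume (frontier Ω) = 0) (hK : IsCompact K) (μ : Measure E3)
    [IsFiniteMeasure (μ.restrict K)] :
    ∫⁻ x in K, newtonianPotential Ω x ∂μ = ENNReal.ofReal (∫ x in K, softPotential Ω 0 x ∂μ) ∧
      IntegrableOn (softPotential Ω 0) K μ := by
  have hc := continuous_softPotential_zero hΩ h0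
  have hi : IntegrableOn (softPotential Ω 0) K μ := by
    obtain ⟨C, hC⟩ := hK.exists_bound_of_continuousOn hc.continuousOn
    refine Integrable.of_bound hc.aestronglyMeasurable C ?_
    filter_upwards [ae_restrict_mem hK.measurableSet] with x hx using hC x hx
  refine ⟨?_, hi⟩
  rw [ofReal_integral_eq_lintegral_ofReal hi
    (Eventually.of_forall fun x => integral_nonneg fun y => softPow_nonneg _ _ _)]
  simp only [newtonianPotential_eq hΩ]

theorem isCompact_frontier_of_isCompact {Ω : Set E3} (hΩ : IsCompact Ω) : IsCompact (frontier Ω) :=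
  hΩ.of_isClosed_subset isClosed_frontier (frontier_subset_iff_isClosed.2 hΩ.isClosed)

theorem HasSmoothBoundary.coulombEnergy_eq {Ω : Set E3} (hΩ : IsCompact Ω)
    (hs : HasSmoothBoundary Ω) :
    coulombEnergy Ω = ENNReal.ofReal (1 / 2 * ∫ x in Ω, softPotential Ω 0 x) := by
  have : IsFiniteMeasure (volume.restrict Ω) := ⟨by simpa using hΩ.measure_lt_top⟩
  rw [coulombEnergy, (setLIntegral_newtonianPotential hΩ (hs.volume_frontier hΩ) hΩ volume).1,
    ENNReal.ofReal_mul (by norm_num), one_div, ENNReal.ofReal_inv_of_pos two_pos,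
    ENNReal.ofReal_ofNat]

theorem HasSmoothBoundary.boundaryCoulombEnergy_eq {Ω : Set E3} (hΩ : IsCompact Ω)
    (hs : HasSmoothBoundary Ω) :
    boundaryCoulombEnergy Ω = ENNReal.ofReal (∫ x, softPotential Ω 0 x ∂(surfaceMeasure Ω)) := by
  have := isFiniteMeasure_surfaceMeasure hΩ hs
  rw [surfaceMeasure] at this
  exact (setLIntegral_newtonianPotential hΩ (hs.volume_frontier hΩ)
    (isCompact_frontier_of_isCompact hΩ) _).1

theorem divergence_add {X Y : E3 → E3} {x : E3} (hX : DifferentiableAt ℝ X x)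
    (hY : DifferentiableAt ℝ Y x) :
    divergence (fun x => X x + Y x) x = divergence X x + divergence Y x := by
  have : fderiv ℝ (fun x => X x + Y x) x = fderiv ℝ X x + fderiv ℝ Y x := fderiv_add hX hY
  simp [divergence, this, Finset.sum_add_distrib]

/-- A smooth substitute for `min 1 √(s / V)`, where `V` is the softened potential. -/
def damping (Ω : Set E3) (δ s : ℝ) (x : E3) : ℝ := -(s * (s + softPotential Ω δ x)⁻¹)

theorem contDiff_damping {Ω : Set E3} (hΩ : IsCompact Ω) (hv : volume Ω ≠ 0) {δ : ℝ} (hδ : δ ≠ 0)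
    {s : ℝ} (hs : 0 < s) : ContDiff ℝ 1 (damping Ω δ s) := by
  refine (contDiff_const.mul (ContDiff.inv (contDiff_const.add (contDiff_softPotential hΩ hδ))
    fun x => ?_)).neg
  have := softPotential_pos hΩ hv δ x
  positivity

/-- The part of the negative softened field that is bounded in terms of `s`. -/
def dampedField (Ω : Set E3) (δ s : ℝ) (x : E3) : E3 := damping Ω δ s x • softField Ω δ x

/-- The complement of `dampedField` in the negative softened field. -/
def excessField (Ω : Set E3) (δ s : ℝ) (x : E3) : E3 := (-1 - damping Ω δ s x) • softField Ω δ x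

theorem contDiff_dampedField {Ω : Set E3} (hΩ : IsCompact Ω) (hv : volume Ω ≠ 0) {δ : ℝ}
    (hδ : δ ≠ 0) {s : ℝ} (hs : 0 < s) : ContDiff ℝ 1 (dampedField Ω δ s) :=
  contDiff_smul_field (contDiff_damping hΩ hv hδ hs) (contDiff_softField hΩ hδ)

theorem contDiff_excessField {Ω : Set E3} (hΩ : IsCompact Ω) (hv : volume Ω ≠ 0) {δ : ℝ}
    (hδ : δ ≠ 0) {s : ℝ} (hs : 0 < s) : ContDiff ℝ 1 (excessField Ω δ s) :=
  contDiff_smul_field (contDiff_const.sub (contDiff_damping hΩ hv hδ hs)) (contDiff_softField hΩ hδ)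

/-- The arithmetic-geometric mean inequality in the form `t² q / (t² + q²) ≤ t/2`, with `q` the root
of the potential. -/
theorem norm_dampedField_le {Ω : Set E3} (hΩ : IsCompact Ω) (hv : volume Ω ≠ 0) {δ t K : ℝ}
    (ht : 0 < t) (hK : 0 < K) {x : E3} (h : ‖softField Ω δ x‖ ^ 2 ≤ K ^ 2 * softPotential Ω δ x) :
    ‖dampedField Ω δ (t ^ 2) x‖ ≤ K * (t / 2) := by
  have hV := softPotential_pos hΩ hv δ x
  have h1 : ‖softField Ω δ x‖ ≤ K * √(softPotential Ω δ x) := by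
    refine abs_le_of_sq_le_sq' ?_ (by positivity) |>.2
    rwa [mul_pow, Real.sq_sqrt hV.le]
  have hq := Real.sq_sqrt hV.le
  have hq0 := Real.sqrt_nonneg (softPotential Ω δ x)
  rw [dampedField, norm_smul, damping, norm_neg, Real.norm_of_nonneg (by positivity)]
  refine (mul_le_mul_of_nonneg_left h1 (by positivity)).trans ?_
  generalize √(softPotential Ω δ x) = q at *
  rw [← hq, ← div_eq_mul_inv, div_mul_eq_mul_div, div_le_iff₀ (by positivity)]
  have : 0 ≤ K * t * (t - q) ^ 2 := by positivity
  nlinarith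

/-- The same inequality for the complementary factor: `q³ / (t² + q²) ≤ q² / (2 t)`. -/
theorem norm_excessField_le {Ω : Set E3} (hΩ : IsCompact Ω) (hv : volume Ω ≠ 0) {δ t K : ℝ}
    (ht : 0 < t) (hK : 0 < K) {x : E3} (h : ‖softField Ω δ x‖ ^ 2 ≤ K ^ 2 * softPotential Ω δ x) :
    ‖excessField Ω δ (t ^ 2) x‖ ≤ K * (2 * t)⁻¹ * softPotential Ω δ x := by
  have hV := softPotential_pos hΩ hv δ x
  have h1 : ‖softField Ω δ x‖ ≤ K * √(softPotential Ω δ x) := by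
    refine abs_le_of_sq_le_sq' ?_ (by positivity) |>.2
    rwa [mul_pow, Real.sq_sqrt hV.le]
  have hq := Real.sq_sqrt hV.le
  have hq0 := Real.sqrt_nonneg (softPotential Ω δ x)
  have h2 : -1 - damping Ω δ (t ^ 2) x =
      -(softPotential Ω δ x * (t ^ 2 + softPotential Ω δ x)⁻¹) := by
    rw [damping]; field_simp; ring
  rw [excessField, norm_smul, h2, norm_neg, Real.norm_of_nonneg (by positivity)]
  refine (mul_le_mul_of_nonneg_left h1 (by positivity)).trans ?_
  generalize √(softPotential Ω δ x) = q at *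
  rw [← hq, ← div_eq_mul_inv, div_mul_eq_mul_div, div_le_iff₀ (by positivity)]
  have h3 : K * (2 * t)⁻¹ * q ^ 2 * (t ^ 2 + q ^ 2) - q ^ 2 * (K * q) =
      K * (2 * t)⁻¹ * q ^ 2 * (t - q) ^ 2 := by field_simp; ring
  have : 0 ≤ K * (2 * t)⁻¹ * q ^ 2 * (t - q) ^ 2 := by positivity
  linarith

/-- The gradient of the damping factor contributes a nonnegative multiple of `‖softField Ω δ x‖²`,
which is dropped. The factor `4s/(s + V)` is bounded below by its tangent `3 - V/s` at `V = s`; the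
difference is a multiple of `(s - V)²`. Finally, the density is at most one and softening only
lowers the potential. -/
theorem divergence_dampedField_ge {Ω : Set E3} (hΩ : IsCompact Ω) (hv : volume Ω ≠ 0) {δ : ℝ}
    (hδ : δ ≠ 0) {s : ℝ} (hs : 0 < s) (x : E3) :
    Real.pi * (3 * softDensity Ω δ x - s⁻¹ * softPotential Ω 0 x) ≤
      divergence (dampedField Ω δ s) x := by
  have hV := softPotential_pos hΩ hv δ x
  have hd : HasFDerivAt (damping Ω δ s)
      (-(s • -((s + softPotential Ω δ x) ^ 2)⁻¹ • fderiv ℝ (softPotential Ω δ) x)) x := by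
    have e1 := (((contDiff_softPotential hΩ hδ).differentiable one_ne_zero x).hasFDerivAt.const_add
      s)
    exact (((hasDerivAt_inv (by positivity : s + softPotential Ω δ x ≠ 0)).comp_hasFDerivAt x
      e1).const_mul s).neg
  have h1 : divergence (dampedField Ω δ s) x =
      4 * Real.pi * (s * (s + softPotential Ω δ x)⁻¹) * softDensity Ω δ x +
        s * ((s + softPotential Ω δ x) ^ 2)⁻¹ * ‖softField Ω δ x‖ ^ 2 := by
    have e2 := divergence_smul (hd.differentiableAt)
      ((contDiff_softField hΩ hδ).differentiable one_ne_zero x)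
    refine e2.trans ?_
    rw [hd.fderiv, divergence_softField hΩ hδ, damping]
    simp only [neg_apply, smul_apply, fderiv_softPotential hΩ hδ,
      real_inner_self_eq_norm_sq, smul_eq_mul]
    ring
  have h2 : 3 - s⁻¹ * softPotential Ω δ x ≤ 4 * (s * (s + softPotential Ω δ x)⁻¹) := by
    rw [← sub_nonneg]
    have : 4 * (s * (s + softPotential Ω δ x)⁻¹) - (3 - s⁻¹ * softPotential Ω δ x) =
      (s - softPotential Ω δ x) ^ 2 * (s⁻¹ * (s + softPotential Ω δ x)⁻¹) := by
      field_simp; ring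
    rw [this]
    positivity
  have hw0 := softDensity_nonneg Ω δ x
  have hw1 := softDensity_le_one hΩ hδ x
  have hV0 := softPotential_le_zero hΩ δ x
  have h3 : s⁻¹ * softPotential Ω δ x * softDensity Ω δ x ≤ s⁻¹ * softPotential Ω 0 x := by
    refine (mul_le_of_le_one_right (by positivity) hw1).trans ?_
    gcongr
  have h4 := mul_le_mul_of_nonneg_right h2 hw0
  have h5 : 0 ≤ s * ((s + softPotential Ω δ x) ^ 2)⁻¹ * ‖softField Ω δ x‖ ^ 2 := by positivity
  rw [h1]
  have h6 := mul_le_mul_of_nonneg_left (show 3 * softDensity Ω δ x - s⁻¹ * softPotential Ω 0 x ≤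
    4 * (s * (s + softPotential Ω δ x)⁻¹) * softDensity Ω δ x by linarith) Real.pi_pos.le
  linarith

theorem divergence_dampedField_add_excessField {Ω : Set E3} (hΩ : IsCompact Ω) (hv : volume Ω ≠ 0)
    {δ : ℝ} (hδ : δ ≠ 0) {s : ℝ} (hs : 0 < s) (x : E3) :
    divergence (dampedField Ω δ s) x + divergence (excessField Ω δ s) x =
      4 * Real.pi * softDensity Ω δ x := by
  rw [← divergence_add ((contDiff_dampedField hΩ hv hδ hs).differentiable one_ne_zero x)
    ((contDiff_excessField hΩ hv hδ hs).differentiable one_ne_zero x)]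
  have h1 : (fun x => dampedField Ω δ s x + excessField Ω δ s x) =
      fun x => (fun _ => (-1 : ℝ)) x • softField Ω δ x := by
    ext1 x
    rw [dampedField, excessField, ← add_smul]
    ring_nf
  rw [h1, divergence_smul (by fun_prop) ((contDiff_softField hΩ hδ).differentiable one_ne_zero x),
    divergence_softField hΩ hδ]
  simp

theorem integrableOn_divergence {Ω : Set E3} (hΩ : IsCompact Ω) {X : E3 → E3}
    (hX : ContDiff ℝ 1 X) : IntegrableOn (divergence X) Ω :=
  (continuous_divergence hX).continuousOn.integrableOn_compact hΩ

/-- Bound the flux of the damped field below by its divergence and above by its length times the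
perimeter, then let `δ → 0`. -/
theorem HasSmoothBoundary.volume_sub_integral_softPotential_le {Ω : Set E3} (hΩ : IsCompact Ω)
    (hv : volume Ω ≠ 0) (hs : HasSmoothBoundary Ω) {t : ℝ} (ht : 0 < t) :
    Real.pi * (3 * volume.real Ω - (t ^ 2)⁻¹ * ∫ x in Ω, softPotential Ω 0 x) ≤
      √(4 * Real.pi / 3) * (t / 2) * (perimeter Ω).toReal := by
  have h0 := hs.volume_frontier hΩ
  refine le_of_tendsto ((((tendsto_integral_softDensity hΩ h0).const_mul 3).sub_const _).const_mul
    Real.pi) ?_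
  filter_upwards [self_mem_nhdsWithin] with δ hδ
  have hA := contDiff_dampedField hΩ hv hδ (pow_pos ht 2)
  have hK : 0 < √(4 * Real.pi / 3) := by positivity
  have hV : IntegrableOn (softPotential Ω 0) Ω :=
    (continuous_softPotential_zero hΩ h0).continuousOn.integrableOn_compact hΩ
  have hw : IntegrableOn (softDensity Ω δ) Ω :=
    (continuous_softDensity hΩ hδ).continuousOn.integrableOn_compact hΩ
  refine le_trans ?_ (hs.integral_divergence_le_mul_perimeter hΩ hA (by positivity) isOpen_univ
    (subset_univ _) fun x _ => norm_dampedField_le hΩ hv ht hK ?_)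
  · rw [← integral_const_mul, ← integral_const_mul,
      ← integral_sub (hw.const_mul _) (hV.const_mul _), ← integral_const_mul]
    exact integral_mono (((hw.const_mul _).sub (hV.const_mul _)).const_mul _)
      (integrableOn_divergence hΩ hA)
      fun x => divergence_dampedField_ge hΩ hv hδ (pow_pos ht 2) x
  · rw [Real.sq_sqrt (by positivity)]
    exact norm_softField_sq_le hΩ hv δ x

/-- The damped field is charged to the perimeter and the excess field to the boundary energy. The
field bound is required only near the boundary and with an arbitrary `K`, so that the equality
argument can insert a better constant. -/
theorem HasSmoothBoundary.volume_le_of_norm_softField_sq_le {Ω : Set E3} (hΩ : IsCompact Ω)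
    (hv : volume Ω ≠ 0) (hs : HasSmoothBoundary Ω) {t K : ℝ} (ht : 0 < t) (hK : 0 < K)
    {N : Set E3} (hN : IsOpen N) (hΩN : frontier Ω ⊆ N)
    (h : ∀ᶠ δ in 𝓝[≠] 0, ∀ x ∈ N, ‖softField Ω δ x‖ ^ 2 ≤ K ^ 2 * softPotential Ω δ x) :
    4 * Real.pi * volume.real Ω ≤ K * (t / 2) * (perimeter Ω).toReal +
      K * (2 * t)⁻¹ * ∫ x, softPotential Ω 0 x ∂(surfaceMeasure Ω) := by
  have h0 := hs.volume_frontier hΩ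
  refine le_of_tendsto ((tendsto_integral_softDensity hΩ h0).const_mul (4 * Real.pi)) ?_
  filter_upwards [self_mem_nhdsWithin, h] with δ hδ hδN
  have hA := contDiff_dampedField hΩ hv hδ (pow_pos ht 2)
  have hB := contDiff_excessField hΩ hv hδ (pow_pos ht 2)
  have hfin := isFiniteMeasure_surfaceMeasure hΩ hs
  have hV : Integrable (softPotential Ω 0) (surfaceMeasure Ω) := by
    rw [surfaceMeasure] at hfin
    exact (setLIntegral_newtonianPotential hΩ h0 (isCompact_frontier_of_isCompact hΩ) _).2
  rw [← integral_const_mul]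
  simp_rw [← divergence_dampedField_add_excessField hΩ hv hδ (pow_pos ht 2)]
  rw [integral_add (integrableOn_divergence hΩ hA) (integrableOn_divergence hΩ hB)]
  refine add_le_add (hs.integral_divergence_le_mul_perimeter hΩ hA (by positivity) hN hΩN
    fun x hx => norm_dampedField_le hΩ hv ht hK (hδN x hx)) ?_
  refine (hs.integral_divergence_le hΩ hB).trans ?_
  rw [← integral_const_mul]
  refine integral_mono_of_nonneg (Eventually.of_forall fun x => norm_nonneg _)
    (hV.const_mul _) ?_
  filter_upwards [ae_restrict_mem isClosed_frontier.measurableSet] with x hx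
  refine (norm_excessField_le hΩ hv ht hK (hδN x (hΩN hx))).trans ?_
  have := softPotential_le_zero hΩ δ x
  gcongr

/-- Multiplied by `t`, the hypothesis says that a quadratic polynomial is nonnegative; for `t ≤ 0`
this is clear from the signs. Its discriminant is therefore nonpositive. -/
theorem sq_le_mul_of_forall_pos {m p d : ℝ} (hm : 0 ≤ m) (hp : 0 ≤ p) (hd : 0 ≤ d)
    (h : ∀ t > 0, 2 * m ≤ t * p + t⁻¹ * d) : m ^ 2 ≤ p * d := by
  have h1 : ∀ t : ℝ, 0 ≤ p * (t * t) + -(2 * m) * t + d := by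
    intro t
    rcases le_or_gt t 0 with ht | ht
    · have : 0 ≤ p * (t * t) := mul_nonneg hp (mul_self_nonneg t)
      nlinarith
    · have h2 := mul_le_mul_of_nonneg_left (h t ht) ht.le
      have h3 : t * (t * p + t⁻¹ * d) = p * (t * t) + d := by field_simp
      linarith
  have h4 := discrim_le_zero h1
  rw [discrim] at h4
  linarith

/-- The inequality between volume, perimeter and boundary energy, with a constant `K` that
improves if the field on the boundary is weaker than for a ball. -/
theorem HasSmoothBoundary.volume_sq_le_of_norm_softField_sq_le {Ω : Set E3} (hΩ : IsCompact Ω)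
    (hv : volume Ω ≠ 0) (hs : HasSmoothBoundary Ω) {K : ℝ} (hK : 0 < K)
    {N : Set E3} (hN : IsOpen N) (hΩN : frontier Ω ⊆ N)
    (h : ∀ᶠ δ in 𝓝[≠] 0, ∀ x ∈ N, ‖softField Ω δ x‖ ^ 2 ≤ K ^ 2 * softPotential Ω δ x) :
    16 * Real.pi ^ 2 * volume.real Ω ^ 2 ≤
      K ^ 2 * ((perimeter Ω).toReal * (boundaryCoulombEnergy Ω).toReal) := by
  have hD : (boundaryCoulombEnergy Ω).toReal = ∫ x, softPotential Ω 0 x ∂(surfaceMeasure Ω) := by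
    rw [hs.boundaryCoulombEnergy_eq hΩ, ENNReal.toReal_ofReal]
    exact integral_nonneg fun x => (softPotential_pos hΩ hv 0 x).le
  have h1 := sq_le_mul_of_forall_pos (m := 4 * Real.pi * volume.real Ω)
    (p := K * (perimeter Ω).toReal) (d := K * (boundaryCoulombEnergy Ω).toReal)
    (by positivity) (by positivity) (by positivity) fun t ht => by
      have := hs.volume_le_of_norm_softField_sq_le hΩ hv ht hK hN hΩN h
      rw [← hD, mul_inv] at this
      linarith
  nlinarith

theorem HasSmoothBoundary.volume_pow_three_le {Ω : Set E3} (hΩ : IsCompact Ω)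
    (hv : volume Ω ≠ 0) (hs : HasSmoothBoundary Ω) :
    6 * Real.pi * volume.real Ω ^ 3 ≤ (perimeter Ω).toReal ^ 2 * (coulombEnergy Ω).toReal := by
  have hm : 0 < volume.real Ω := ENNReal.toReal_pos hv hΩ.measure_lt_top.ne
  set I := ∫ x in Ω, softPotential Ω 0 x with hI
  have hI0 : 0 ≤ I := integral_nonneg fun x => (softPotential_pos hΩ hv 0 x).le
  have hD : (coulombEnergy Ω).toReal = 1 / 2 * I := by
    rw [hs.coulombEnergy_eq hΩ, ENNReal.toReal_ofReal (by positivity)]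
  rw [hD]
  set m := volume.real Ω
  set P := (perimeter Ω).toReal
  have hP : 0 ≤ P := ENNReal.toReal_nonneg
  have key : ∀ t > 0, Real.pi * (3 * m - (t ^ 2)⁻¹ * I) ≤ √(4 * Real.pi / 3) * (t / 2) * P :=
    fun t ht => hs.volume_sub_integral_softPotential_le hΩ hv ht
  -- If `I` vanished, a sufficiently small `t` would give `3πm ≤ πm`.
  have hIpos : 0 < I := by
    refine hI0.lt_of_ne' fun hI' => ?_
    rw [hI'] at key
    have hc : 0 < √(4 * Real.pi / 3) * P + 1 := by positivity
    have h1 := key (m * Real.pi / (√(4 * Real.pi / 3) * P + 1)) (by positivity)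
    have h2 : √(4 * Real.pi / 3) * (m * Real.pi / (√(4 * Real.pi / 3) * P + 1) / 2) * P ≤
        m * Real.pi := by
      have : √(4 * Real.pi / 3) * (m * Real.pi / (√(4 * Real.pi / 3) * P + 1) / 2) * P =
        m * Real.pi * ((√(4 * Real.pi / 3) * P) / (2 * (√(4 * Real.pi / 3) * P + 1))) := by
        field_simp
      rw [this]
      refine mul_le_of_le_one_right (by positivity) ?_
      rw [div_le_one (by positivity)]
      have : 0 ≤ √(4 * Real.pi / 3) * P := by positivity
      linarith
    have : 0 < m * Real.pi := by positivity
    linarith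
  -- Here `t²` is the mean of the potential over `Ω`, and the left side becomes `2πm`.
  have h1 := key √(I / m) (by positivity)
  have h2 : √(I / m) ^ 2 = I / m := Real.sq_sqrt (by positivity)
  rw [h2] at h1
  have h3 : Real.pi * (3 * m - (I / m)⁻¹ * I) = 2 * Real.pi * m := by field_simp; ring
  rw [h3] at h1
  have h4 := pow_le_pow_left₀ (by positivity) h1 2
  have h5 : (√(4 * Real.pi / 3) * (√(I / m) / 2) * P) ^ 2 = Real.pi / 3 * (I / m) * P ^ 2 := by
    rw [mul_pow, mul_pow, div_pow, h2, Real.sq_sqrt (by positivity)]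
    ring
  rw [h5] at h4
  have h6 := mul_le_mul_of_nonneg_right h4 (show 0 ≤ 3 * m / (2 * Real.pi) by positivity)
  have h7 : Real.pi / 3 * (I / m) * P ^ 2 * (3 * m / (2 * Real.pi)) = P ^ 2 * (1 / 2 * I) := by
    field_simp
  have h8 : (2 * Real.pi * m) ^ 2 * (3 * m / (2 * Real.pi)) = 6 * Real.pi * m ^ 3 := by
    field_simp; ring
  linarith

theorem HasSmoothBoundary.volume_sq_le {Ω : Set E3} (hΩ : IsCompact Ω) (hv : volume Ω ≠ 0)
    (hs : HasSmoothBoundary Ω) :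
    12 * Real.pi * volume.real Ω ^ 2 ≤
      (perimeter Ω).toReal * (boundaryCoulombEnergy Ω).toReal := by
  have h1 := hs.volume_sq_le_of_norm_softField_sq_le hΩ hv (K := √(4 * Real.pi / 3)) (by positivity)
    isOpen_univ (subset_univ _) (Eventually.of_forall fun δ x _ => by
      rw [Real.sq_sqrt (by positivity)]; exact norm_softField_sq_le hΩ hv δ x)
  rw [Real.sq_sqrt (by positivity)] at h1
  refine le_of_mul_le_mul_left ?_ (show 0 < 4 * Real.pi / 3 by positivity)
  linarith

/-- Let `q` be the ratio of the two sides of the field bound. For a set that is not a ball, `q < 1`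
at `δ = 0`, hence `q < a < 1` on the compact boundary. Joint continuity extends this to small `δ`
and to a neighbourhood of the boundary. The improved constant contradicts equality, since the volume
is positive. -/
theorem HasSmoothBoundary.isRoundBall_of_volume_sq_eq {Ω : Set E3} (hΩ : IsCompact Ω)
    (hv : volume Ω ≠ 0) (hs : HasSmoothBoundary Ω)
    (h : 12 * Real.pi * volume.real Ω ^ 2 =
      (perimeter Ω).toReal * (boundaryCoulombEnergy Ω).toReal) : IsRoundBall Ω := by
  by_contra hball
  have hm : 0 < volume.real Ω := ENNReal.toReal_pos hv hΩ.measure_lt_top.ne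
  have h0 := hs.volume_frontier hΩ
  have hK := isCompact_frontier_of_isCompact hΩ
  set q : ℝ × E3 → ℝ := fun p =>
    ‖softField Ω p.1 p.2‖ ^ 2 / (4 * Real.pi / 3 * softPotential Ω p.1 p.2) with hq
  have hVpos : ∀ p : ℝ × E3, 0 < 4 * Real.pi / 3 * softPotential Ω p.1 p.2 := fun p => by
    have := softPotential_pos hΩ hv p.1 p.2
    positivity
  have hqc : Continuous q := ((continuous_softField hΩ h0).norm.pow 2).div
    (continuous_const.mul (continuous_softPotential hΩ h0)) fun p => (hVpos p).ne'
  have hlt : ∀ x, q (0, x) < 1 := fun x => by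
    rw [hq, div_lt_one (hVpos _)]
    exact (norm_softField_sq_le hΩ hv 0 x).lt_of_ne fun h' =>
      hball (hs.isRoundBall_of_norm_softField_sq_eq hΩ hv h')
  obtain ⟨a, ha0, ha1, ha⟩ : ∃ a, 0 < a ∧ a < 1 ∧ ∀ x ∈ frontier Ω, q (0, x) < a := by
    rcases (frontier Ω).eq_empty_or_nonempty with he | hne
    · exact ⟨1 / 2, by norm_num, by norm_num, by simp [he]⟩
    · obtain ⟨x, hx, hmax⟩ := hK.exists_isMaxOn hne
        (hqc.comp (Continuous.prodMk_right (0 : ℝ))).continuousOn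
      have h1 := hlt x
      have h2 : 0 ≤ q (0, x) := div_nonneg (by positivity) (hVpos _).le
      refine ⟨(1 + q (0, x)) / 2, by linarith, by linarith, fun y hy => ?_⟩
      have h3 : q (0, y) ≤ q (0, x) := hmax hy
      linarith
  -- The tube lemma gives one neighbourhood of the boundary that serves all small `δ`.
  obtain ⟨u, N, hu, hN, h0u, hΩN, huN⟩ := generalized_tube_lemma isCompact_singleton hK
    (isOpen_lt hqc continuous_const) (show {(0 : ℝ)} ×ˢ frontier Ω ⊆ {p | q p < a} by
      rintro ⟨δ, x⟩ ⟨rfl, hx⟩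
      exact ha x hx)
  have hev : ∀ᶠ δ in 𝓝[≠] 0, ∀ x ∈ N, ‖softField Ω δ x‖ ^ 2 ≤
      √(4 * Real.pi / 3 * a) ^ 2 * softPotential Ω δ x := by
    filter_upwards [mem_nhdsWithin_of_mem_nhds (hu.mem_nhds (singleton_subset_iff.1 h0u))]
      with δ hδ x hx
    have h1 : q (δ, x) < a := huN (mk_mem_prod hδ hx)
    rw [hq, div_lt_iff₀ (hVpos _)] at h1
    rw [Real.sq_sqrt (by positivity)]
    linarith
  have h1 := hs.volume_sq_le_of_norm_softField_sq_le hΩ hv (by positivity) hN hΩN hev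
  rw [Real.sq_sqrt (by positivity), ← h] at h1
  have h2 : 0 < 16 * Real.pi ^ 2 * volume.real Ω ^ 2 := by positivity
  nlinarith

theorem ball_ae_eq_closedBall (c : E3) (r : ℝ) :
    (ball c r : Set E3) =ᵐ[volume] closedBall c r := by
  rw [← ball_union_sphere]
  exact (union_ae_eq_left_of_ae_eq_empty
    (ae_eq_empty.2 (Measure.addHaar_sphere volume c r))).symm

/-- Seen from `x`, the ball has the origin on its boundary and its centre in direction `e`, so it is
the extremal ball of the bathtub kernel for `c = 1/(2r)`. -/
theorem newtonianPotential_closedBall {c : E3} {r : ℝ} (hr : 0 < r) {x : E3} (hx : x ∈ sphere c r) :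
    newtonianPotential (closedBall c r) x = ENNReal.ofReal (4 * Real.pi / 3 * r ^ 2) := by
  set e : E3 := r⁻¹ • (c - x)
  have he : ‖e‖ = 1 := by
    rw [norm_smul, norm_inv, Real.norm_of_nonneg hr.le, ← dist_eq_norm, dist_comm, mem_sphere.1 hx,
      inv_mul_cancel₀ hr.ne']
  have hc : 0 < (2 * r)⁻¹ := by positivity
  have h1 : (2 * (2 * r)⁻¹)⁻¹ = r := by field_simp
  have h2 : r • e = c - x := smul_inv_smul₀ hr.ne' _
  have h3 := lintegral_ball_enorm_inv he hc
  rw [h1, h2] at h3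
  have h4 : Real.pi / (3 * (2 * r)⁻¹ ^ 2) = 4 * Real.pi / 3 * r ^ 2 := by field_simp; ring
  rw [← h4, ← h3, newtonianPotential, ← setLIntegral_congr (ball_ae_eq_closedBall c r),
    ← lintegral_indicator measurableSet_ball, ← lintegral_indicator measurableSet_ball,
    ← lintegral_sub_right_eq_self ((ball (c - x) r).indicator fun z => ‖z‖ₑ⁻¹) x]
  congr 1 with y
  simp only [indicator, mem_ball, dist_eq_norm, sub_sub_sub_cancel_right, enorm_sub_rev x y]

/-- The potential is constant on the sphere, and both the perimeter and the area are at most `4πr²`.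
Upper bounds suffice, because the general inequality provides the opposite direction. -/
theorem perimeter_mul_boundaryCoulombEnergy_closedBall_le (c : E3) {r : ℝ} (hr : 0 < r) :
    (perimeter (closedBall c r)).toReal * (boundaryCoulombEnergy (closedBall c r)).toReal ≤
      12 * Real.pi * volume.real (closedBall c r) ^ 2 := by
  have hΩ : IsCompact (closedBall c r) := isCompact_closedBall c r
  have hs := hasSmoothBoundary_closedBall c hr
  have := isFiniteMeasure_surfaceMeasure hΩ hs
  have hσ := surfaceMeasure_closedBall_le c hr
  have hP : (perimeter (closedBall c r)).toReal ≤ 4 * Real.pi * r ^ 2 :=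
    (ENNReal.toReal_mono (measure_ne_top _ _) (hs.perimeter_le hΩ)).trans hσ
  have hD : (boundaryCoulombEnergy (closedBall c r)).toReal =
      4 * Real.pi / 3 * r ^ 2 * (surfaceMeasure (closedBall c r)).real univ := by
    have h1 : boundaryCoulombEnergy (closedBall c r) =
        ENNReal.ofReal (4 * Real.pi / 3 * r ^ 2) * surfaceMeasure (closedBall c r) univ := by
      rw [boundaryCoulombEnergy, ← lintegral_const, surfaceMeasure]
      refine setLIntegral_congr_fun isClosed_frontier.measurableSet fun x hx => ?_
      rw [frontier_closedBall c hr.ne'] at hx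
      exact newtonianPotential_closedBall hr hx
    rw [h1, ENNReal.toReal_mul, ENNReal.toReal_ofReal (by positivity), Measure.real]
  have hv : volume.real (closedBall c r) = r ^ 3 * (Real.pi * 4 / 3) := by
    rw [Measure.real, EuclideanSpace.volume_closedBall_fin_three,
      ENNReal.toReal_mul, ENNReal.toReal_pow, ENNReal.toReal_ofReal hr.le,
      ENNReal.toReal_ofReal (by positivity)]
  rw [hD, hv]
  calc _ ≤ 4 * Real.pi * r ^ 2 * (4 * Real.pi / 3 * r ^ 2 * (4 * Real.pi * r ^ 2)) := by gcongr
    _ = 12 * Real.pi * (r ^ 3 * (Real.pi * 4 / 3)) ^ 2 := by ring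

end LiquidDrop

end

theorem theorem4p1 (Ω : Set LiquidDrop.E3) (hne : Ω.Nonempty) (hc : IsCompact Ω)
    (hs : LiquidDrop.HasSmoothBoundary Ω) :
    LiquidDrop.perimeter Ω < ⊤ ∧
    LiquidDrop.coulombEnergy Ω < ⊤ ∧
    LiquidDrop.boundaryCoulombEnergy Ω < ⊤ ∧
    (volume Ω).toReal ^ 3 <
      3 / (16 * Real.pi) * (LiquidDrop.perimeter Ω).toReal ^ 2 *
        (LiquidDrop.coulombEnergy Ω).toReal ∧
    (volume Ω).toReal ^ 2 ≤
      1 / (12 * Real.pi) * (LiquidDrop.perimeter Ω).toReal *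
        (LiquidDrop.boundaryCoulombEnergy Ω).toReal ∧
    ((volume Ω).toReal ^ 2 =
      1 / (12 * Real.pi) * (LiquidDrop.perimeter Ω).toReal *
        (LiquidDrop.boundaryCoulombEnergy Ω).toReal ↔ LiquidDrop.IsRoundBall Ω) := by
  have hv := hs.volume_ne_zero hne
  have hm : 0 < volume.real Ω := ENNReal.toReal_pos hv hc.measure_lt_top.ne
  have hle := hs.volume_sq_le hc hv
  have hiff : ∀ p d : ℝ, 1 / (12 * Real.pi) * p * d = (p * d) / (12 * Real.pi) := fun p d => by
    field_simp
  have hpi : 0 < 12 * Real.pi := by positivity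
  refine ⟨hs.perimeter_lt_top hc, ?_, ?_, ?_, ?_, ?_, ?_⟩
  · rw [hs.coulombEnergy_eq hc]; exact ENNReal.ofReal_lt_top
  · rw [hs.boundaryCoulombEnergy_eq hc]; exact ENNReal.ofReal_lt_top
  · have h1 := hs.volume_pow_three_le hc hv
    have h2 : 0 < volume.real Ω ^ 3 := by positivity
    rw [mul_assoc, div_mul_eq_mul_div, lt_div_iff₀ (by positivity)]
    change volume.real Ω ^ 3 * (16 * Real.pi) < _
    -- Strictness comes from `6π > 16π/3` and positive volume.
    have h3 : 0 < Real.pi * volume.real Ω ^ 3 := by positivity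
    linarith
  · rw [hiff, le_div_iff₀ hpi, mul_comm]
    exact hle
  · intro h
    rw [hiff, eq_div_iff hpi.ne', mul_comm] at h
    exact hs.isRoundBall_of_volume_sq_eq hc hv h
  · rintro ⟨c, r, hr, rfl⟩
    rw [hiff, eq_div_iff hpi.ne', mul_comm]
    exact hle.antisymm (LiquidDrop.perimeter_mul_boundaryCoulombEnergy_closedBall_le c hr)
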